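/- Let $r,s$ be integers with $1<s<r$ and $r\not\equiv 2 \pmod 4$, and let $$\mathbb{R}H_{r,s}=\Big\{\big([x_0,\dots,x_r],[y_0,\dots,y_s]\big)\in\mathbb{R}P^r\times\mathbb{R}P^s \;\Big|\; x_0y_0+\cdots+x_sy_s=0\Big\}$$ be the real Milnor manifold. Let $\mathbb{Z}_2$ act freely and continuously on a compact Hausdorff space $X$ such that $H^*(X;\mathbb{Z}_2)$ and $H^*(\mathbb{R}H_{r,s};\mathbb{Z}_2)$ are isomorphic as graded $\mathbb{Z}_2$-algebras (the isomorphism need not be induced by a map), where $H^*$ denotes singular cohomology with the cup product. Then the induced action of $\mathbb{Z}_2$ on $H^*(X;\mathbb{Z}_2)$ is trivial, i.e. $g^*$ is the identity of $H^n(X;\mathbb{Z}_2)$ for all $g\in\mathbb{Z}_2$ and all $n\ge 0$. -/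

import Mathlib

open CategoryTheory Opposite
open scoped LinearAlgebra.Projectivization

universe u v

/-! ## Mod 2 cohomology of simplicial sets, with cup product -/

namespace SSetMod2

/-- The mod 2 cochains of degree `n` of a simplicial set: the functions on `n`-simplices with values
in `ZMod 2` (that is, the dual of the free `ZMod 2`-module on the `n`-simplices). -/
abbrev Cochain (K : SSet.{u}) (n : ℕ) : Type u := K.obj (op (SimplexCategory.mk n)) → ZMod 2

/-- The coboundary `(δ f)(σ) = ∑ i, f (dᵢ σ)`; modulo 2 no signs are needed. -/
def coboundary (K : SSet.{u}) (n : ℕ) : Cochain K n →ₗ[ZMod 2] Cochain K (n + 1) where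
  toFun f σ := ∑ i : Fin (n + 2), f (K.map (SimplexCategory.δ i).op σ)
  map_add' f g := by
    funext σ
    simp [Finset.sum_add_distrib]
  map_smul' c f := by
    funext σ
    simp [Finset.mul_sum]

theorem coboundary_apply (K : SSet.{u}) (n : ℕ) (f : Cochain K n)
    (σ : K.obj (op (SimplexCategory.mk (n + 1)))) :
    coboundary K n f σ = ∑ i : Fin (n + 2), f (K.map (SimplexCategory.δ i).op σ) := rfl

theorem coboundary_coboundary (K : SSet.{u}) (n : ℕ) (f : Cochain K n) :
    coboundary K (n + 1) (coboundary K n f) = 0 := by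
  funext σ
  simp only [coboundary_apply, Pi.zero_apply]
  rw [← Finset.sum_product', Finset.univ_product_univ]
  let S : Finset (Fin (n + 3) × Fin (n + 2)) := {ij | (ij.1 : ℕ) ≤ (ij.2 : ℕ)}
  rw [← Finset.sum_add_sum_compl S, ← CharTwo.add_self_eq_zero
    (∑ ij ∈ S, f (K.map (SimplexCategory.δ ij.2).op (K.map (SimplexCategory.δ ij.1).op σ)))]
  congr 1
  symm
  refine Finset.sum_bij'
    (fun ij hij ↦ (ij.2.succ, ij.1.castLT
      (lt_of_le_of_lt (Finset.mem_filter.mp hij).2 ij.2.is_lt)))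
    (fun ij hij ↦ (ij.2.castSucc, ij.1.pred (by
      rintro h
      simp [S, h] at hij))) ?_ ?_ ?_ ?_ ?_
  · rintro ⟨i, j⟩ hij
    simp [S] at hij ⊢
    omega
  · rintro ⟨i, j⟩ hij
    simp [S] at hij ⊢
    omega
  · rintro ⟨i, j⟩ hij
    simp
  · rintro ⟨i, j⟩ hij
    simp
  · rintro ⟨i, j⟩ hij
    have hij' : (i : ℕ) ≤ j := by simpa [S] using hij
    have hlt : (i : ℕ) < n + 2 := lt_of_le_of_lt hij' j.is_lt
    have h := SimplexCategory.δ_comp_δ (i := i.castLT hlt) (j := j) (by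
      rw [Fin.le_def]; exact hij')
    rw [Fin.castSucc_castLT] at h
    have h2 := congrArg (fun φ ↦ K.map φ.op σ) h
    simp only [op_comp, Functor.map_comp] at h2
    exact congrArg f h2.symm

/-- The cocycles of degree `n`. -/
def cocycles (K : SSet.{u}) (n : ℕ) : Submodule (ZMod 2) (Cochain K n) :=
  LinearMap.ker (coboundary K n)

/-- The coboundaries of degree `n`: zero in degree `0`, the image of the coboundary map otherwise. -/
def coboundaries (K : SSet.{u}) : (n : ℕ) → Submodule (ZMod 2) (Cochain K n)
  | 0 => ⊥
  | n + 1 => LinearMap.range (coboundary K n)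

/-- The `n`-th mod 2 cohomology of a simplicial set: cocycles modulo coboundaries. -/
abbrev H (K : SSet.{u}) (n : ℕ) : Type u :=
  (cocycles K n) ⧸ (coboundaries K n).submoduleOf (cocycles K n)

/-- The class of a cocycle. -/
def cls (K : SSet.{u}) (n : ℕ) : cocycles K n →ₗ[ZMod 2] H K n :=
  ((coboundaries K n).submoduleOf (cocycles K n)).mkQ

/-! ### Induced maps -/

section map

variable {K : SSet.{u}} {L : SSet.{u}}

/-- Pullback of cochains along a map of simplicial sets. -/
def cochainMap (φ : K ⟶ L) (n : ℕ) : Cochain L n →ₗ[ZMod 2] Cochain K n where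
  toFun f σ := f (φ.app _ σ)
  map_add' _ _ := rfl
  map_smul' _ _ := rfl

theorem coboundary_cochainMap (φ : K ⟶ L) (n : ℕ) (f : Cochain L n) :
    coboundary K n (cochainMap φ n f) = cochainMap φ (n + 1) (coboundary L n f) := by
  funext σ
  change ∑ i : Fin (n + 2), f (φ.app _ (K.map (SimplexCategory.δ i).op σ)) =
    ∑ i : Fin (n + 2), f (L.map (SimplexCategory.δ i).op (φ.app _ σ))
  refine Finset.sum_congr rfl fun i _ ↦ congrArg f ?_
  exact ConcreteCategory.congr_hom (φ.naturality (SimplexCategory.δ i).op) σ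

theorem cochainMap_mem_cocycles (φ : K ⟶ L) (n : ℕ) (f : Cochain L n) (hf : f ∈ cocycles L n) :
    cochainMap φ n f ∈ cocycles K n := by
  have hf' : coboundary L n f = 0 := hf
  change coboundary K n _ = 0
  rw [coboundary_cochainMap, hf', map_zero]

theorem cochainMap_mem_coboundaries (φ : K ⟶ L) (n : ℕ) (f : Cochain L n)
    (hf : f ∈ coboundaries L n) : cochainMap φ n f ∈ coboundaries K n := by
  cases n with
  | zero =>
    have hf' : f = 0 := hf
    rw [hf', map_zero]
    exact Submodule.zero_mem _
  | succ n =>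
    obtain ⟨e, rfl⟩ := hf
    exact ⟨cochainMap φ n e, coboundary_cochainMap φ n e⟩

/-- The map induced on cohomology. -/
def map (φ : K ⟶ L) (n : ℕ) : H L n →ₗ[ZMod 2] H K n :=
  Submodule.mapQ _ _
    ((cochainMap φ n).restrict (cochainMap_mem_cocycles φ n))
    (fun f hf ↦ cochainMap_mem_coboundaries φ n f.1 hf)

end map

/-! ### Cup product -/

section cup

variable (K : SSet.{u})

/-- The front face `[v₀, …, v_p]` of an `n`-simplex, `p ≤ n`. -/
def front {p n : ℕ} (h : p ≤ n) (σ : K.obj (op (SimplexCategory.mk n))) :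
    K.obj (op (SimplexCategory.mk p)) :=
  K.map (SimplexCategory.subinterval 0 p (by omega)).op σ

/-- The back face `[v_p, …, v_n]` of an `n`-simplex, `n = p + q`. -/
def back {p q n : ℕ} (h : p + q = n) (σ : K.obj (op (SimplexCategory.mk n))) :
    K.obj (op (SimplexCategory.mk q)) :=
  K.map (SimplexCategory.subinterval p q (by omega)).op σ

/-- The cup product of cochains, by the Alexander–Whitney formula
`(f ∪ g)[v₀, …, v_n] = f[v₀, …, v_p] * g[v_p, …, v_n]` for `n = p + q`. -/
def cochainCup {p q n : ℕ} (h : p + q = n) :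
    Cochain K p →ₗ[ZMod 2] Cochain K q →ₗ[ZMod 2] Cochain K n :=
  LinearMap.mk₂ (ZMod 2)
    (fun f g σ ↦ f (front K (Nat.le.intro h) σ) * g (back K h σ))
    (fun _ _ _ ↦ funext fun _ ↦ add_mul _ _ _)
    (fun _ _ _ ↦ funext fun _ ↦ mul_assoc _ _ _)
    (fun _ _ _ ↦ funext fun _ ↦ mul_add _ _ _)
    (fun _ _ _ ↦ funext fun _ ↦ mul_left_comm _ _ _)

theorem cochainCup_apply {p q n : ℕ} (h : p + q = n) (f : Cochain K p) (g : Cochain K q)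
    (σ : K.obj (op (SimplexCategory.mk n))) :
    cochainCup K h f g σ = f (front K (Nat.le.intro h) σ) * g (back K h σ) := rfl

/-- The Leibniz rule. -/
theorem coboundary_cochainCup {p q n : ℕ} (h : p + q = n) (f : Cochain K p) (g : Cochain K q) :
    coboundary K n (cochainCup K h f g) =
      cochainCup K (show p + 1 + q = n + 1 by omega) (coboundary K p f) g +
        cochainCup K (show p + (q + 1) = n + 1 by omega) f (coboundary K q g) := by
  subst h
  funext σ
  simp only [Pi.add_apply, cochainCup_apply, coboundary_apply]
  have e : p + 1 + (q + 1) = p + q + 2 := by omega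
  rw [← (finCongr e).sum_comp, Fin.sum_univ_add, Fin.sum_univ_castSucc (n := p + 1),
    Fin.sum_univ_succ (n := q + 1), add_mul, mul_add, Finset.sum_mul, Finset.mul_sum]
  have key : ∀ (m k : ℕ) (φ ψ : SimplexCategory.mk m ⟶ SimplexCategory.mk k)
      (τ : K.obj (op (SimplexCategory.mk k))),
      (∀ i, (φ.toOrderHom i : ℕ) = ψ.toOrderHom i) → K.map φ.op τ = K.map ψ.op τ := by
    intro m k φ ψ τ hφ
    have : φ = ψ := by
      ext i
      exact hφ i
    rw [this]
  have comp2 : ∀ (l m k : ℕ) (φ : SimplexCategory.mk l ⟶ SimplexCategory.mk m)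
      (ψ : SimplexCategory.mk m ⟶ SimplexCategory.mk k) (τ : K.obj (op (SimplexCategory.mk k))),
      K.map φ.op (K.map ψ.op τ) = K.map (φ ≫ ψ).op τ := by
    intro l m k φ ψ τ
    simp
  simp only [front, back, comp2]
  have hmid : ∀ x y z t : ZMod 2, x = z → y = t → ∀ c d, c = d →
      x + y = z + c + (d + t) := by
    rintro x y _ _ rfl rfl c _ rfl
    rw [add_assoc, ← add_assoc c c y, CharTwo.add_self_eq_zero, zero_add]
  have hδ : ∀ (m : ℕ) (i : Fin (m + 2)) (j : Fin (m + 1)),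
      ((SimplexCategory.δ i).toOrderHom j : ℕ) = if (j : ℕ) < i then (j : ℕ) else j + 1 := by
    intro m i j
    change ((Fin.succAbove i j : Fin (m + 2)) : ℕ) = _
    rw [Fin.succAbove]
    simp only [Fin.lt_def, Fin.val_castSucc]
    split_ifs <;> rfl
  have hs : ∀ (a l m : ℕ) (hl : a + l ≤ m) (j : Fin (l + 1)),
      ((SimplexCategory.subinterval a l hl).toOrderHom j : ℕ) = j + a := fun _ _ _ _ _ ↦ rfl
  have hc : ∀ (l m k : ℕ) (φ : SimplexCategory.mk l ⟶ SimplexCategory.mk m)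
      (ψ : SimplexCategory.mk m ⟶ SimplexCategory.mk k) (j : Fin (l + 1)),
      ((φ ≫ ψ).toOrderHom j : ℕ) = ψ.toOrderHom (φ.toOrderHom j) := fun _ _ _ _ _ _ ↦ rfl
  refine hmid _ _ _ _ (Finset.sum_congr rfl fun i _ ↦ ?_) (Finset.sum_congr rfl fun i _ ↦ ?_) _ _ ?_
  all_goals
    refine congrArg₂ (· * ·) (congrArg f (key _ _ _ _ _ fun j ↦ ?_))
      (congrArg g (key _ _ _ _ _ fun j ↦ ?_))
    all_goals
      have hj := j.is_lt
      dsimp only [SimplexCategory.len_mk] at j hj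
      simp only [hc, hδ, hs, finCongr_apply, Fin.val_cast, Fin.val_castAdd, Fin.val_natAdd,
        Fin.val_castSucc, Fin.val_succ, Fin.val_last, Fin.val_zero, Nat.not_lt_zero, if_false]
      first | omega | (split_ifs <;> omega)

theorem cochainCup_mem_cocycles {p q n : ℕ} (h : p + q = n) (f : Cochain K p) (g : Cochain K q)
    (hf : f ∈ cocycles K p) (hg : g ∈ cocycles K q) : cochainCup K h f g ∈ cocycles K n := by
  have hf' : coboundary K p f = 0 := hf
  have hg' : coboundary K q g = 0 := hg
  change coboundary K n _ = 0
  rw [coboundary_cochainCup, hf', hg', map_zero, map_zero, LinearMap.zero_apply, add_zero]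

theorem cochainCup_mem_coboundaries_left {p q n : ℕ} (h : p + q = n) (f : Cochain K p)
    (g : Cochain K q) (hf : f ∈ coboundaries K p) (hg : g ∈ cocycles K q) :
    cochainCup K h f g ∈ coboundaries K n := by
  have hg' : coboundary K q g = 0 := hg
  cases p with
  | zero =>
    have hf' : f = 0 := hf
    rw [hf', map_zero, LinearMap.zero_apply]
    exact Submodule.zero_mem _
  | succ p =>
    obtain ⟨e, rfl⟩ := hf
    obtain rfl : p + q + 1 = n := by omega
    refine ⟨cochainCup K rfl e g, ?_⟩
    rw [coboundary_cochainCup, hg', map_zero, add_zero]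

theorem cochainCup_mem_coboundaries_right {p q n : ℕ} (h : p + q = n) (f : Cochain K p)
    (g : Cochain K q) (hf : f ∈ cocycles K p) (hg : g ∈ coboundaries K q) :
    cochainCup K h f g ∈ coboundaries K n := by
  have hf' : coboundary K p f = 0 := hf
  cases q with
  | zero =>
    have hg' : g = 0 := hg
    rw [hg', map_zero]
    exact Submodule.zero_mem _
  | succ q =>
    obtain ⟨e, rfl⟩ := hg
    obtain rfl : p + q + 1 = n := by omega
    refine ⟨cochainCup K rfl f e, ?_⟩
    rw [coboundary_cochainCup, hf', map_zero, LinearMap.zero_apply, zero_add]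

/-- The cup product of two cocycles, as a cohomology class. -/
def cocycleCup {p q n : ℕ} (h : p + q = n) :
    cocycles K p →ₗ[ZMod 2] cocycles K q →ₗ[ZMod 2] H K n :=
  LinearMap.mk₂ (ZMod 2)
    (fun f g ↦ cls K n ⟨cochainCup K h f.1 g.1, cochainCup_mem_cocycles K h f.1 g.1 f.2 g.2⟩)
    (fun f f' g ↦ by
      rw [← map_add]
      exact congrArg _ (Subtype.ext (by simp)))
    (fun c f g ↦ by
      rw [← map_smul]
      exact congrArg _ (Subtype.ext (by simp)))
    (fun f g g' ↦ by
      rw [← map_add]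
      exact congrArg _ (Subtype.ext (by simp)))
    (fun c f g ↦ by
      rw [← map_smul]
      exact congrArg _ (Subtype.ext (by simp)))

/-- The cup product `Hᵖ × H^q → Hⁿ`, `n = p + q`, characterized by `cup_cls`. -/
def cup {p q n : ℕ} (h : p + q = n) : H K p →ₗ[ZMod 2] H K q →ₗ[ZMod 2] H K n :=
  Submodule.liftQ _
    (LinearMap.flip (Submodule.liftQ _ (cocycleCup K h).flip (by
      intro g hg
      ext f
      exact (Submodule.Quotient.mk_eq_zero _).2
        (cochainCup_mem_coboundaries_right K h f.1 g.1 f.2 hg))))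
    (by
      intro f hf
      apply LinearMap.ext
      intro y
      obtain ⟨g, rfl⟩ := Submodule.Quotient.mk_surjective _ y
      exact (Submodule.Quotient.mk_eq_zero _).2
        (cochainCup_mem_coboundaries_left K h f.1 g.1 hf g.2))

theorem cup_cls {p q n : ℕ} (h : p + q = n) (f : cocycles K p) (g : cocycles K q) :
    cup K h (cls K p f) (cls K q g) =
      cls K n ⟨cochainCup K h f.1 g.1, cochainCup_mem_cocycles K h f.1 g.1 f.2 g.2⟩ := rfl

theorem one_mem_cocycles : (fun _ ↦ 1 : Cochain K 0) ∈ cocycles K 0 := by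
  change coboundary K 0 _ = 0
  funext σ
  rw [coboundary_apply]
  exact CharTwo.add_self_eq_zero (1 : ZMod 2)

/-- The unit of the cohomology algebra: the class of the constant `0`-cochain `1`. -/
def one : H K 0 := cls K 0 ⟨fun _ ↦ 1, one_mem_cocycles K⟩

end cup

end SSetMod2

/-! ## Singular mod 2 cohomology of topological spaces -/

/-- The singular mod 2 cohomology `Hⁿ(X; ℤ/2)`. -/
abbrev Mod2Cohomology (X : Type u) [TopologicalSpace X] (n : ℕ) : Type u :=
  SSetMod2.H (TopCat.toSSet.obj (TopCat.of X)) n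

namespace Mod2Cohomology

/-- The homomorphism `φ^* : Hⁿ(Y; ℤ/2) → Hⁿ(X; ℤ/2)` induced by a continuous map `φ : X → Y`. -/
noncomputable def map {X Y : Type u} [TopologicalSpace X] [TopologicalSpace Y] (φ : C(X, Y))
    (n : ℕ) : Mod2Cohomology Y n →ₗ[ZMod 2] Mod2Cohomology X n :=
  SSetMod2.map (TopCat.toSSet.map (TopCat.ofHom φ)) n

/-- The cup product `Hᵖ(X; ℤ/2) × H^q(X; ℤ/2) → Hⁿ(X; ℤ/2)`, where `n = p + q`. -/
noncomputable def cup (X : Type u) [TopologicalSpace X] {p q n : ℕ} (h : p + q = n) :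
    Mod2Cohomology X p →ₗ[ZMod 2] Mod2Cohomology X q →ₗ[ZMod 2] Mod2Cohomology X n :=
  SSetMod2.cup _ h

/-- The unit `1 ∈ H⁰(X; ℤ/2)`. -/
noncomputable def one (X : Type u) [TopologicalSpace X] : Mod2Cohomology X 0 :=
  SSetMod2.one _

end Mod2Cohomology

/-- An isomorphism `H^*(Y; ℤ/2) ≅ H^*(X; ℤ/2)` of graded `ℤ/2`-algebras (not necessarily induced
by a map between the spaces): degreewise linear isomorphisms preserving unit and cup products. -/
structure Mod2CohomologyIso (X : Type u) [TopologicalSpace X] (Y : Type v) [TopologicalSpace Y] where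
  toEquiv (n : ℕ) : Mod2Cohomology Y n ≃ₗ[ZMod 2] Mod2Cohomology X n
  map_one : toEquiv 0 (Mod2Cohomology.one Y) = Mod2Cohomology.one X
  map_cup {p q n : ℕ} (h : p + q = n) (x : Mod2Cohomology Y p) (y : Mod2Cohomology Y q) :
    toEquiv n (Mod2Cohomology.cup Y h x y) =
      Mod2Cohomology.cup X h (toEquiv p x) (toEquiv q y)

/-! ## Real Milnor manifolds -/

/-- The topology of a projective space: the quotient topology from the nonzero vectors. -/
instance Projectivization.instTopologicalSpaceQuotient {𝕜 : Type u} {V : Type v} [DivisionRing 𝕜]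
    [AddCommGroup V] [Module 𝕜 V] [TopologicalSpace V] : TopologicalSpace (ℙ 𝕜 V) :=
  TopologicalSpace.coinduced (fun v : {v : V // v ≠ 0} ↦ Projectivization.mk' 𝕜 v) inferInstance

/-- Real projective `n`-space, the space of lines in `ℝⁿ⁺¹`. -/
abbrev RealProjectiveSpace (n : ℕ) : Type := ℙ ℝ (Fin (n + 1) → ℝ)

/-- The subset `{([x₀, …, x_r], [y₀, …, y_s]) | x₀ y₀ + ⋯ + x_s y_s = 0}` of `ℝP^r × ℝP^s`, `s ≤ r`
(the choice of homogeneous coordinates is irrelevant, see `mk_mem_realMilnorSet`). -/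
def realMilnorSet (r s : ℕ) (h : s ≤ r) : Set (RealProjectiveSpace r × RealProjectiveSpace s) :=
  {p | ∑ i : Fin (s + 1), p.1.rep (Fin.castLE (Nat.succ_le_succ h) i) * p.2.rep i = 0}

theorem mk_mem_realMilnorSet (r s : ℕ) (h : s ≤ r) (x : Fin (r + 1) → ℝ) (hx : x ≠ 0)
    (y : Fin (s + 1) → ℝ) (hy : y ≠ 0) :
    (Projectivization.mk ℝ x hx, Projectivization.mk ℝ y hy) ∈ realMilnorSet r s h ↔
      ∑ i : Fin (s + 1), x (Fin.castLE (Nat.succ_le_succ h) i) * y i = 0 := by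
  obtain ⟨a, ha⟩ := Projectivization.exists_smul_eq_mk_rep ℝ x hx
  obtain ⟨b, hb⟩ := Projectivization.exists_smul_eq_mk_rep ℝ y hy
  have hab : (a : ℝ) * b ≠ 0 := mul_ne_zero a.ne_zero b.ne_zero
  have key : ∑ i : Fin (s + 1), (a • x) (Fin.castLE (Nat.succ_le_succ h) i) * (b • y) i =
      ((a : ℝ) * b) * ∑ i : Fin (s + 1), x (Fin.castLE (Nat.succ_le_succ h) i) * y i := by
    rw [Finset.mul_sum]
    refine Finset.sum_congr rfl fun i _ ↦ ?_
    simp only [Pi.smul_apply, Units.smul_def, smul_eq_mul]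
    ring
  simp only [realMilnorSet, Set.mem_ofPred_eq]
  rw [← ha, ← hb, key, mul_eq_zero, or_iff_right hab]

/-- The real Milnor manifold `ℝH_{r,s}`, with the subspace topology from `ℝP^r × ℝP^s`. -/
abbrev RealMilnorManifold (r s : ℕ) (h : s ≤ r) : Type := realMilnorSet r s h

/-! ## The total cohomology and multiplication by classes of degree one -/

namespace SSetMod2

section basics

variable {K : SSet.{u}}

/-! Write `r = m + 1`. The mod 2 cohomology of the Milnor manifold is generated by two classes `a`,
`b` of degree one (from the two projective factors), with `a ^ (s + 1) = 0`, `b ^ (r + 1) = 0` and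
`∑ i ≤ s, aⁱ b ^ (r - i) = 0`. The monomials `aⁱ bʲ` with `i ≤ s`, `j ≤ m` form a basis, the top
class is `aˢ bᵐ`, and the total dimension is `(s + 1) * r` (`exists_milnorAlg`).

The free action enters only through a parity. The degree-one class `w` of the double cover `X → X /
ℤ₂` is nilpotent because `X` is compact Hausdorff. With finite cohomology upstairs, the Gysin
triangle then forces an even total Betti number (`even_finrank_of_free`), so `(s + 1) * r` is even.

The rest is algebra (`MilnorAlg.fixes_generators`). An automorphism sends `a` and `b` into `{a, b, a
+ b}`. The relation `a ^ (s + 1) = 0` excludes `a ↦ b`, and also `a ↦ a + b` when `s < m`; for `s =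
m` the latter needs `m` even, against the parity. So `a` is fixed, and `b ↦ a` contradicts
injectivity. If `b ↦ a + b`, multiplying the image of the sum relation by `a ^ (s - 1)` and by `a ^
(s - 2) b` shows that `r` is even and that `r.choose 2` is odd, that is `r ≡ 2 [MOD 4]`, which is
excluded. Since `a` and `b` generate, the action is trivial.

For the topological input, `Orb G X` (singular simplices modulo `G`) replaces quotient spaces: it
carries homotopy invariance, Mayer–Vietoris and the Gysin triangle, and equals the singular set of a
quotient along which simplices lift uniquely up to `G`. The cohomology of pairs of orthogonal
vectors `(x, y)`, with `y` in a subspace `W`, modulo the sign of `x`, is bounded by induction on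
`dim W` (`z_cohomology`); dividing by the sign of `y` gives generators and the top class
(`milnor_Z`). The sum relation is proved for `W = V`, where exchanging `x` and `y` is a symmetry
(`Milnor.sum_mon_eq_zero_of_swap`), and then restricted. -/

theorem cls_surjective (n : ℕ) : Function.Surjective (cls K n) :=
  Submodule.mkQ_surjective _

theorem cls_eq_zero_iff {n : ℕ} (f : cocycles K n) : cls K n f = 0 ↔ f.1 ∈ coboundaries K n :=
  Submodule.Quotient.mk_eq_zero _

theorem cls_eq_iff {n : ℕ} (f g : cocycles K n) :
    cls K n f = cls K n g ↔ f.1 + g.1 ∈ coboundaries K n := by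
  rw [← sub_eq_zero, ← map_sub, cls_eq_zero_iff]
  have : (f - g).1 = f.1 + g.1 := by
    change f.1 - g.1 = _
    funext σ
    exact CharTwo.sub_eq_add _ _
  rw [this]

theorem cochain_add_self {n : ℕ} (f : Cochain K n) : f + f = 0 := by
  funext σ
  exact CharTwo.add_self_eq_zero _

theorem cochain_add_eq_zero_iff {n : ℕ} {f g : Cochain K n} : f + g = 0 ↔ f = g := by
  refine ⟨fun h ↦ ?_, fun h ↦ h ▸ cochain_add_self f⟩
  funext σ
  exact CharTwo.add_eq_zero.1 (congrFun h σ)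

theorem H_add_self {n : ℕ} (x : H K n) : x + x = 0 := by
  obtain ⟨f, rfl⟩ := cls_surjective n x
  rw [← map_add, cls_eq_zero_iff]
  change f.1 + f.1 ∈ _
  rw [cochain_add_self]
  exact Submodule.zero_mem _

theorem mem_cocycles_iff {n : ℕ} (f : Cochain K n) : f ∈ cocycles K n ↔ coboundary K n f = 0 :=
  Iff.rfl

theorem coboundary_mem_cocycles {n : ℕ} (f : Cochain K n) :
    coboundary K n f ∈ cocycles K (n + 1) := coboundary_coboundary K n f

theorem mem_coboundaries_succ_iff {n : ℕ} (f : Cochain K (n + 1)) :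
    f ∈ coboundaries K (n + 1) ↔ ∃ g, coboundary K n g = f := Iff.rfl

theorem mem_coboundaries_zero_iff (f : Cochain K 0) :
    f ∈ coboundaries K 0 ↔ f = 0 := Iff.rfl

end basics

/-! ### Naturality of cohomology and of the cup product. -/

section functoriality

variable {K L M : SSet.{u}}

theorem map_cls (φ : K ⟶ L) (n : ℕ) (f : cocycles L n) :
    map φ n (cls L n f) = cls K n ⟨cochainMap φ n f.1, cochainMap_mem_cocycles φ n f.1 f.2⟩ := rfl

theorem cochainMap_apply (φ : K ⟶ L) (n : ℕ) (f : Cochain L n)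
    (σ : K.obj (op (SimplexCategory.mk n))) : cochainMap φ n f σ = f (φ.app _ σ) := rfl

theorem cochainMap_comp (φ : K ⟶ L) (ψ : L ⟶ M) (n : ℕ) (f : Cochain M n) :
    cochainMap (φ ≫ ψ) n f = cochainMap φ n (cochainMap ψ n f) := rfl

theorem map_comp (φ : K ⟶ L) (ψ : L ⟶ M) (n : ℕ) (x : H M n) :
    map (φ ≫ ψ) n x = map φ n (map ψ n x) := by
  obtain ⟨f, rfl⟩ := cls_surjective n x
  rfl

theorem map_id (n : ℕ) (x : H K n) : map (𝟙 K) n x = x := by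
  obtain ⟨f, rfl⟩ := cls_surjective n x
  rfl

theorem cochainMap_cup (φ : K ⟶ L) {p q n : ℕ} (h : p + q = n) (f : Cochain L p)
    (g : Cochain L q) :
    cochainMap φ n (cochainCup L h f g) =
      cochainCup K h (cochainMap φ p f) (cochainMap φ q g) := by
  funext σ
  simp only [cochainMap_apply, cochainCup_apply]
  congr 2
  · exact (ConcreteCategory.congr_hom (φ.naturality
      (SimplexCategory.subinterval 0 p (by omega)).op) σ).symm
  · exact (ConcreteCategory.congr_hom (φ.naturality
      (SimplexCategory.subinterval p q (by omega)).op) σ).symm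

theorem map_cup (φ : K ⟶ L) {p q n : ℕ} (h : p + q = n) (x : H L p) (y : H L q) :
    map φ n (cup L h x y) = cup K h (map φ p x) (map φ q y) := by
  obtain ⟨f, rfl⟩ := cls_surjective p x
  obtain ⟨g, rfl⟩ := cls_surjective q y
  simp only [cup_cls, map_cls]
  congr 2
  exact cochainMap_cup φ h f.1 g.1

theorem map_one (φ : K ⟶ L) : map φ 0 (one L) = one K := rfl

end functoriality

section total

variable (K : SSet.{u})

/-- The total cohomology, as a product. -/
abbrev T : Type u := (n : ℕ) → H K n

instance : AddCommGroup (T K) :=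
  @Pi.addCommGroup ℕ (fun n ↦ H K n)
    fun n ↦ Submodule.Quotient.addCommGroup ((coboundaries K n).submoduleOf (cocycles K n))

instance : Module (ZMod 2) (T K) :=
  Pi.module ℕ (fun n ↦ H K n) (ZMod 2)

/-- Left multiplication by a class of degree one. -/
def Lm : H K 1 →ₗ[ZMod 2] T K →ₗ[ZMod 2] T K :=
  LinearMap.mk₂ (ZMod 2)
    (fun c t n ↦ match n with
      | 0 => 0
      | n + 1 => cup K (add_comm 1 n) c (t n))
    (fun c c' t ↦ by
      funext n
      cases n with
      | zero => exact (add_zero _).symm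
      | succ n => simp)
    (fun a c t ↦ by
      funext n
      cases n with
      | zero => exact (smul_zero a).symm
      | succ n => simp)
    (fun c t t' ↦ by
      funext n
      cases n with
      | zero => exact (add_zero _).symm
      | succ n => simp)
    (fun a c t ↦ by
      funext n
      cases n with
      | zero => exact (smul_zero a).symm
      | succ n => simp)

/-- The unit of the total cohomology. -/
def T1 : T K := Pi.single 0 (one K)

variable {K}

theorem Lm_zero (c : H K 1) (t : T K) : Lm K c t 0 = 0 := rfl

theorem Lm_succ (c : H K 1) (t : T K) (n : ℕ) :
    Lm K c t (n + 1) = cup K (add_comm 1 n) c (t n) := rfl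

theorem Lm_single (c : H K 1) (n : ℕ) (x : H K n) :
    Lm K c (Pi.single n x) = Pi.single (n + 1) (cup K (add_comm 1 n) c x) := by
  funext m
  cases m with
  | zero =>
    rw [Lm_zero, Pi.single_eq_of_ne (by omega)]
  | succ m =>
    rw [Lm_succ]
    by_cases h : m = n
    · subst h
      simp
    · rw [Pi.single_eq_of_ne h, Pi.single_eq_of_ne (by omega), map_zero]

theorem cup_one_right (c : H K 1) : cup K (add_comm 1 0) c (one K) = c := by
  obtain ⟨f, rfl⟩ := cls_surjective 1 c
  rw [one, cup_cls]
  congr 1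
  ext σ
  change f.1 _ * 1 = f.1 σ
  rw [mul_one]
  have : front K (Nat.le.intro (add_comm 1 0)) σ = σ := by
    unfold front
    have : SimplexCategory.subinterval 0 1 (show 0 + 1 ≤ 1 by omega) = 𝟙 _ := by
      ext i
      rfl
    rw [this]
    simp
  rw [this]

theorem Lm_T1 (c : H K 1) : Lm K c (T1 K) = Pi.single 1 c := by
  rw [T1, Lm_single, cup_one_right]

/-- The pointwise product of 1-cochains is the cup-1 product: for 1-cocycles, `δ (c d) = c ∪ d + d ∪
c`. Everything is decided on the front 2-face of the simplex. -/
theorem cochainCup_comm_aux {n : ℕ} (c d : cocycles K 1) (t : cocycles K n) :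
    cochainCup K (add_comm 1 (n + 1)) c.1 (cochainCup K (add_comm 1 n) d.1 t.1) +
      cochainCup K (add_comm 1 (n + 1)) d.1 (cochainCup K (add_comm 1 n) c.1 t.1) =
    coboundary K (n + 1) (cochainCup K (add_comm 1 n) (fun τ ↦ c.1 τ * d.1 τ) t.1) := by
  have ht : coboundary K n t.1 = 0 := t.2
  rw [coboundary_cochainCup, ht, _root_.map_zero, add_zero]
  funext σ
  simp only [Pi.add_apply, cochainCup_apply]
  set ρ := front K (show 2 ≤ n + 1 + 1 by omega) σ with hρ
  have comp2 : ∀ (l m k : ℕ) (φ : SimplexCategory.mk l ⟶ SimplexCategory.mk m)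
      (ψ : SimplexCategory.mk m ⟶ SimplexCategory.mk k) (τ : K.obj (op (SimplexCategory.mk k))),
      K.map φ.op (K.map ψ.op τ) = K.map (φ ≫ ψ).op τ := by
    intro l m k φ ψ τ
    simp
  have key : ∀ (m k : ℕ) (φ ψ : SimplexCategory.mk m ⟶ SimplexCategory.mk k)
      (τ : K.obj (op (SimplexCategory.mk k))),
      (∀ i, (φ.toOrderHom i : ℕ) = ψ.toOrderHom i) → K.map φ.op τ = K.map ψ.op τ := by
    intro m k φ ψ τ hφ
    have : φ = ψ := by
      ext i
      exact hφ i
    rw [this]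
  have h1 : front K (Nat.le.intro (add_comm 1 (n + 1))) σ = K.map (SimplexCategory.δ 2).op ρ := by
    rw [hρ, front, front, comp2]
    refine key _ _ _ _ _ fun i ↦ ?_
    fin_cases i <;> rfl
  have h2 : front K (Nat.le.intro (add_comm 1 n)) (back K (add_comm 1 (n + 1)) σ) =
      K.map (SimplexCategory.δ 0).op ρ := by
    rw [hρ, front, front, back, comp2, comp2]
    refine key _ _ _ _ _ fun i ↦ ?_
    fin_cases i <;> rfl
  have h3 : back K (add_comm 1 n) (back K (add_comm 1 (n + 1)) σ) =
      back K (show 2 + n = n + 1 + 1 by omega) σ := by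
    rw [back, back, back, comp2]
    refine key _ _ _ _ _ fun i ↦ ?_
    change ((i : ℕ) + 1) + 1 = (i : ℕ) + 2
    omega
  rw [h1, h2, h3]
  have hc : coboundary K 1 c.1 ρ = 0 := congrFun c.2 ρ
  have hd : coboundary K 1 d.1 ρ = 0 := congrFun d.2 ρ
  rw [coboundary_apply, Fin.sum_univ_three] at hc hd
  change _ = (coboundary K 1 (fun τ ↦ c.1 τ * d.1 τ) ρ) * _
  rw [coboundary_apply, Fin.sum_univ_three, ← mul_assoc, ← mul_assoc, ← add_mul]
  congr 1
  -- Given `c1 = c0 + c2` and `d1 = d0 + d2`, what remains is `c2 d0 + d2 c0 = c0 d0 + c1 d1 + c2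
  -- d2` over the field with two elements.
  generalize c.1 (K.map (SimplexCategory.δ 0).op ρ) = c0 at *
  generalize c.1 (K.map (SimplexCategory.δ 1).op ρ) = c1 at *
  generalize c.1 (K.map (SimplexCategory.δ 2).op ρ) = c2 at *
  generalize d.1 (K.map (SimplexCategory.δ 0).op ρ) = d0 at *
  generalize d.1 (K.map (SimplexCategory.δ 1).op ρ) = d1 at *
  generalize d.1 (K.map (SimplexCategory.δ 2).op ρ) = d2 at *
  revert c0 c1 c2 d0 d1 d2
  decide

/-- Commutativity of multiplication by degree-one classes is all that is needed, since the algebras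
in question are generated in degree one. -/
theorem Lm_comm (c d : H K 1) (t : T K) : Lm K c (Lm K d t) = Lm K d (Lm K c t) := by
  funext n
  match n with
  | 0 => rfl
  | 1 => simp only [Lm_succ, Lm_zero, _root_.map_zero]
  | n + 2 =>
    simp only [Lm_succ]
    obtain ⟨c, rfl⟩ := cls_surjective 1 c
    obtain ⟨d, rfl⟩ := cls_surjective 1 d
    generalize t n = y
    obtain ⟨t, rfl⟩ := cls_surjective n y
    rw [cup_cls, cup_cls, cup_cls, cup_cls, cls_eq_iff]
    exact ⟨_, (cochainCup_comm_aux c d t).symm⟩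

theorem Lm_commute (c d : H K 1) : Commute (Lm K c) (Lm K d) :=
  LinearMap.ext fun t ↦ Lm_comm c d t

variable {L M : SSet.{u}}

/-- The map induced on total cohomology. -/
def Tmap (φ : K ⟶ L) : T L →ₗ[ZMod 2] T K :=
  LinearMap.pi fun n ↦ (map φ n) ∘ₗ LinearMap.proj n

theorem Tmap_apply (φ : K ⟶ L) (t : T L) (n : ℕ) : Tmap φ t n = map φ n (t n) := rfl

theorem Tmap_single (φ : K ⟶ L) (n : ℕ) (x : H L n) :
    Tmap φ (Pi.single n x) = Pi.single n (map φ n x) := by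
  funext m
  rw [Tmap_apply]
  by_cases h : m = n
  · subst h
    simp
  · rw [Pi.single_eq_of_ne h, Pi.single_eq_of_ne h, map_zero]

theorem Tmap_T1 (φ : K ⟶ L) : Tmap φ (T1 L) = T1 K := by
  rw [T1, Tmap_single, map_one, T1]

theorem Tmap_Lm (φ : K ⟶ L) (c : H L 1) (t : T L) :
    Tmap φ (Lm L c t) = Lm K (map φ 1 c) (Tmap φ t) := by
  funext n
  cases n with
  | zero => rw [Tmap_apply, Lm_zero, Lm_zero, map_zero]
  | succ n => rw [Tmap_apply, Lm_succ, Lm_succ, map_cup, Tmap_apply]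

theorem Tmap_Lm_pow (φ : K ⟶ L) (c : H L 1) (k : ℕ) (t : T L) :
    Tmap φ ((Lm L c ^ k) t) = (Lm K (map φ 1 c) ^ k) (Tmap φ t) := by
  induction k with
  | zero => rfl
  | succ k ih => rw [pow_succ', pow_succ', Module.End.mul_apply, Tmap_Lm, ih, Module.End.mul_apply]

theorem Tmap_comp (φ : K ⟶ L) (ψ : L ⟶ M) (t : T M) : Tmap (φ ≫ ψ) t = Tmap φ (Tmap ψ t) :=
  funext fun n ↦ map_comp φ ψ n (t n)

end total

/-! ### Passing from bijections on simplices to isomorphisms in cohomology. -/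

section iso

variable {K L : SSet.{u}}

theorem map_bijective_of_cochainMap_bijective (φ : K ⟶ L)
    (hφ : ∀ n, Function.Bijective (cochainMap φ n)) (n : ℕ) : Function.Bijective (map φ n) := by
  have hcoc : ∀ n (f : Cochain L n), cochainMap φ n f ∈ cocycles K n → f ∈ cocycles L n := by
    intro n f hf
    refine (hφ (n + 1)).1 ?_
    rw [← coboundary_cochainMap, map_zero]
    exact hf
  constructor
  · rw [injective_iff_map_eq_zero]
    intro x hx
    obtain ⟨f, rfl⟩ := cls_surjective n x
    rw [map_cls, cls_eq_zero_iff] at hx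
    rw [cls_eq_zero_iff]
    cases n with
    | zero => exact (hφ 0).1 (hx.trans (map_zero _).symm)
    | succ n =>
      obtain ⟨g, hg⟩ := hx
      obtain ⟨g, rfl⟩ := (hφ n).2 g
      rw [coboundary_cochainMap] at hg
      exact ⟨g, (hφ (n + 1)).1 hg⟩
  · intro y
    obtain ⟨f, rfl⟩ := cls_surjective n y
    obtain ⟨g, hg⟩ := (hφ n).2 f.1
    refine ⟨cls L n ⟨g, hcoc n g (hg ▸ f.2)⟩, ?_⟩
    rw [map_cls]
    congr 1
    exact Subtype.ext hg

theorem cochainMap_bijective_of_bijective (φ : K ⟶ L) (n : ℕ)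
    (hφ : Function.Bijective (φ.app (op (SimplexCategory.mk n)))) :
    Function.Bijective (cochainMap φ n) := by
  constructor
  · intro f g h
    funext σ
    obtain ⟨τ, rfl⟩ := hφ.2 σ
    exact congrFun h τ
  · intro f
    refine ⟨fun σ ↦ f ((Equiv.ofBijective _ hφ).symm σ), ?_⟩
    funext τ
    exact congrArg f ((Equiv.ofBijective _ hφ).symm_apply_apply τ)

theorem Tmap_bijective (φ : K ⟶ L) (hφ : ∀ n, Function.Bijective (map φ n)) :
    Function.Bijective (Tmap φ) := by
  constructor
  · intro s t h
    funext n
    exact (hφ n).1 (congrFun h n)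
  · intro t
    choose s hs using fun n ↦ (hφ n).2 (t n)
    exact ⟨s, funext hs⟩

end iso

end SSetMod2

/-! ## Linear algebra of exact triangles -/

section triangle

variable {M N : Type*} [AddCommGroup M] [Module (ZMod 2) M] [AddCommGroup N] [Module (ZMod 2) N]

/-- `W` maps `ker W ^ (j + 1)` into `ker W ^ j` with kernel inside `ker W`, so all these kernels are
finite, and one of them is everything. This yields finiteness of the base of a double cover, which
is not assumed. -/
theorem finite_of_nilpotent_of_finite_ker (W : Module.End (ZMod 2) M) (hW : IsNilpotent W)
    (hfin : (LinearMap.ker W).FG) : Module.Finite (ZMod 2) M := by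
  have h : ∀ j : ℕ, (LinearMap.ker (W ^ j)).FG := by
    intro j
    induction j with
    | zero =>
      have : LinearMap.ker (W ^ 0) = ⊥ := by
        rw [pow_zero]
        exact LinearMap.ker_id
      rw [this]
      exact Submodule.fg_bot
    | succ j ih =>
      have := Module.Finite.of_fg ih
      have := Module.Finite.of_fg hfin
      refine Submodule.fg_of_fg_map_of_fg_inf_ker W ?_ ?_
      · have hle : (LinearMap.ker (W ^ (j + 1))).map W ≤ LinearMap.ker (W ^ j) := by
          rintro _ ⟨x, hx, rfl⟩
          rw [SetLike.mem_coe, LinearMap.mem_ker, pow_succ] at hx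
          exact hx
        have := Submodule.finiteDimensional_of_le hle
        exact Module.Finite.iff_fg.1 inferInstance
      · have := Submodule.finiteDimensional_of_le
          (inf_le_right : LinearMap.ker (W ^ (j + 1)) ⊓ LinearMap.ker W ≤ LinearMap.ker W)
        exact Module.Finite.iff_fg.1 inferInstance
  obtain ⟨j, hj⟩ := hW
  have := h j
  rw [hj, LinearMap.ker_zero] at this
  exact ⟨this⟩

/-- In an exact triangle `M → M → N → M`, kernel and cokernel of `W` have the same dimension once
`M` is finite; they are the ranges of `R` and `P`, and together they make up `N`. -/
theorem finite_and_finrank_of_triangle (W : Module.End (ZMod 2) M) (P : M →ₗ[ZMod 2] N) (R : N →ₗ[ZMod 2] M)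
    (hP : LinearMap.ker P = LinearMap.range W) (hR : LinearMap.ker R = LinearMap.range P)
    (hker : LinearMap.ker W = LinearMap.range R) (hW : IsNilpotent W) [Module.Finite (ZMod 2) N] :
    Module.Finite (ZMod 2) M ∧ Module.finrank (ZMod 2) N = 2 * Module.finrank (ZMod 2) (LinearMap.range P) := by
  have hM : Module.Finite (ZMod 2) M := by
    refine finite_of_nilpotent_of_finite_ker W hW ?_
    rw [hker]
    exact Module.Finite.iff_fg.1 inferInstance
  refine ⟨hM, ?_⟩
  have h1 := LinearMap.finrank_range_add_finrank_ker P
  have h2 := LinearMap.finrank_range_add_finrank_ker R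
  have h3 := LinearMap.finrank_range_add_finrank_ker W
  rw [hP] at h1
  rw [hR] at h2
  rw [hker] at h3
  omega

/-- If `W` is nilpotent and `S` spans a complement of the range of `W`, then the elements `Wⁱ x`
with `x ∈ S` span the whole space. -/
theorem span_pow_of_nilpotent (W : Module.End (ZMod 2) M) (m : ℕ) (hW : W ^ m = 0) {ι : Type*}
    (β : ι → M) (h : Submodule.span (ZMod 2) (Set.range β) ⊔ LinearMap.range W = ⊤) :
    Submodule.span (ZMod 2) (Set.range fun ij : Fin m × ι ↦ (W ^ (ij.1 : ℕ)) (β ij.2)) = ⊤ := by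
  set S := Submodule.span (ZMod 2) (Set.range fun ij : Fin m × ι ↦ (W ^ (ij.1 : ℕ)) (β ij.2)) with hS
  have hmem : ∀ (i : ℕ) (j : ι), (W ^ i) (β j) ∈ S := by
    intro i j
    by_cases hi : i < m
    · exact Submodule.subset_span ⟨(⟨i, hi⟩, j), rfl⟩
    · rw [← Nat.sub_add_cancel (not_lt.1 hi), pow_add, hW, mul_zero]
      exact Submodule.zero_mem _
  have hstep : ∀ n x, ∃ y ∈ S, ∃ z, x = y + (W ^ n) z := by
    intro n
    induction n with
    | zero => exact fun x ↦ ⟨0, Submodule.zero_mem _, x, by simp⟩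
    | succ n ih =>
      intro x
      obtain ⟨y, hy, z, rfl⟩ := ih x
      have hz : z ∈ Submodule.span (ZMod 2) (Set.range β) ⊔ LinearMap.range W := h ▸ Submodule.mem_top
      obtain ⟨b, hb, _, ⟨c, rfl⟩, rfl⟩ := Submodule.mem_sup.1 hz
      refine ⟨y + (W ^ n) b, Submodule.add_mem _ hy ?_, c, ?_⟩
      · have : Submodule.span (ZMod 2) (Set.range β) ≤ S.comap (W ^ n) := by
          rw [Submodule.span_le]
          rintro _ ⟨j, rfl⟩
          exact hmem n j
        exact this hb
      · rw [map_add, pow_succ, Module.End.mul_apply, add_assoc]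
  rw [eq_top_iff]
  rintro x -
  obtain ⟨y, hy, z, rfl⟩ := hstep m x
  rw [hW, LinearMap.zero_apply, add_zero]
  exact hy

end triangle

/-! ## The Gysin sequence of a double cover -/

namespace SSetMod2

variable {K : SSet.{u}} {L : SSet.{u}}

/-- A double cover of simplicial sets with deck involution `t`, together with a labelling `θ` of the
vertices which changes under `t`. -/
structure DoubleCover (p : K ⟶ L) (t : K ⟶ K) (θ : Cochain K 0) : Prop where
  surj (n : ℕ) : Function.Surjective (p.app (op (SimplexCategory.mk n)))
  eq_or {n : ℕ} {σ τ : K.obj (op (SimplexCategory.mk n))} :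
    p.app _ σ = p.app _ τ → τ = σ ∨ τ = t.app _ σ
  app_t {n : ℕ} (σ : K.obj (op (SimplexCategory.mk n))) : p.app _ (t.app _ σ) = p.app _ σ
  t_t {n : ℕ} (σ : K.obj (op (SimplexCategory.mk n))) : t.app _ (t.app _ σ) = σ
  odd (σ : K.obj (op (SimplexCategory.mk 0))) : θ (t.app _ σ) = θ σ + 1

theorem cochainCup_const_one {n : ℕ} (g : Cochain K n) :
    cochainCup K (zero_add n) (fun _ ↦ 1) g = g := by
  funext σ
  rw [cochainCup_apply, one_mul]
  have : back K (zero_add n) σ = σ := by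
    unfold back
    have : SimplexCategory.subinterval 0 n (show 0 + n ≤ n by omega) = 𝟙 _ := by
      ext i
      rfl
    rw [this]
    simp
  rw [this]

namespace DoubleCover

variable {p : K ⟶ L} {t : K ⟶ K} {θ : Cochain K 0} (D : DoubleCover p t θ)

include D

theorem cochainMap_injective (n : ℕ) : Function.Injective (cochainMap p n) := by
  intro f g h
  funext σ
  obtain ⟨τ, rfl⟩ := D.surj n σ
  exact congrFun h τ

theorem cochainMap_t (n : ℕ) (f : Cochain L n) :
    cochainMap t n (cochainMap p n f) = cochainMap p n f :=
  funext fun σ ↦ congrArg f (D.app_t σ)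

theorem exists_descend {n : ℕ} (f : Cochain K n) (hf : cochainMap t n f = f) :
    ∃ h, cochainMap p n h = f := by
  refine ⟨fun σ ↦ f (Function.surjInv (D.surj n) σ), ?_⟩
  funext σ
  rw [cochainMap_apply]
  obtain h | h := D.eq_or (Function.surjInv_eq (D.surj n) (p.app _ σ))
  · rw [← h]
  · conv_rhs => rw [h]
    exact (congrFun hf _).symm

/-- The transfer of cochains. -/
noncomputable def trC (n : ℕ) : Cochain K n →ₗ[ZMod 2] Cochain L n where
  toFun f σ := f (Function.surjInv (D.surj n) σ) + f (t.app _ (Function.surjInv (D.surj n) σ))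
  map_add' f g := by
    funext σ
    simp only [Pi.add_apply]
    ring
  map_smul' c f := by
    funext σ
    simp only [Pi.smul_apply, smul_eq_mul, RingHom.id_apply]
    ring

theorem cochainMap_trC (n : ℕ) (f : Cochain K n) :
    cochainMap p n (D.trC n f) = f + cochainMap t n f := by
  funext σ
  change f _ + f _ = f σ + f (t.app _ σ)
  obtain h | h := D.eq_or (Function.surjInv_eq (D.surj n) (p.app _ σ))
  · rw [← h]
  · conv_rhs => rw [h, D.t_t]
    exact add_comm _ _

theorem coboundary_trC (n : ℕ) (f : Cochain K n) :
    coboundary L n (D.trC n f) = D.trC (n + 1) (coboundary K n f) := by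
  apply D.cochainMap_injective
  rw [← coboundary_cochainMap, cochainMap_trC, cochainMap_trC, map_add, coboundary_cochainMap]

theorem trC_mem_cocycles (n : ℕ) (f : Cochain K n) (hf : f ∈ cocycles K n) :
    D.trC n f ∈ cocycles L n := by
  rw [mem_cocycles_iff] at hf ⊢
  rw [coboundary_trC, hf, map_zero]

/-- The transfer. -/
noncomputable def tr (n : ℕ) : H K n →ₗ[ZMod 2] H L n :=
  Submodule.mapQ _ _ ((D.trC n).restrict (D.trC_mem_cocycles n))
    (fun f hf ↦ by
      change D.trC n f.1 ∈ coboundaries L n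
      have hf' : f.1 ∈ coboundaries K n := hf
      cases n with
      | zero =>
        rw [(mem_coboundaries_zero_iff _).1 hf', map_zero]
        exact Submodule.zero_mem _
      | succ n =>
        obtain ⟨g, hg⟩ := hf'
        exact ⟨D.trC n g, by rw [coboundary_trC, hg]⟩)

theorem tr_cls (n : ℕ) (f : cocycles K n) :
    D.tr n (cls K n f) = cls L n ⟨D.trC n f.1, D.trC_mem_cocycles n f.1 f.2⟩ := rfl

/-- The transfer on total cohomology. -/
noncomputable def Ttr : T K →ₗ[ZMod 2] T L :=
  LinearMap.pi fun n ↦ (D.tr n) ∘ₗ LinearMap.proj n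

theorem trC_cochainMap (n : ℕ) (h : Cochain L n) : D.trC n (cochainMap p n h) = 0 := by
  apply D.cochainMap_injective
  rw [D.cochainMap_trC, D.cochainMap_t, cochain_add_self, map_zero]

/-- Since `θ ∘ t = θ + 1`, cupping with `θ` fails to commute with `t` exactly by the identity. This
defect is used to correct non-invariant cochains to invariant ones, which then descend to `L`. -/
theorem cochainMap_t_theta_cup {n : ℕ} (f : Cochain K n) :
    cochainMap t n (cochainCup K (zero_add n) θ f) =
      cochainCup K (zero_add n) θ (cochainMap t n f) + cochainMap t n f := by
  rw [cochainMap_cup]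
  have : cochainMap t 0 θ = θ + fun _ ↦ 1 := funext fun σ ↦ D.odd σ
  rw [this, map_add, LinearMap.add_apply, cochainCup_const_one]

variable {w : cocycles L 1} (hw : cochainMap p 1 w.1 = coboundary K 0 θ)

include hw

omit D in
-- `θ` is a primitive of `w` upstairs, so by the Leibniz rule `θ ∪ p^* f` is a primitive of `p^* (w
-- ∪ f)`.
theorem coboundary_theta_cup {n : ℕ} (f : Cochain L n) (hf : coboundary L n f = 0) :
    coboundary K n (cochainCup K (zero_add n) θ (cochainMap p n f)) =
      cochainMap p (n + 1) (cochainCup L (add_comm 1 n) w.1 f) := by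
  rw [coboundary_cochainCup, coboundary_cochainMap, hf, map_zero, map_zero, add_zero,
    cochainMap_cup, hw]

omit D in
theorem map_w : map p 1 (cls L 1 w) = 0 := by
  rw [map_cls, cls_eq_zero_iff]
  exact ⟨θ, hw.symm⟩

/-- If `p^* h = δ β`, put `γ = tr β`. Both `β` and `θ ∪ p^* γ` change by `p^* γ` under `t`, so their
sum descends to some `α`, and `δ α = h + w ∪ γ`. Conversely `p^* w` is the coboundary of `θ`. -/
theorem ker_Tmap : LinearMap.ker (Tmap p) = LinearMap.range (Lm L (cls L 1 w)) := by
  apply le_antisymm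
  · intro s hs
    have hs' : ∀ n, map p n (s n) = 0 := fun n ↦ congrFun hs n
    have key : ∀ n, ∃ y : H L n, cup L (add_comm 1 n) (cls L 1 w) y = s (n + 1) := by
      intro n
      obtain ⟨⟨h, hh⟩, hs1⟩ := cls_surjective (n + 1) (s (n + 1))
      have h0 := hs' (n + 1)
      rw [← hs1, map_cls, cls_eq_zero_iff] at h0
      obtain ⟨β, hβ⟩ := h0
      have hγ : D.trC n β ∈ cocycles L n := by
        rw [mem_cocycles_iff, D.coboundary_trC, hβ, D.trC_cochainMap]
      obtain ⟨α, hα⟩ := D.exists_descend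
        (β + cochainCup K (zero_add n) θ (cochainMap p n (D.trC n β))) (by
          rw [map_add, D.cochainMap_t_theta_cup, D.cochainMap_t]
          rw [add_comm _ (cochainMap p n (D.trC n β)), ← add_assoc]
          congr 1
          rw [D.cochainMap_trC, add_comm β, ← add_assoc, cochain_add_self, zero_add])
      refine ⟨cls L n ⟨_, hγ⟩, ?_⟩
      rw [cup_cls, ← hs1, cls_eq_iff]
      refine ⟨α, D.cochainMap_injective _ ?_⟩
      rw [← coboundary_cochainMap, hα, map_add, hβ, coboundary_theta_cup hw _ hγ]
      exact (add_comm _ _).trans (map_add (cochainMap p (n + 1)) _ _).symm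
    choose y hy using key
    refine ⟨y, ?_⟩
    funext n
    cases n with
    | zero =>
      rw [Lm_zero]
      obtain ⟨h, hs1⟩ := cls_surjective 0 (s 0)
      have h0 := hs' 0
      rw [← hs1, map_cls, cls_eq_zero_iff, mem_coboundaries_zero_iff] at h0
      rw [← hs1, eq_comm, cls_eq_zero_iff, mem_coboundaries_zero_iff]
      exact D.cochainMap_injective _ (h0.trans (map_zero _).symm)
    | succ n => exact hy n
  · rintro _ ⟨s, rfl⟩
    rw [LinearMap.mem_ker, Tmap_Lm, map_w hw, map_zero, LinearMap.zero_apply]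

omit hw in
-- If `tr β = δ α`, then `β + δ (θ ∪ p^* α)` is invariant, because the second term changes under `t`
-- by `p^* δ α = β + t^* β`. It is therefore pulled back from `L`. In degree zero `tr β` vanishes
-- outright and `β` itself descends.
theorem ker_Ttr : LinearMap.ker D.Ttr = LinearMap.range (Tmap p) := by
  apply le_antisymm
  · intro s hs
    have hs' : ∀ n, D.tr n (s n) = 0 := fun n ↦ congrFun hs n
    have key : ∀ n, ∃ y : H L n, map p n y = s n := by
      intro n
      obtain ⟨β, hs1⟩ := cls_surjective n (s n)
      have h0 := hs' n
      rw [← hs1, tr_cls, cls_eq_zero_iff] at h0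
      cases n with
      | zero =>
        rw [mem_coboundaries_zero_iff] at h0
        have h0 : D.trC 0 β.1 = 0 := h0
        obtain ⟨α, hα⟩ := D.exists_descend β.1 (by
          rw [eq_comm, ← cochain_add_eq_zero_iff, ← D.cochainMap_trC, h0, map_zero])
        refine ⟨cls L 0 ⟨α, D.cochainMap_injective _ ?_⟩, ?_⟩
        · rw [← coboundary_cochainMap, hα, map_zero]
          exact β.2
        · rw [← hs1, map_cls]
          congr 1
          exact Subtype.ext hα
      | succ n =>
        obtain ⟨α, hα⟩ := h0
        have hα : coboundary L n α = D.trC (n + 1) β.1 := hα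
        obtain ⟨γ, hγ⟩ := D.exists_descend
          (β.1 + coboundary K n (cochainCup K (zero_add n) θ (cochainMap p n α))) (by
            rw [map_add, ← coboundary_cochainMap, D.cochainMap_t_theta_cup, D.cochainMap_t,
              map_add, coboundary_cochainMap p, hα, D.cochainMap_trC]
            generalize cochainMap t (n + 1) β.1 = x
            generalize coboundary K n (cochainCup K (zero_add n) θ (cochainMap p n α)) = y
            calc x + (y + (β.1 + x)) = (x + x) + (β.1 + y) := by abel
              _ = β.1 + y := by rw [cochain_add_self, zero_add])
        refine ⟨cls L (n + 1) ⟨γ, D.cochainMap_injective _ ?_⟩, ?_⟩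
        · have hβ : coboundary K (n + 1) β.1 = 0 := β.2
          rw [← coboundary_cochainMap, hγ, map_zero, map_add, coboundary_coboundary, hβ, add_zero]
        · rw [← hs1, map_cls, cls_eq_iff]
          refine ⟨cochainCup K (zero_add n) θ (cochainMap p n α), ?_⟩
          change _ = cochainMap p (n + 1) γ + β.1
          rw [hγ, add_comm β.1, add_assoc, cochain_add_self, add_zero]
    choose y hy using key
    exact ⟨y, funext hy⟩
  · rintro _ ⟨s, rfl⟩
    rw [LinearMap.mem_ker]
    funext n
    change D.tr n (map p n (s n)) = 0
    obtain ⟨h, hs1⟩ := cls_surjective n (s n)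
    rw [← hs1, map_cls, tr_cls, cls_eq_zero_iff]
    change D.trC n (cochainMap p n h.1) ∈ _
    rw [D.trC_cochainMap]
    exact Submodule.zero_mem _

/-- If `w ∪ h = δ α`, then `θ ∪ p^* h + p^* α` is a cocycle whose transfer is `h`. Conversely `β + θ
∪ p^* (tr β)` descends to a primitive of `w ∪ tr β`. -/
theorem ker_Lm : LinearMap.ker (Lm L (cls L 1 w)) = LinearMap.range D.Ttr := by
  apply le_antisymm
  · intro s hs
    have key : ∀ n, ∃ y : H K n, D.tr n y = s n := by
      intro n
      have h0 : Lm L (cls L 1 w) s (n + 1) = 0 := congrFun hs (n + 1)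
      obtain ⟨h, hs1⟩ := cls_surjective n (s n)
      rw [Lm_succ, ← hs1, cup_cls, cls_eq_zero_iff] at h0
      obtain ⟨α, hα⟩ := h0
      have hα : coboundary L n α = cochainCup L (add_comm 1 n) w.1 h.1 := hα
      refine ⟨cls K n ⟨cochainCup K (zero_add n) θ (cochainMap p n h.1) + cochainMap p n α, ?_⟩, ?_⟩
      · rw [mem_cocycles_iff, map_add, coboundary_theta_cup hw _ h.2, coboundary_cochainMap, hα,
          cochain_add_self]
      · rw [tr_cls, ← hs1]
        congr 1
        ext1
        apply D.cochainMap_injective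
        rw [D.cochainMap_trC]
        change _ + _ + cochainMap t n (_ + _) = _
        rw [map_add, D.cochainMap_t_theta_cup, D.cochainMap_t, D.cochainMap_t]
        generalize cochainCup K (zero_add n) θ (cochainMap p n h.1) = x
        generalize cochainMap p n α = y
        generalize cochainMap p n h.1 = z
        calc x + y + (x + z + y) = (x + x) + (y + y) + z := by abel
          _ = z := by rw [cochain_add_self, cochain_add_self, zero_add, zero_add]
    choose y hy using key
    exact ⟨y, funext hy⟩
  · rintro _ ⟨s, rfl⟩
    rw [LinearMap.mem_ker]
    funext n
    cases n with
    | zero => rfl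
    | succ n =>
      rw [Lm_succ]
      change cup L _ _ (D.tr n (s n)) = 0
      obtain ⟨β, hs1⟩ := cls_surjective n (s n)
      rw [← hs1, tr_cls, cup_cls, cls_eq_zero_iff]
      obtain ⟨α, hα⟩ := D.exists_descend
        (β.1 + cochainCup K (zero_add n) θ (cochainMap p n (D.trC n β.1))) (by
          rw [map_add, D.cochainMap_t_theta_cup, D.cochainMap_t]
          rw [add_comm _ (cochainMap p n (D.trC n β.1)), ← add_assoc]
          congr 1
          rw [D.cochainMap_trC, add_comm β.1, ← add_assoc, cochain_add_self, zero_add])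
      refine ⟨α, D.cochainMap_injective _ ?_⟩
      have hβ : coboundary K n β.1 = 0 := β.2
      rw [← coboundary_cochainMap, hα, map_add, hβ,
        coboundary_theta_cup hw _ (D.trC_mem_cocycles n β.1 β.2), zero_add]

/-- A space with finite total cohomology and a free involution of finite index has even total
Betti number. -/
theorem even_finrank (hnil : IsNilpotent (Lm L (cls L 1 w))) [Module.Finite (ZMod 2) (T K)] :
    Even (Module.finrank (ZMod 2) (T K)) := by
  have h := (finite_and_finrank_of_triangle (M := T L) (N := T K) (Lm L (cls L 1 w)) (Tmap p) D.Ttr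
    (D.ker_Tmap hw) D.ker_Ttr (D.ker_Lm hw) hnil).2
  rw [h]
  exact even_two_mul _

/-- Generation of the total cohomology of the base of a double cover. -/
theorem span_eq_top {m r : ℕ} (hnil : Lm L (cls L 1 w) ^ m = 0) [Module.Finite (ZMod 2) (T K)]
    (hr : Module.finrank (ZMod 2) (T K) ≤ 2 * r) (β : Fin r → T L)
    (hβ : LinearIndependent (ZMod 2) fun j ↦ Tmap p (β j)) :
    Submodule.span (ZMod 2)
      (Set.range fun ij : Fin m × Fin r ↦ (Lm L (cls L 1 w) ^ (ij.1 : ℕ)) (β ij.2)) = ⊤ := by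
  -- The triangle makes the range of `p^*` half of the cohomology of `K`, so `r` independent
  -- restrictions fill it. Hence the `β j` span modulo multiples of `w`.
  obtain ⟨hfin, hrank⟩ := finite_and_finrank_of_triangle (M := T L) (N := T K) (Lm L (cls L 1 w)) (Tmap p) D.Ttr
    (D.ker_Tmap hw) D.ker_Ttr
    (D.ker_Lm hw) ⟨m, hnil⟩
  apply span_pow_of_nilpotent _ m hnil
  rw [← D.ker_Tmap hw]
  have hle : Submodule.span (ZMod 2) (Set.range fun j ↦ Tmap p (β j)) ≤
      LinearMap.range (Tmap p) := by
    rw [Submodule.span_le]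
    rintro _ ⟨j, rfl⟩
    exact ⟨_, rfl⟩
  have heq := Submodule.eq_of_le_of_finrank_le hle (by
    rw [finrank_span_eq_card hβ, Fintype.card_fin]
    omega)
  have h2 : Submodule.map (Tmap p) (Submodule.span (ZMod 2) (Set.range β)) =
      LinearMap.range (Tmap p) := by
    rw [← heq, Submodule.map_span, ← Set.range_comp]
    rfl
  rw [← Submodule.comap_map_eq, h2, LinearMap.range_eq_map, Submodule.comap_map_eq, top_sup_eq]

omit hw in
/-- If the cohomology of the cover does not vanish in some degree, neither does that of the base. -/
theorem exists_ne_zero {n : ℕ} (x : H K n) (hx : x ≠ 0) : ∃ y : H L n, y ≠ 0 := by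
  by_contra! h
  -- If the base vanished in degree `n`, the transfer of `x` would be zero, so `x` would be pulled
  -- back from a zero group.
  have h1 : Pi.single n x ∈ LinearMap.ker D.Ttr := by
    rw [LinearMap.mem_ker]
    funext m
    change D.tr m ((Pi.single n x : T K) m) = 0
    by_cases hm : m = n
    · subst hm
      exact h _
    · rw [Pi.single_eq_of_ne hm, map_zero]
  rw [D.ker_Ttr] at h1
  obtain ⟨s, hs⟩ := h1
  apply hx
  have := congrFun hs n
  rw [Pi.single_eq_same, Tmap_apply, h (s n), map_zero] at this
  exact this.symm

end DoubleCover

end SSetMod2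

/-! ## The Mayer–Vietoris sequence -/

namespace SSetMod2

variable {K : SSet.{u}} {K₁ : SSet.{u}} {K₂ : SSet.{u}} {K₀ : SSet.{u}}

/-- A square of simplicial sets which satisfies excision in mod 2 cohomology: the cochains of `K₁`
and `K₂` which agree on `K₀` glue to cochains of `K`, and the cochains of `K` which vanish on `K₁`
and `K₂` are acyclic. -/
structure Excisive (j₁ : K₁ ⟶ K) (j₂ : K₂ ⟶ K) (i₁ : K₀ ⟶ K₁) (i₂ : K₀ ⟶ K₂) : Prop where
  comm : i₁ ≫ j₁ = i₂ ≫ j₂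
  ext (n : ℕ) : Function.Surjective (cochainMap i₁ n)
  glue {n : ℕ} (f₁ : Cochain K₁ n) (f₂ : Cochain K₂ n) (h : cochainMap i₁ n f₁ = cochainMap i₂ n f₂) :
    ∃ f, cochainMap j₁ n f = f₁ ∧ cochainMap j₂ n f = f₂
  zero (f : Cochain K 0) (h₁ : cochainMap j₁ 0 f = 0) (h₂ : cochainMap j₂ 0 f = 0) : f = 0
  small {n : ℕ} (f : Cochain K (n + 1)) (hf : f ∈ cocycles K (n + 1))
    (h₁ : cochainMap j₁ (n + 1) f = 0) (h₂ : cochainMap j₂ (n + 1) f = 0) :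
    ∃ g, coboundary K n g = f ∧ cochainMap j₁ n g = 0 ∧ cochainMap j₂ n g = 0

namespace Excisive

variable {j₁ : K₁ ⟶ K} {j₂ : K₂ ⟶ K} {i₁ : K₀ ⟶ K₁} {i₂ : K₀ ⟶ K₂} (E : Excisive j₁ j₂ i₁ i₂)

include E

theorem cochainMap_comm {n : ℕ} (f : Cochain K n) :
    cochainMap i₁ n (cochainMap j₁ n f) = cochainMap i₂ n (cochainMap j₂ n f) := by
  rw [← cochainMap_comp, E.comm, cochainMap_comp]

/-- A cocycle which restricts to coboundaries of `f₁`, `f₂`, with `f₁`, `f₂` agreeing on `K₀`, is a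
coboundary. -/
theorem mem_coboundaries_of_glue {n : ℕ} (F : Cochain K (n + 1)) (hF : F ∈ cocycles K (n + 1))
    (f₁ : Cochain K₁ n) (f₂ : Cochain K₂ n) (h₁ : cochainMap j₁ _ F = coboundary K₁ n f₁)
    (h₂ : cochainMap j₂ _ F = coboundary K₂ n f₂)
    (h : cochainMap i₁ n f₁ = cochainMap i₂ n f₂) : F ∈ coboundaries K (n + 1) := by
  obtain ⟨f, rfl, rfl⟩ := E.glue f₁ f₂ h
  obtain ⟨g, hg, -, -⟩ := E.small (F + coboundary K n f)
    (Submodule.add_mem _ hF (coboundary_mem_cocycles f))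
    (by rw [map_add, h₁, coboundary_cochainMap, cochain_add_self])
    (by rw [map_add, h₂, coboundary_cochainMap, cochain_add_self])
  refine ⟨g + f, ?_⟩
  rw [map_add, hg, add_assoc, cochain_add_self, add_zero]

/-- Cocycles on `K₁` and `K₂` which agree on `K₀` glue to a cocycle. -/
theorem exists_cocycle {n : ℕ} (f₁ : Cochain K₁ n) (f₂ : Cochain K₂ n) (h₁ : f₁ ∈ cocycles K₁ n)
    (h₂ : f₂ ∈ cocycles K₂ n) (h : cochainMap i₁ n f₁ = cochainMap i₂ n f₂) :
    ∃ f ∈ cocycles K n, cochainMap j₁ n f = f₁ ∧ cochainMap j₂ n f = f₂ := by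
  obtain ⟨f, rfl, rfl⟩ := E.glue f₁ f₂ h
  rw [mem_cocycles_iff, coboundary_cochainMap] at h₁ h₂
  obtain ⟨g, hg, hg₁, hg₂⟩ := E.small (coboundary K n f) (coboundary_mem_cocycles f) h₁ h₂
  refine ⟨f + g, ?_, ?_, ?_⟩
  · rw [mem_cocycles_iff, map_add, hg, cochain_add_self]
  · rw [map_add, hg₁, add_zero]
  · rw [map_add, hg₂, add_zero]

/-- Representatives agree on `K₀` only up to a coboundary. Extending its primitive from `K₀` to `K₁`
and correcting one representative makes them agree exactly, and then they glue. -/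
theorem exists_of_map_eq {n : ℕ} (x₁ : H K₁ n) (x₂ : H K₂ n) (h : map i₁ n x₁ = map i₂ n x₂) :
    ∃ x, map j₁ n x = x₁ ∧ map j₂ n x = x₂ := by
  obtain ⟨f₁, rfl⟩ := cls_surjective n x₁
  obtain ⟨f₂, rfl⟩ := cls_surjective n x₂
  rw [map_cls, map_cls, cls_eq_iff] at h
  have key : ∃ g : Cochain K₁ n, g ∈ coboundaries K₁ n ∧
      cochainMap i₁ n (f₁.1 + g) = cochainMap i₂ n f₂.1 := by
    cases n with
    | zero =>
      rw [mem_coboundaries_zero_iff, cochain_add_eq_zero_iff] at h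
      exact ⟨0, Submodule.zero_mem _, by rw [add_zero]; exact h⟩
    | succ n =>
      obtain ⟨b, hb⟩ := h
      obtain ⟨b, rfl⟩ := E.ext n b
      refine ⟨coboundary K₁ n b, ⟨b, rfl⟩, ?_⟩
      rw [map_add, ← coboundary_cochainMap, hb, ← add_assoc, cochain_add_self, zero_add]
  obtain ⟨g, hg, hfg⟩ := key
  have hgc : g ∈ cocycles K₁ n := by
    cases n with
    | zero => rw [(mem_coboundaries_zero_iff _).1 hg]; exact Submodule.zero_mem _
    | succ n => obtain ⟨b, rfl⟩ := hg; exact coboundary_mem_cocycles b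
  obtain ⟨f, hf, hf₁, hf₂⟩ := E.exists_cocycle _ _ (Submodule.add_mem _ f₁.2 hgc) f₂.2 hfg
  refine ⟨cls K n ⟨f, hf⟩, ?_, ?_⟩
  · rw [map_cls, cls_eq_iff]
    change cochainMap j₁ n f + f₁.1 ∈ _
    rw [hf₁, add_comm, ← add_assoc, cochain_add_self, zero_add]
    exact hg
  · rw [map_cls]
    congr 1
    exact Subtype.ext hf₂

theorem eq_zero_of_map_eq_zero (x : H K 0) (h₁ : map j₁ 0 x = 0) (h₂ : map j₂ 0 x = 0) :
    x = 0 := by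
  obtain ⟨f, rfl⟩ := cls_surjective 0 x
  rw [map_cls, cls_eq_zero_iff, mem_coboundaries_zero_iff] at h₁ h₂
  rw [cls_eq_zero_iff, mem_coboundaries_zero_iff]
  exact E.zero f.1 h₁ h₂

omit E in
variable (j₁ j₂ i₁ i₂) in
/-- The relation which underlies the connecting homomorphism. -/
def Conn (n : ℕ) (c : H K₀ n) (x : H K (n + 1)) : Prop :=
  ∃ (f₀ : cocycles K₀ n) (F : cocycles K (n + 1)) (f₁ : Cochain K₁ n) (f₂ : Cochain K₂ n),
    cls K₀ n f₀ = c ∧ cls K (n + 1) F = x ∧ cochainMap i₁ n f₁ + cochainMap i₂ n f₂ = f₀.1 ∧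
      cochainMap j₁ _ F.1 = coboundary K₁ n f₁ ∧ cochainMap j₂ _ F.1 = coboundary K₂ n f₂

omit E in
theorem Conn.add {n : ℕ} {c c' : H K₀ n} {x x' : H K (n + 1)} (h : Conn j₁ j₂ i₁ i₂ n c x)
    (h' : Conn j₁ j₂ i₁ i₂ n c' x') : Conn j₁ j₂ i₁ i₂ n (c + c') (x + x') := by
  obtain ⟨f₀, F, f₁, f₂, rfl, rfl, h0, h1, h2⟩ := h
  obtain ⟨f₀', F', f₁', f₂', rfl, rfl, h0', h1', h2'⟩ := h'
  refine ⟨f₀ + f₀', F + F', f₁ + f₁', f₂ + f₂', map_add _ _ _, map_add _ _ _, ?_, ?_, ?_⟩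
  · rw [map_add, map_add, add_add_add_comm, h0, h0']
    rfl
  · rw [map_add, ← h1, ← h1', ← map_add]
    rfl
  · rw [map_add, ← h2, ← h2', ← map_add]
    rfl

theorem Conn.exists_right {n : ℕ} (c : H K₀ n) : ∃ x, Conn j₁ j₂ i₁ i₂ n c x := by
  obtain ⟨f₀, rfl⟩ := cls_surjective n c
  obtain ⟨f₁, hf₁⟩ := E.ext n f₀.1
  obtain ⟨F, hF, hF₁, hF₂⟩ := E.exists_cocycle (coboundary K₁ n f₁) 0 (coboundary_mem_cocycles f₁)
    (Submodule.zero_mem _) (by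
      rw [← coboundary_cochainMap, hf₁, map_zero]
      exact f₀.2)
  refine ⟨_, f₀, ⟨F, hF⟩, f₁, 0, rfl, rfl, ?_, hF₁, ?_⟩
  · rw [map_zero, add_zero, hf₁]
  · rw [map_zero]
    exact hF₂

/-- For `u = v = 0` this is the well-definedness of the connecting map; in general it is half of
exactness at `K₀`. -/
theorem Conn.eq_zero {n : ℕ} {c : H K₀ n} {x : H K (n + 1)} (h : Conn j₁ j₂ i₁ i₂ n c x)
    (u : H K₁ n) (v : H K₂ n) (hc : c = map i₁ n u + map i₂ n v) : x = 0 := by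
  obtain ⟨f₀, F, f₁, f₂, rfl, rfl, h0, h1, h2⟩ := h
  obtain ⟨u, rfl⟩ := cls_surjective n u
  obtain ⟨v, rfl⟩ := cls_surjective n v
  rw [map_cls, map_cls, ← map_add, cls_eq_iff] at hc
  have hu : coboundary K₁ n u.1 = 0 := u.2
  have hv : coboundary K₂ n v.1 = 0 := v.2
  -- The discrepancy is a coboundary on `K₀`; extending its primitive to `K₁` turns it into the
  -- restriction of a cocycle, which can be absorbed into `f₁`.
  have key : ∃ g : Cochain K₁ n, coboundary K₁ n g = 0 ∧
      f₀.1 + (cochainMap i₁ n u.1 + cochainMap i₂ n v.1) = cochainMap i₁ n g := by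
    cases n with
    | zero => exact ⟨0, map_zero _, ((mem_coboundaries_zero_iff _).1 hc).trans (map_zero _).symm⟩
    | succ n =>
      obtain ⟨b, hb⟩ := hc
      obtain ⟨b, rfl⟩ := E.ext n b
      refine ⟨coboundary K₁ n b, coboundary_coboundary _ _ _, ?_⟩
      rw [← coboundary_cochainMap, hb]
      rfl
  obtain ⟨g, hg, hg'⟩ := key
  rw [cls_eq_zero_iff]
  refine E.mem_coboundaries_of_glue F.1 F.2 (f₁ + u.1 + g) (f₂ + v.1) ?_ ?_ ?_
  · rw [map_add, map_add, hu, hg, add_zero, add_zero, h1]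
  · rw [map_add, hv, add_zero, h2]
  · rw [map_add, map_add, map_add, ← cochain_add_eq_zero_iff, ← hg', ← h0]
    generalize cochainMap i₁ n f₁ = a
    generalize cochainMap i₂ n f₂ = b
    generalize cochainMap i₁ n u.1 = c
    generalize cochainMap i₂ n v.1 = d
    calc a + c + (a + b + (c + d)) + (b + d) = (a + a) + (b + b) + (c + c) + (d + d) := by abel
      _ = 0 := by simp only [cochain_add_self, add_zero]

omit E in
theorem Conn.exists_of_zero {n : ℕ} {c : H K₀ n} (h : Conn j₁ j₂ i₁ i₂ n c 0)
    (E : Excisive j₁ j₂ i₁ i₂) : ∃ u v, c = map i₁ n u + map i₂ n v := by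
  obtain ⟨f₀, F, f₁, f₂, rfl, hx, h0, h1, h2⟩ := h
  rw [cls_eq_zero_iff] at hx
  obtain ⟨G, hG⟩ := hx
  rw [← hG, ← coboundary_cochainMap] at h1 h2
  refine ⟨cls K₁ n ⟨f₁ + cochainMap j₁ n G, ?_⟩, cls K₂ n ⟨f₂ + cochainMap j₂ n G, ?_⟩, ?_⟩
  · rw [mem_cocycles_iff, map_add, h1, cochain_add_self]
  · rw [mem_cocycles_iff, map_add, h2, cochain_add_self]
  · rw [map_cls, map_cls, ← map_add]
    congr 1
    ext1
    change f₀.1 = cochainMap i₁ n (_ + _) + cochainMap i₂ n (_ + _)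
    rw [map_add, map_add, add_add_add_comm, h0, E.cochainMap_comm, cochain_add_self, add_zero]

omit E in
theorem Conn.map_eq_zero {n : ℕ} {c : H K₀ n} {x : H K (n + 1)} (h : Conn j₁ j₂ i₁ i₂ n c x) :
    map j₁ _ x = 0 ∧ map j₂ _ x = 0 := by
  obtain ⟨f₀, F, f₁, f₂, rfl, rfl, h0, h1, h2⟩ := h
  rw [map_cls, map_cls, cls_eq_zero_iff, cls_eq_zero_iff]
  exact ⟨⟨f₁, h1.symm⟩, ⟨f₂, h2.symm⟩⟩

theorem Conn.exists_left {n : ℕ} (x : H K (n + 1)) (h₁ : map j₁ _ x = 0) (h₂ : map j₂ _ x = 0) :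
    ∃ c, Conn j₁ j₂ i₁ i₂ n c x := by
  obtain ⟨F, rfl⟩ := cls_surjective _ x
  rw [map_cls, cls_eq_zero_iff] at h₁ h₂
  obtain ⟨f₁, hf₁⟩ := h₁
  obtain ⟨f₂, hf₂⟩ := h₂
  refine ⟨cls K₀ n ⟨cochainMap i₁ n f₁ + cochainMap i₂ n f₂, ?_⟩, _, F, f₁, f₂, rfl, rfl, rfl,
    hf₁.symm, hf₂.symm⟩
  rw [mem_cocycles_iff, map_add, coboundary_cochainMap, coboundary_cochainMap, hf₁, hf₂]
  change cochainMap i₁ _ (cochainMap j₁ _ F.1) + cochainMap i₂ _ (cochainMap j₂ _ F.1) = 0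
  rw [E.cochainMap_comm, cochain_add_self]

theorem Conn.unique {n : ℕ} {c : H K₀ n} {x y : H K (n + 1)} (h : Conn j₁ j₂ i₁ i₂ n c x)
    (h' : Conn j₁ j₂ i₁ i₂ n c y) : x = y := by
  have := Conn.eq_zero E (h.add h') 0 0 (by rw [H_add_self, map_zero, map_zero, add_zero])
  rw [← add_zero x, ← H_add_self y, ← add_assoc, this, zero_add]

/-- The connecting homomorphism. -/
noncomputable def δ (n : ℕ) : H K₀ n →ₗ[ZMod 2] H K (n + 1) :=
  AddMonoidHom.toZModLinearMap 2 (AddMonoidHom.mk'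
    (fun c ↦ (Conn.exists_right E c).choose) fun c c' ↦
      Conn.unique E (Conn.exists_right E (c + c')).choose_spec
        ((Conn.exists_right E c).choose_spec.add (Conn.exists_right E c').choose_spec))

theorem conn_δ (n : ℕ) (c : H K₀ n) : Conn j₁ j₂ i₁ i₂ n c (E.δ n c) :=
  (Conn.exists_right E c).choose_spec

/-- The connecting homomorphism on total cohomology. -/
noncomputable def Tδ : T K₀ →ₗ[ZMod 2] T K :=
  LinearMap.pi fun n ↦ match n with
    | 0 => 0
    | n + 1 => (E.δ n) ∘ₗ LinearMap.proj n

theorem range_Tδ : LinearMap.ker (Tmap j₁) ⊓ LinearMap.ker (Tmap j₂) = LinearMap.range E.Tδ := by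
  apply le_antisymm
  · rintro t ⟨h₁, h₂⟩
    have key : ∀ n, ∃ c, E.δ n c = t (n + 1) := by
      intro n
      obtain ⟨c, hc⟩ := Conn.exists_left E (t (n + 1)) (congrFun h₁ (n + 1)) (congrFun h₂ (n + 1))
      exact ⟨c, Conn.unique E (E.conn_δ n c) hc⟩
    choose s hs using key
    refine ⟨s, funext fun n ↦ ?_⟩
    cases n with
    | zero => exact (E.eq_zero_of_map_eq_zero _ (congrFun h₁ 0) (congrFun h₂ 0)).symm
    | succ n => exact hs n
  · rintro _ ⟨s, rfl⟩
    constructor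
    · funext n
      cases n with
      | zero => exact map_zero (map j₁ 0)
      | succ n => exact (E.conn_δ n (s n)).map_eq_zero.1
    · funext n
      cases n with
      | zero => exact map_zero (map j₂ 0)
      | succ n => exact (E.conn_δ n (s n)).map_eq_zero.2

theorem Tmap_comm (t : T K) : Tmap i₁ (Tmap j₁ t) = Tmap i₂ (Tmap j₂ t) := by
  rw [← Tmap_comp, E.comm, Tmap_comp]

theorem range_le_ker_Tδ : LinearMap.range (Tmap i₁) ≤ LinearMap.ker E.Tδ := by
  rintro _ ⟨s, rfl⟩
  rw [LinearMap.mem_ker]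
  funext n
  cases n with
  | zero => rfl
  | succ n =>
    exact Conn.eq_zero E (E.conn_δ n _) (s n) 0 (by rw [map_zero, add_zero]; rfl)

variable {r : ℕ} (β : Fin r → T K)

/-- The `r` global classes `β j` and the range of the connecting map span. The same `r` classes
restrict to independent elements of the kernel of the connecting map, so what they add to the
dimension is paid for by what that kernel removes. -/
theorem finite_and_finrank_le [Module.Finite (ZMod 2) (T K₀)]
    (h₁ : Submodule.span (ZMod 2) (Set.range fun j ↦ Tmap j₁ (β j)) = ⊤)
    (h₂ : Submodule.span (ZMod 2) (Set.range fun j ↦ Tmap j₂ (β j)) = ⊤)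
    (h₀ : LinearIndependent (ZMod 2) fun j ↦ Tmap i₁ (Tmap j₁ (β j))) :
    Module.Finite (ZMod 2) (T K) ∧
      Module.finrank (ZMod 2) (T K) ≤ Module.finrank (ZMod 2) (T K₀) := by
  set B := Submodule.span (ZMod 2) (Set.range β) with hB
  have hgen : ∀ t : T K, ∃ b ∈ B, ∃ s, t = b + E.Tδ s := by
    intro t
    have ht₁ : Tmap j₁ t ∈ Submodule.span (ZMod 2) (Set.range fun j ↦ Tmap j₁ (β j)) :=
      h₁ ▸ Submodule.mem_top
    have ht₂ : Tmap j₂ t ∈ Submodule.span (ZMod 2) (Set.range fun j ↦ Tmap j₂ (β j)) :=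
      h₂ ▸ Submodule.mem_top
    obtain ⟨l₁, hl₁⟩ := (Submodule.mem_span_range_iff_exists_fun _).1 ht₁
    obtain ⟨l₂, hl₂⟩ := (Submodule.mem_span_range_iff_exists_fun _).1 ht₂
    -- Both expansions restrict to the same class on `K₀`, where the `β j` are independent.
    have hl : l₁ = l₂ := by
      apply linearIndependent_iff_injective_fintypeLinearCombination.1 h₀
      simp only [Fintype.linearCombination_apply]
      have e₁ := congrArg (Tmap i₁) hl₁
      have e₂ := congrArg (Tmap i₂) hl₂
      simp only [map_sum, map_smul] at e₁ e₂
      simp only [← E.Tmap_comm] at e₂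
      rw [e₁, e₂]
    refine ⟨∑ j, l₁ j • β j, Submodule.sum_mem _ fun j _ ↦ Submodule.smul_mem _ _
      (Submodule.subset_span ⟨j, rfl⟩), ?_⟩
    have : t - ∑ j, l₁ j • β j ∈ LinearMap.range E.Tδ := by
      rw [← E.range_Tδ]
      constructor
      · rw [SetLike.mem_coe, LinearMap.mem_ker, map_sub, ← hl₁]
        simp
      · rw [SetLike.mem_coe, LinearMap.mem_ker, map_sub, ← hl₂, hl]
        simp
    obtain ⟨s, hs⟩ := this
    exact ⟨s, by rw [hs]; abel⟩
  have htop : B ⊔ LinearMap.range E.Tδ = ⊤ := by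
    rw [eq_top_iff]
    rintro t -
    obtain ⟨b, hb, s, rfl⟩ := hgen t
    exact Submodule.add_mem_sup hb ⟨s, rfl⟩
  have hBfin : Module.Finite (ZMod 2) B := FiniteDimensional.span_of_finite _ (Set.finite_range _)
  have hBr : Module.finrank (ZMod 2) B ≤ r := by
    refine (finrank_range_le_card β).trans ?_
    rw [Fintype.card_fin]
  have hfin : Module.Finite (ZMod 2) (T K) := by
    refine ⟨?_⟩
    rw [← htop]
    exact Submodule.FG.sup (Module.Finite.iff_fg.1 hBfin) (Module.Finite.iff_fg.1 inferInstance)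
  refine ⟨hfin, ?_⟩
  have h1 := Submodule.finrank_add_le_finrank_add_finrank B (LinearMap.range E.Tδ)
  rw [htop, finrank_top] at h1
  have h2 := LinearMap.finrank_range_add_finrank_ker E.Tδ
  have h3 : r ≤ Module.finrank (ZMod 2) (LinearMap.ker E.Tδ) := by
    have hle : Submodule.span (ZMod 2) (Set.range fun j ↦ Tmap i₁ (Tmap j₁ (β j))) ≤
        LinearMap.ker E.Tδ := by
      rw [Submodule.span_le]
      rintro _ ⟨j, rfl⟩
      exact E.range_le_ker_Tδ ⟨_, rfl⟩
    have := Submodule.finrank_mono hle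
    rwa [finrank_span_eq_card h₀, Fintype.card_fin] at this
  omega

/-- With nothing on `K₀` the connecting map vanishes, so restriction to the two pieces is injective
and each piece contributes at most `r`. -/
theorem finite_and_finrank_le_of_subsingleton [Subsingleton (T K₀)]
    (h₁ : Submodule.span (ZMod 2) (Set.range fun j ↦ Tmap j₁ (β j)) = ⊤)
    (h₂ : Submodule.span (ZMod 2) (Set.range fun j ↦ Tmap j₂ (β j)) = ⊤) :
    Module.Finite (ZMod 2) (T K) ∧ Module.finrank (ZMod 2) (T K) ≤ 2 * r := by
  have hinj : Function.Injective ((Tmap j₁).prod (Tmap j₂)) := by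
    rw [← LinearMap.ker_eq_bot, LinearMap.ker_prod, E.range_Tδ, LinearMap.range_eq_bot]
    ext s
    rw [Subsingleton.elim s 0, map_zero, map_zero]
  have hf : ∀ (L : SSet.{u}) (γ : Fin r → T L), Submodule.span (ZMod 2) (Set.range γ) = ⊤ →
      Module.Finite (ZMod 2) (T L) ∧ Module.finrank (ZMod 2) (T L) ≤ r := by
    intro L γ h
    constructor
    · refine ⟨?_⟩
      rw [← h]
      exact Submodule.fg_span (Set.finite_range _)
    · have := finrank_range_le_card (R := ZMod 2) γ
      rwa [Set.finrank, h, finrank_top, Fintype.card_fin] at this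
  obtain ⟨hf₁, hr₁⟩ := hf _ _ h₁
  obtain ⟨hf₂, hr₂⟩ := hf _ _ h₂
  refine ⟨Module.Finite.of_injective _ hinj, ?_⟩
  have := LinearMap.finrank_le_finrank_of_injective hinj
  rw [Module.finrank_prod] at this
  omega

/-- Non-trivial classes of `K₀` yield non-trivial classes of `K`, one degree higher. -/
theorem exists_notMem_span {n : ℕ} (hn : r ≤ n + 1) (hβ : ∀ (j : Fin r) (m : ℕ), m ≠ j → β j m = 0)
    (h₁ : Submodule.span (ZMod 2) (Set.range fun j ↦ Tmap j₁ (β j)) = ⊤)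
    (h₂ : Submodule.span (ZMod 2) (Set.range fun j ↦ Tmap j₂ (β j)) = ⊤)
    (c : H K₀ n)
    (hc : Pi.single n c ∉ Submodule.span (ZMod 2) (Set.range fun j ↦ Tmap i₁ (Tmap j₁ (β j)))) :
    ∃ x : H K (n + 1), Pi.single (n + 1) x ∉ Submodule.span (ZMod 2) (Set.range β) := by
  refine ⟨E.δ n c, fun h ↦ hc ?_⟩
  obtain ⟨l, hl⟩ := (Submodule.mem_span_range_iff_exists_fun _).1 h
  -- The `β j` live in degrees below `r ≤ n + 1`, so their span is zero in degree `n + 1`. The class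
  -- `c` then comes from the two pieces, and the pieces are spanned by the `β j`.
  have h0 : E.δ n c = 0 := by
    have := congrFun hl (n + 1)
    rw [Pi.single_eq_same] at this
    rw [← this, Finset.sum_apply]
    refine Finset.sum_eq_zero fun j _ ↦ ?_
    rw [Pi.smul_apply, hβ j _ (by have := j.2; omega), smul_zero]
  have hconn := E.conn_δ n c
  rw [h0] at hconn
  obtain ⟨u, v, rfl⟩ := hconn.exists_of_zero E
  have hsum : (Pi.single n (map i₁ n u + map i₂ n v) : T K₀) =
      Pi.single n (map i₁ n u) + Pi.single n (map i₂ n v) :=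
    map_add (LinearMap.single (ZMod 2) (fun n ↦ H K₀ n) n) _ _
  rw [hsum]
  refine Submodule.add_mem _ ?_ ?_
  · rw [← Tmap_single]
    have hu : (Pi.single n u : T K₁) ∈ Submodule.span (ZMod 2) (Set.range fun j ↦ Tmap j₁ (β j)) :=
      h₁ ▸ Submodule.mem_top
    have := Submodule.mem_map_of_mem (f := Tmap i₁) hu
    rwa [Submodule.map_span, ← Set.range_comp] at this
  · rw [← Tmap_single]
    have hv : (Pi.single n v : T K₂) ∈ Submodule.span (ZMod 2) (Set.range fun j ↦ Tmap j₂ (β j)) :=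
      h₂ ▸ Submodule.mem_top
    have := Submodule.mem_map_of_mem (f := Tmap i₂) hv
    rw [Submodule.map_span, ← Set.range_comp] at this
    simp only [E.Tmap_comm]
    exact this

/-- The pieces are cohomologically disjoint, so there is a class equal to `β j` on one and to zero
on the other. Independence on the second piece would make any expansion in the `β`s trivial, against
independence on the first. -/
theorem exists_notMem_span_of_subsingleton [Subsingleton (T K₀)] (j : Fin r)
    (hβ : ∀ m : ℕ, m ≠ j → β j m = 0)
    (h₁ : LinearIndependent (ZMod 2) fun j ↦ Tmap j₁ (β j))
    (h₂ : LinearIndependent (ZMod 2) fun j ↦ Tmap j₂ (β j)) :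
    ∃ x : H K j, Pi.single (j : ℕ) x ∉ Submodule.span (ZMod 2) (Set.range β) := by
  obtain ⟨x, hx₁, hx₂⟩ := E.exists_of_map_eq (n := j) (Tmap j₁ (β j) j) 0 (by
    have : ∀ a b : H K₀ j, a = b := by
      intro a b
      have h := Subsingleton.elim (Pi.single (j : ℕ) a : T K₀) (Pi.single (j : ℕ) b)
      have := congrFun h j
      rwa [Pi.single_eq_same, Pi.single_eq_same] at this
    exact this _ _)
  refine ⟨x, fun h ↦ ?_⟩
  obtain ⟨l, hl⟩ := (Submodule.mem_span_range_iff_exists_fun _).1 h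
  have h0 : l = 0 := by
    have := congrArg (Tmap j₂) hl
    rw [Tmap_single, hx₂, Pi.single_zero, map_sum] at this
    simp only [map_smul] at this
    exact funext (Fintype.linearIndependent_iff.1 h₂ l this)
  rw [h0] at hl
  simp only [Pi.zero_apply, zero_smul, Finset.sum_const_zero] at hl
  have hx : x = 0 := by
    have := congrFun hl j
    rw [Pi.single_eq_same] at this
    exact this.symm
  refine h₁.ne_zero j ?_
  funext m
  by_cases hm : m = j
  · subst hm
    rw [← hx₁, hx, map_zero]
    rfl
  · rw [Tmap_apply, hβ m hm, map_zero]
    rfl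

end Excisive

end SSetMod2

/-! ## Chains of tuples in a convex set -/

namespace TupleChain

/-- Formal mod 2 chains of `(m + 1)`-tuples. -/
abbrev Ch (K : Type*) (m : ℕ) := (Fin (m + 1) → K) →₀ ZMod 2

section

variable {K L : Type*}

/-- The linear extension of a map on tuples. -/
noncomputable def lin {M : Type*} [AddCommGroup M] [Module (ZMod 2) M] {m : ℕ}
    (f : (Fin (m + 1) → K) → M) : Ch K m →ₗ[ZMod 2] M := Finsupp.linearCombination (ZMod 2) f

theorem lin_single {M : Type*} [AddCommGroup M] [Module (ZMod 2) M] {m : ℕ}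
    (f : (Fin (m + 1) → K) → M) (v : Fin (m + 1) → K) : lin f (Finsupp.single v 1) = f v := by
  rw [lin, Finsupp.linearCombination_single, one_smul]

theorem hom_ext {M : Type*} [AddCommGroup M] [Module (ZMod 2) M] {m : ℕ}
    {f g : Ch K m →ₗ[ZMod 2] M} (h : ∀ v, f (Finsupp.single v 1) = g (Finsupp.single v 1)) :
    f = g :=
  Finsupp.lhom_ext' fun v ↦ LinearMap.ext_ring (h v)

/-- The boundary. -/
noncomputable def bd (m : ℕ) : Ch K (m + 1) →ₗ[ZMod 2] Ch K m :=
  lin fun v ↦ ∑ i : Fin (m + 2), Finsupp.single (v ∘ i.succAbove) 1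

/-- The cone. -/
noncomputable def cone (b : K) (m : ℕ) : Ch K m →ₗ[ZMod 2] Ch K (m + 1) :=
  lin fun v ↦ Finsupp.single (Fin.cons b v : Fin (m + 2) → K) 1

/-- The augmentation. -/
noncomputable def aug : Ch K 0 →ₗ[ZMod 2] ZMod 2 := lin fun _ ↦ 1

/-- The chain map induced by a map. -/
noncomputable def push (f : K → L) (m : ℕ) : Ch K m →ₗ[ZMod 2] Ch L m :=
  lin fun v ↦ Finsupp.single (f ∘ v) 1

theorem add_self {m : ℕ} (c : Ch K m) : c + c = 0 := by
  ext v
  exact CharTwo.add_self_eq_zero _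

theorem bd_single {m : ℕ} (v : Fin (m + 2) → K) :
    bd m (Finsupp.single v 1) = ∑ i : Fin (m + 2), Finsupp.single (v ∘ i.succAbove) 1 :=
  lin_single _ _

theorem cone_single (b : K) {m : ℕ} (v : Fin (m + 1) → K) :
    cone b m (Finsupp.single v 1) = Finsupp.single (Fin.cons b v : Fin (m + 2) → K) 1 :=
  lin_single _ _

theorem push_single (f : K → L) {m : ℕ} (v : Fin (m + 1) → K) :
    push f m (Finsupp.single v 1) = Finsupp.single (f ∘ v) 1 :=
  lin_single _ _

theorem cons_comp_succAbove (b : K) {m : ℕ} (v : Fin (m + 2) → K) (j : Fin (m + 2)) :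
    (Fin.cons b v : Fin (m + 3) → K) ∘ j.succ.succAbove =
      (Fin.cons b (v ∘ j.succAbove) : Fin (m + 2) → K) := by
  funext i
  refine Fin.cases ?_ (fun i ↦ ?_) i
  · simp
  · simp

/-- The contracting homotopy from which all later chain identities are deduced: homotopies and
subdivisions are defined recursively as cones. -/
theorem bd_cone (b : K) (m : ℕ) (c : Ch K (m + 1)) :
    bd (m + 1) (cone b (m + 1) c) = c + cone b m (bd m c) := by
  suffices h : bd (m + 1) ∘ₗ cone b (m + 1) = LinearMap.id + cone b m ∘ₗ bd m from
    LinearMap.congr_fun h c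
  apply hom_ext
  intro v
  simp only [LinearMap.comp_apply, LinearMap.add_apply, LinearMap.id_apply, bd_single, cone_single,
    map_sum]
  rw [Fin.sum_univ_succ]
  congr 1
  refine Finset.sum_congr rfl fun j _ ↦ ?_
  rw [cons_comp_succAbove]

theorem bd_cone_zero (b : K) (c : Ch K 0) :
    bd 0 (cone b 0 c) = c + Finsupp.single (fun _ ↦ b) (aug c) := by
  suffices h : bd 0 ∘ₗ cone b 0 = LinearMap.id + Finsupp.lsingle (fun _ ↦ b) ∘ₗ aug from
    LinearMap.congr_fun h c
  apply hom_ext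
  intro v
  simp only [LinearMap.comp_apply, LinearMap.add_apply, LinearMap.id_apply, bd_single, cone_single]
  rw [aug, lin_single, Fin.sum_univ_two]
  congr 2
  funext i
  fin_cases i
  rfl

theorem aug_bd (c : Ch K 1) : aug (bd 0 c) = 0 := by
  suffices h : aug ∘ₗ bd 0 = (0 : Ch K 1 →ₗ[ZMod 2] ZMod 2) from LinearMap.congr_fun h c
  apply hom_ext
  intro v
  rw [LinearMap.comp_apply, bd_single, map_sum, Fin.sum_univ_two, aug, lin_single, lin_single]
  rfl

theorem exists_cone {m : ℕ} (v : Fin (m + 2) → K) :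
    (Finsupp.single v 1 : Ch K (m + 1)) = cone (v 0) m (Finsupp.single (Fin.tail v) 1) := by
  rw [cone_single, Fin.cons_self_tail]

/-- Every tuple is the cone from its first entry over its tail, so the cone formula and induction
give the claim without cancelling pairs of faces. -/
theorem bd_bd (m : ℕ) (c : Ch K (m + 2)) : bd m (bd (m + 1) c) = 0 := by
  induction m with
  | zero =>
    suffices h : bd 0 ∘ₗ bd 1 = (0 : Ch K 2 →ₗ[ZMod 2] Ch K 0) from LinearMap.congr_fun h c
    apply hom_ext
    intro v
    rw [LinearMap.comp_apply, exists_cone, bd_cone, map_add, bd_cone_zero, aug_bd,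
      Finsupp.single_zero, add_zero, add_self]
    rfl
  | succ m ih =>
    suffices h : bd (m + 1) ∘ₗ bd (m + 2) = (0 : Ch K (m + 3) →ₗ[ZMod 2] Ch K (m + 1)) from
      LinearMap.congr_fun h c
    apply hom_ext
    intro v
    rw [LinearMap.comp_apply, exists_cone, bd_cone, map_add, bd_cone, ih, map_zero, add_zero,
      add_self]
    rfl

theorem push_bd (f : K → L) (m : ℕ) (c : Ch K (m + 1)) :
    push f m (bd m c) = bd m (push f (m + 1) c) := by
  suffices h : push f m ∘ₗ bd m = bd m ∘ₗ push f (m + 1) from LinearMap.congr_fun h c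
  apply hom_ext
  intro v
  simp only [LinearMap.comp_apply, bd_single, push_single, map_sum]
  rfl

theorem push_cone (f : K → L) (b : K) (m : ℕ) (c : Ch K m) :
    push f (m + 1) (cone b m c) = cone (f b) m (push f m c) := by
  suffices h : push f (m + 1) ∘ₗ cone b m = cone (f b) m ∘ₗ push f m from LinearMap.congr_fun h c
  apply hom_ext
  intro v
  simp only [LinearMap.comp_apply, cone_single, push_single]
  rw [Fin.comp_cons]

theorem aug_push (f : K → L) (c : Ch K 0) : aug (push f 0 c) = aug c := by
  suffices h : aug ∘ₗ push f 0 = aug from LinearMap.congr_fun h c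
  apply hom_ext
  intro v
  rw [LinearMap.comp_apply, push_single, aug, aug, lin_single, lin_single]

/-- The chains supported in a set. -/
noncomputable def supp (A : Set K) (m : ℕ) : Submodule (ZMod 2) (Ch K m) :=
  Finsupp.supported (ZMod 2) (ZMod 2) {v | ∀ i, v i ∈ A}

theorem single_mem_supp {A : Set K} {m : ℕ} {v : Fin (m + 1) → K} (h : ∀ i, v i ∈ A) :
    Finsupp.single v 1 ∈ supp A m :=
  Finsupp.single_mem_supported _ _ h

theorem map_mem_of_mem_supp {M : Type*} [AddCommGroup M] [Module (ZMod 2) M] {A : Set K} {m : ℕ}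
    {c : Ch K m} (hc : c ∈ supp A m) (f : Ch K m →ₗ[ZMod 2] M) (N : Submodule (ZMod 2) M)
    (h : ∀ v : Fin (m + 1) → K, (∀ i, v i ∈ A) → f (Finsupp.single v 1) ∈ N) : f c ∈ N := by
  rw [supp, Finsupp.supported_eq_span_single] at hc
  have : Submodule.span (ZMod 2) ((fun v ↦ Finsupp.single v 1) '' {v | ∀ i, v i ∈ A}) ≤
      N.comap f := by
    rw [Submodule.span_le]
    rintro _ ⟨v, hv, rfl⟩
    exact h v hv
  exact this hc

theorem cone_mem_supp {A : Set K} {b : K} (hb : b ∈ A) {m : ℕ} {c : Ch K m} (hc : c ∈ supp A m) :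
    cone b m c ∈ supp A (m + 1) := by
  refine map_mem_of_mem_supp hc _ _ fun v hv ↦ ?_
  rw [cone_single]
  refine single_mem_supp fun i ↦ ?_
  refine Fin.cases ?_ (fun i ↦ ?_) i
  · exact hb
  · exact hv i

theorem bd_single_mem_supp {A : Set K} {m : ℕ} {v : Fin (m + 2) → K} (hv : ∀ i, v i ∈ A) :
    bd m (Finsupp.single v 1) ∈ supp A m := by
  rw [bd_single]
  exact Submodule.sum_mem _ fun i _ ↦ single_mem_supp fun j ↦ hv _

/-! ### The acyclic carrier homotopy -/

/-- The chain homotopy between two chain maps `φ` and `ψ` built by coning off at the points `b`. -/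
noncomputable def htpy (b : ∀ m, (Fin (m + 1) → K) → L) (φ ψ : ∀ m, Ch K m →ₗ[ZMod 2] Ch L m) :
    ∀ m, Ch K m →ₗ[ZMod 2] Ch L (m + 1)
  | 0 => lin fun v ↦ cone (b 0 v) 0 (φ 0 (Finsupp.single v 1) + ψ 0 (Finsupp.single v 1))
  | m + 1 => lin fun v ↦ cone (b (m + 1) v) (m + 1)
      (φ (m + 1) (Finsupp.single v 1) + ψ (m + 1) (Finsupp.single v 1) +
        htpy b φ ψ m (bd m (Finsupp.single v 1)))

variable (b : ∀ m, (Fin (m + 1) → K) → L) {φ ψ : ∀ m, Ch K m →ₗ[ZMod 2] Ch L m}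

theorem bd_htpy_zero (hφa : ∀ c, aug (φ 0 c) = aug c) (hψa : ∀ c, aug (ψ 0 c) = aug c)
    (c : Ch K 0) : bd 0 (htpy b φ ψ 0 c) = φ 0 c + ψ 0 c := by
  suffices h : bd 0 ∘ₗ htpy b φ ψ 0 = φ 0 + ψ 0 from LinearMap.congr_fun h c
  apply hom_ext
  intro v
  rw [LinearMap.comp_apply, htpy, lin_single, bd_cone_zero, map_add, hφa, hψa,
    CharTwo.add_self_eq_zero, Finsupp.single_zero, add_zero]
  rfl

/-- The acyclic carrier argument: the chain `φ v + ψ v + h (∂ v)` is a cycle by the identity one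
degree lower, hence is bounded by its cone. -/
theorem bd_htpy_succ (hφa : ∀ c, aug (φ 0 c) = aug c) (hψa : ∀ c, aug (ψ 0 c) = aug c)
    (hφ : ∀ m c, bd m (φ (m + 1) c) = φ m (bd m c))
    (hψ : ∀ m c, bd m (ψ (m + 1) c) = ψ m (bd m c)) (m : ℕ) (c : Ch K (m + 1)) :
    bd (m + 1) (htpy b φ ψ (m + 1) c) = φ (m + 1) c + ψ (m + 1) c + htpy b φ ψ m (bd m c) := by
  suffices key : ∀ v : Fin (m + 2) → K,
      bd m (φ (m + 1) (Finsupp.single v 1) + ψ (m + 1) (Finsupp.single v 1) +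
        htpy b φ ψ m (bd m (Finsupp.single v 1))) = 0 by
    suffices h : bd (m + 1) ∘ₗ htpy b φ ψ (m + 1) =
      φ (m + 1) + ψ (m + 1) + htpy b φ ψ m ∘ₗ bd m from LinearMap.congr_fun h c
    apply hom_ext
    intro v
    rw [LinearMap.comp_apply, htpy, lin_single, bd_cone, key, map_zero, add_zero]
    rfl
  intro v
  rw [map_add, map_add, hφ, hψ]
  cases m with
  | zero => rw [bd_htpy_zero b hφa hψa, add_self]
  | succ m =>
    rw [bd_htpy_succ hφa hψa hφ hψ m, bd_bd, map_zero, add_zero, add_self]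

/-- Naturality reduces to naturality of the cone points. It makes the homotopies on different
standard simplices compatible with face maps, as required to define cochains simplex by simplex. -/
theorem push_htpy {K' L' : Type*} {b' : ∀ m, (Fin (m + 1) → K') → L'}
    {φ' ψ' : ∀ m, Ch K' m →ₗ[ZMod 2] Ch L' m} (f : K → K') (g : L → L')
    (hb : ∀ m v, g (b m v) = b' m (f ∘ v)) (hφ : ∀ m c, push g m (φ m c) = φ' m (push f m c))
    (hψ : ∀ m c, push g m (ψ m c) = ψ' m (push f m c)) (m : ℕ) (c : Ch K m) :
    push g (m + 1) (htpy b φ ψ m c) = htpy b' φ' ψ' m (push f m c) := by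
  induction m with
  | zero =>
    suffices h : push g 1 ∘ₗ htpy b φ ψ 0 = htpy b' φ' ψ' 0 ∘ₗ push f 0 from
      LinearMap.congr_fun h c
    apply hom_ext
    intro v
    rw [LinearMap.comp_apply, LinearMap.comp_apply, htpy, htpy, push_single, lin_single,
      lin_single, push_cone, map_add, hφ, hψ, hb, push_single]
  | succ m ih =>
    suffices h : push g (m + 2) ∘ₗ htpy b φ ψ (m + 1) = htpy b' φ' ψ' (m + 1) ∘ₗ push f (m + 1) from
      LinearMap.congr_fun h c
    apply hom_ext
    intro v
    rw [LinearMap.comp_apply, LinearMap.comp_apply, htpy, htpy, push_single, lin_single,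
      lin_single, push_cone, map_add (push g (m + 1)), map_add (push g (m + 1)), hφ, hψ, hb, ih,
      push_bd, push_single]

theorem htpy_single_mem_supp {A : Set K} {B : Set L}
    (hb : ∀ m v, (∀ i, v i ∈ A) → b m v ∈ B)
    (hφ : ∀ m v, (∀ i, v i ∈ A) → φ m (Finsupp.single v 1) ∈ supp B m)
    (hψ : ∀ m v, (∀ i, v i ∈ A) → ψ m (Finsupp.single v 1) ∈ supp B m) (m : ℕ)
    (v : Fin (m + 1) → K) (hv : ∀ i, v i ∈ A) :
    htpy b φ ψ m (Finsupp.single v 1) ∈ supp B (m + 1) := by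
  induction m with
  | zero =>
    rw [htpy, lin_single]
    exact cone_mem_supp (hb _ _ hv) (Submodule.add_mem _ (hφ _ _ hv) (hψ _ _ hv))
  | succ m ih =>
    rw [htpy, lin_single]
    refine cone_mem_supp (hb _ _ hv) (Submodule.add_mem _
      (Submodule.add_mem _ (hφ _ _ hv) (hψ _ _ hv)) ?_)
    exact map_mem_of_mem_supp (bd_single_mem_supp hv) _ _ ih

/-! ### Subdivision -/

/-- Subdivision of chains, coning off at the points `b`. -/
noncomputable def sd (b : ∀ m, (Fin (m + 1) → K) → K) : ∀ m, Ch K m →ₗ[ZMod 2] Ch K m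
  | 0 => LinearMap.id
  | m + 1 => lin fun v ↦ cone (b (m + 1) v) m (sd b m (bd m (Finsupp.single v 1)))

variable (b : ∀ m, (Fin (m + 1) → K) → K)

theorem bd_sd (m : ℕ) (c : Ch K (m + 1)) : bd m (sd b (m + 1) c) = sd b m (bd m c) := by
  induction m with
  | zero =>
    suffices h : bd 0 ∘ₗ sd b 1 = sd b 0 ∘ₗ bd 0 from LinearMap.congr_fun h c
    apply hom_ext
    intro v
    change bd 0 (lin (fun v ↦ cone (b 1 v) 0 (bd 0 (Finsupp.single v 1))) (Finsupp.single v 1)) =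
      bd 0 (Finsupp.single v 1)
    rw [lin_single, bd_cone_zero, aug_bd, Finsupp.single_zero, add_zero]
  | succ m ih =>
    suffices h : bd (m + 1) ∘ₗ sd b (m + 2) = sd b (m + 1) ∘ₗ bd (m + 1) from
      LinearMap.congr_fun h c
    apply hom_ext
    intro v
    rw [LinearMap.comp_apply, LinearMap.comp_apply, sd, lin_single, bd_cone, ih, bd_bd, map_zero,
      map_zero, add_zero]

theorem push_sd {b' : ∀ m, (Fin (m + 1) → L) → L} (f : K → L)
    (hb : ∀ m v, f (b m v) = b' m (f ∘ v)) (m : ℕ) (c : Ch K m) :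
    push f m (sd b m c) = sd b' m (push f m c) := by
  induction m with
  | zero => rfl
  | succ m ih =>
    suffices h : push f (m + 1) ∘ₗ sd b (m + 1) = sd b' (m + 1) ∘ₗ push f (m + 1) from
      LinearMap.congr_fun h c
    apply hom_ext
    intro v
    rw [LinearMap.comp_apply, LinearMap.comp_apply, sd, sd, push_single, lin_single, lin_single,
      push_cone, ih, hb, push_bd, push_single]

theorem sd_single_mem_supp {A : Set K} (hb : ∀ m v, (∀ i, v i ∈ A) → b m v ∈ A) (m : ℕ)
    (v : Fin (m + 1) → K) (hv : ∀ i, v i ∈ A) : sd b m (Finsupp.single v 1) ∈ supp A m := by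
  induction m with
  | zero => exact single_mem_supp hv
  | succ m ih =>
    rw [sd, lin_single]
    exact cone_mem_supp (hb _ _ hv) (map_mem_of_mem_supp (bd_single_mem_supp hv) _ _ ih)

end

end TupleChain

/-! ## Orbits of singular simplices -/

/-- The map of standard simplices induced by a map of vertices. -/
noncomputable def simplexMap {m n : ℕ} (f : Fin (m + 1) → Fin (n + 1)) :
    C(stdSimplex ℝ (Fin (m + 1)), stdSimplex ℝ (Fin (n + 1))) :=
  ⟨stdSimplex.map f, stdSimplex.continuous_map f⟩

theorem simplexMap_id (n : ℕ) : simplexMap (id : Fin (n + 1) → Fin (n + 1)) = ContinuousMap.id _ :=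
  ContinuousMap.ext fun x ↦ stdSimplex.map_id_apply x

theorem simplexMap_comp {l m n : ℕ} (f : Fin (l + 1) → Fin (m + 1)) (g : Fin (m + 1) → Fin (n + 1)) :
    (simplexMap g).comp (simplexMap f) = simplexMap (g ∘ f) :=
  ContinuousMap.ext fun x ↦ stdSimplex.map_comp_apply f g x

/-- The singular simplices of `X` up to the action of a group `G`. -/
noncomputable def Orb (G : Type v) (X : Type u) [Group G] [TopologicalSpace X] [MulAction G X]
    [ContinuousConstSMul G X] : SSet.{u} where
  obj n := Quotient (MulAction.orbitRel G C(stdSimplex ℝ (Fin (n.unop.len + 1)), X))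
  map φ := ↾(Quotient.map (fun σ ↦ σ.comp (simplexMap φ.unop.toOrderHom)) (by
    rintro _ σ ⟨g, rfl⟩
    exact ⟨g, rfl⟩))
  map_id n := by
    ext ⟨σ⟩
    change Quotient.mk _ (σ.comp (simplexMap id)) = Quotient.mk _ σ
    rw [simplexMap_id]
    rfl
  map_comp φ ψ := by
    ext ⟨σ⟩
    change Quotient.mk _ (σ.comp (simplexMap (φ.unop.toOrderHom ∘ ψ.unop.toOrderHom))) =
      Quotient.mk _ ((σ.comp _).comp _)
    rw [← simplexMap_comp]
    rfl

namespace Orb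

open SSetMod2

section

variable (G : Type v) {X : Type u} [Group G] [TopologicalSpace X] [MulAction G X]
  [ContinuousConstSMul G X]

/-- The orbit of a singular simplex. -/
def mk {n : ℕ} (σ : C(stdSimplex ℝ (Fin (n + 1)), X)) :
    (Orb G X).obj (op (SimplexCategory.mk n)) :=
  Quotient.mk (MulAction.orbitRel G C(stdSimplex ℝ (Fin (n + 1)), X)) σ

variable {G}

theorem mk_surjective {n : ℕ} (τ : (Orb G X).obj (op (SimplexCategory.mk n))) :
    ∃ σ : C(stdSimplex ℝ (Fin (n + 1)), X), mk G σ = τ :=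
  Quotient.exists_rep τ

theorem mk_eq_mk_iff {n : ℕ} (σ τ : C(stdSimplex ℝ (Fin (n + 1)), X)) :
    mk G σ = mk G τ ↔ ∃ g : G, g • τ = σ :=
  Quotient.eq

theorem mk_smul {n : ℕ} (g : G) (σ : C(stdSimplex ℝ (Fin (n + 1)), X)) : mk G (g • σ) = mk G σ :=
  (mk_eq_mk_iff _ _).2 ⟨g, rfl⟩

/-- The face of a singular simplex. -/
noncomputable def face {n : ℕ} (i : Fin (n + 2)) (σ : C(stdSimplex ℝ (Fin (n + 2)), X)) :
    C(stdSimplex ℝ (Fin (n + 1)), X) :=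
  σ.comp (simplexMap i.succAbove)

theorem coboundary_mk {n : ℕ} (f : Cochain (Orb G X) n) (σ : C(stdSimplex ℝ (Fin (n + 2)), X)) :
    coboundary (Orb G X) n f (mk G σ) = ∑ i : Fin (n + 2), f (mk G (face i σ)) := rfl

theorem cochain_ext {n : ℕ} {f g : Cochain (Orb G X) n} (h : ∀ σ, f (mk G σ) = g (mk G σ)) :
    f = g := by
  funext τ
  obtain ⟨σ, rfl⟩ := mk_surjective τ
  exact h σ

/-- The cochain given by an invariant function on singular simplices. -/
def ofInvariant {n : ℕ} (F : C(stdSimplex ℝ (Fin (n + 1)), X) → ZMod 2)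
    (hF : ∀ (g : G) σ, F (g • σ) = F σ) : Cochain (Orb G X) n :=
  Quotient.lift (s := MulAction.orbitRel G C(stdSimplex ℝ (Fin (n + 1)), X)) F (by
    rintro _ σ ⟨g, rfl⟩
    exact hF g σ)

theorem ofInvariant_mk {n : ℕ} (F : C(stdSimplex ℝ (Fin (n + 1)), X) → ZMod 2)
    (hF : ∀ (g : G) σ, F (g • σ) = F σ) (σ : C(stdSimplex ℝ (Fin (n + 1)), X)) :
    ofInvariant F hF (mk G σ) = F σ := rfl

end

section maps

variable {G : Type*} {G' : Type*} {G'' : Type*} {X Y Z : Type u} [Group G] [TopologicalSpace X]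
  [MulAction G X] [ContinuousConstSMul G X] [Group G'] [TopologicalSpace Y] [MulAction G' Y]
  [ContinuousConstSMul G' Y] [Group G''] [TopologicalSpace Z] [MulAction G'' Z]
  [ContinuousConstSMul G'' Z]

variable (G G') in
/-- A map which sends translates to translates. -/
def Equivar (φ : C(X, Y)) : Prop := ∀ g : G, ∃ g' : G', ∀ x, φ (g • x) = g' • φ x

/-- The map induced on orbits of singular simplices. -/
noncomputable def map (φ : C(X, Y)) (hφ : Equivar G G' φ) : Orb G X ⟶ Orb G' Y where
  app n := ↾(Quotient.map (fun σ ↦ φ.comp σ) (by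
    rintro _ σ ⟨g, rfl⟩
    obtain ⟨g', hg'⟩ := hφ g
    exact ⟨g', ContinuousMap.ext fun x ↦ (hg' (σ x)).symm⟩))
  naturality m n f := by
    ext ⟨σ⟩
    rfl

theorem map_app_mk (φ : C(X, Y)) (hφ : Equivar G G' φ) {n : ℕ}
    (σ : C(stdSimplex ℝ (Fin (n + 1)), X)) :
    (map φ hφ).app (op (SimplexCategory.mk n)) (mk G σ) = mk G' (φ.comp σ) := rfl

theorem hom_ext {K : SSet.{u}} {φ ψ : Orb G X ⟶ K}
    (h : ∀ n (σ : C(stdSimplex ℝ (Fin (n + 1)), X)),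
      φ.app (op (SimplexCategory.mk n)) (mk G σ) = ψ.app (op (SimplexCategory.mk n)) (mk G σ)) :
    φ = ψ := by
  ext ⟨n⟩ ⟨σ⟩
  exact h n.len σ

theorem map_comp_map (φ : C(X, Y)) (hφ : Equivar G G' φ) (ψ : C(Y, Z)) (hψ : Equivar G' G'' ψ)
    (χ : C(X, Z)) (hχ : Equivar G G'' χ) (h : ∀ x, ψ (φ x) = χ x) :
    map φ hφ ≫ map ψ hψ = map χ hχ := by
  apply hom_ext
  intro n σ
  change mk G'' (ψ.comp (φ.comp σ)) = mk G'' (χ.comp σ)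
  congr 1
  exact ContinuousMap.ext fun x ↦ h (σ x)

theorem map_id' (φ : C(X, X)) (hφ : Equivar G G φ) (h : ∀ x, φ x = x) : map φ hφ = 𝟙 _ := by
  apply hom_ext
  intro n σ
  change mk G (φ.comp σ) = mk G σ
  congr 1
  exact ContinuousMap.ext fun x ↦ h (σ x)

end maps

end Orb

/-! ## Affine simplices and evaluation of cochains on chains of tuples -/

open TupleChain

section affine

variable {E : Type*} [AddCommGroup E] [Module ℝ E] [TopologicalSpace E] [ContinuousAdd E]
  [ContinuousSMul ℝ E] {s : Set E} (hs : Convex ℝ s)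

/-- The affine singular simplex with given vertices. -/
noncomputable def affineSimplex {m : ℕ} (v : Fin (m + 1) → s) :
    C(stdSimplex ℝ (Fin (m + 1)), s) where
  toFun t := ⟨∑ i, t i • (v i : E), hs.sum_mem (fun i _ ↦ t.2.1 i) t.2.2 (fun i _ ↦ (v i).2)⟩
  continuous_toFun := by
    refine Continuous.subtype_mk (continuous_finsetSum _ fun i _ ↦ ?_) _
    exact ((continuous_apply i).comp continuous_subtype_val).smul continuous_const

theorem affineSimplex_coe {m : ℕ} (v : Fin (m + 1) → s) (t : stdSimplex ℝ (Fin (m + 1))) :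
    (affineSimplex hs v t : E) = ∑ i, t i • (v i : E) := rfl

theorem affineSimplex_comp_simplexMap {m n : ℕ} (v : Fin (n + 1) → s)
    (f : Fin (m + 1) → Fin (n + 1)) :
    (affineSimplex hs v).comp (simplexMap f) = affineSimplex hs (v ∘ f) := by
  ext t
  change ∑ j, (stdSimplex.map f t) j • (v j : E) = ∑ i, t i • (v (f i) : E)
  simp only [stdSimplex.map_coe, FunOnFinite.linearMap_apply_apply, Finset.sum_smul]
  rw [← Finset.sum_fiberwise Finset.univ f]
  refine Finset.sum_congr rfl fun j _ ↦ Finset.sum_congr rfl fun i hi ↦ ?_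
  rw [(Finset.mem_filter.1 hi).2]

theorem affineSimplex_mem {m : ℕ} (v : Fin (m + 1) → s) {A : Set s}
    (hA : Convex ℝ (Subtype.val '' A)) (hv : ∀ i, v i ∈ A) (t : stdSimplex ℝ (Fin (m + 1))) :
    affineSimplex hs v t ∈ A := by
  have h : (affineSimplex hs v t : E) ∈ Subtype.val '' A :=
    hA.sum_mem (fun i _ ↦ t.2.1 i) t.2.2 (fun i _ ↦ ⟨v i, hv i, rfl⟩)
  obtain ⟨y, hy, hy'⟩ := h
  rwa [← Subtype.ext hy']

variable {E' : Type*} [AddCommGroup E'] [Module ℝ E'] [TopologicalSpace E'] [ContinuousAdd E']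
  [ContinuousSMul ℝ E'] {s' : Set E'} (hs' : Convex ℝ s')

theorem comp_affineSimplex {m : ℕ} (v : Fin (m + 1) → s) (φ : C(s, s')) (Φ : E →ₗ[ℝ] E')
    (hφ : ∀ x : s, (φ x : E') = Φ x) :
    φ.comp (affineSimplex hs v) = affineSimplex hs' (φ ∘ v) := by
  ext t
  change (φ _ : E') = ∑ i, t i • (φ (v i) : E')
  rw [hφ, affineSimplex_coe, map_sum]
  simp only [map_smul, hφ]

variable {X : Type*} [TopologicalSpace X]

/-- Evaluation of a cochain on a chain of tuples, by means of a map to `X`. -/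
noncomputable def evalChain (τ : C(s, X)) {n : ℕ} (F : C(stdSimplex ℝ (Fin (n + 1)), X) → ZMod 2) :
    Ch s n →ₗ[ZMod 2] ZMod 2 :=
  lin fun v ↦ F (τ.comp (affineSimplex hs v))

theorem evalChain_single (τ : C(s, X)) {n : ℕ}
    (F : C(stdSimplex ℝ (Fin (n + 1)), X) → ZMod 2) (v : Fin (n + 1) → s) :
    evalChain hs τ F (Finsupp.single v 1) = F (τ.comp (affineSimplex hs v)) :=
  lin_single _ _

theorem evalChain_bd (τ : C(s, X)) {n : ℕ} (F : C(stdSimplex ℝ (Fin (n + 1)), X) → ZMod 2)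
    (c : Ch s (n + 1)) :
    evalChain hs τ F (bd n c) =
      evalChain hs τ (fun σ ↦ ∑ i : Fin (n + 2), F (Orb.face i σ)) c := by
  suffices h : evalChain hs τ F ∘ₗ bd n =
    evalChain hs τ (fun σ ↦ ∑ i : Fin (n + 2), F (Orb.face i σ)) from LinearMap.congr_fun h c
  apply TupleChain.hom_ext
  intro v
  rw [LinearMap.comp_apply, evalChain_single, bd_single, map_sum]
  refine Finset.sum_congr rfl fun i _ ↦ ?_
  rw [evalChain_single, ← affineSimplex_comp_simplexMap]
  rfl

theorem evalChain_push (τ : C(s', X)) (φ : C(s, s')) (Φ : E →ₗ[ℝ] E')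
    (hφ : ∀ x : s, (φ x : E') = Φ x) {n : ℕ} (F : C(stdSimplex ℝ (Fin (n + 1)), X) → ZMod 2)
    (c : Ch s n) :
    evalChain hs' τ F (push φ n c) = evalChain hs (τ.comp φ) F c := by
  suffices h : evalChain hs' τ F ∘ₗ push φ n = evalChain hs (τ.comp φ) F from
    LinearMap.congr_fun h c
  apply TupleChain.hom_ext
  intro v
  rw [LinearMap.comp_apply, push_single, evalChain_single, evalChain_single,
    ContinuousMap.comp_assoc, comp_affineSimplex hs hs' v φ Φ hφ]

theorem evalChain_smul {G : Type*} [Group G] [MulAction G X] [ContinuousConstSMul G X] (g : G)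
    (τ : C(s, X)) {n : ℕ} (F : C(stdSimplex ℝ (Fin (n + 1)), X) → ZMod 2)
    (hF : ∀ σ, F (g • σ) = F σ) (c : Ch s n) :
    evalChain hs (g • τ) F c = evalChain hs τ F c := by
  congr 1
  apply TupleChain.hom_ext
  intro v
  rw [evalChain_single, evalChain_single]
  exact hF (τ.comp (affineSimplex hs v))

end affine

/-! ### The tautological simplex, on which natural chain operators are evaluated. -/

section vertices

/-- The tuple of vertices of the standard simplex. -/
noncomputable def vertices (n : ℕ) (i : Fin (n + 1)) : stdSimplex ℝ (Fin (n + 1)) :=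
  stdSimplex.vertex i

/-- The tautological chain. -/
noncomputable def tautChain (n : ℕ) : Ch (stdSimplex ℝ (Fin (n + 1))) n :=
  Finsupp.single (vertices n) 1

theorem affineSimplex_vertices (n : ℕ) :
    affineSimplex (convex_stdSimplex ℝ (Fin (n + 1))) (vertices n) = ContinuousMap.id _ := by
  refine ContinuousMap.ext fun t ↦ Subtype.ext ?_
  change (∑ i, t i • (Pi.single i 1 : Fin (n + 1) → ℝ)) = t.1
  funext j
  rw [Finset.sum_apply]
  simp [Pi.single_apply]
  rfl

theorem simplexMap_vertices {m n : ℕ} (f : Fin (m + 1) → Fin (n + 1)) :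
    simplexMap f ∘ vertices m = vertices n ∘ f :=
  funext fun i ↦ stdSimplex.map_vertex f i

theorem bd_tautChain (n : ℕ) :
    bd n (tautChain (n + 1)) = ∑ i : Fin (n + 2), push (simplexMap i.succAbove) n (tautChain n) := by
  rw [tautChain, bd_single]
  refine Finset.sum_congr rfl fun i _ ↦ ?_
  rw [tautChain, push_single, simplexMap_vertices]

/-- The linear map which extends `simplexMap`. -/
noncomputable def simplexLin {m n : ℕ} (f : Fin (m + 1) → Fin (n + 1)) :
    (Fin (m + 1) → ℝ) →ₗ[ℝ] (Fin (n + 1) → ℝ) := FunOnFinite.linearMap ℝ ℝ f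

theorem simplexMap_coe {m n : ℕ} (f : Fin (m + 1) → Fin (n + 1)) (x : stdSimplex ℝ (Fin (m + 1))) :
    (simplexMap f x : Fin (n + 1) → ℝ) = simplexLin f x := rfl

end vertices

open TupleChain SSetMod2

/-! ## Homotopy invariance -/

section prism

/-- The cylinder over the standard simplex. -/
def cylinder (n : ℕ) : Set ((Fin (n + 1) → ℝ) × ℝ) :=
  stdSimplex ℝ (Fin (n + 1)) ×ˢ Set.Icc (0 : ℝ) 1

theorem convex_cylinder (n : ℕ) : Convex ℝ (cylinder n) :=
  (convex_stdSimplex ℝ (Fin (n + 1))).prod (convex_Icc 0 1)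

/-- The inclusion of the standard simplex at height `e`. -/
def cylinderIncl (n : ℕ) (e : unitInterval) (x : stdSimplex ℝ (Fin (n + 1))) : cylinder n :=
  ⟨(x, e), x.2, e.2⟩

/-- The map of cylinders induced by a map of vertices. -/
noncomputable def cylinderMap {m n : ℕ} (f : Fin (m + 1) → Fin (n + 1)) :
    C(cylinder m, cylinder n) where
  toFun p := ⟨(simplexMap f ⟨p.1.1, p.2.1⟩, p.1.2), (simplexMap f ⟨p.1.1, p.2.1⟩).2, p.2.2⟩
  continuous_toFun := by fun_prop

/-- The prism operator. -/
noncomputable def prism (n m : ℕ) : Ch (stdSimplex ℝ (Fin (n + 1))) m →ₗ[ZMod 2]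
    Ch (cylinder n) (m + 1) :=
  htpy (fun _ v ↦ cylinderIncl n 0 (v 0)) (push (cylinderIncl n 0)) (push (cylinderIncl n 1)) m

theorem push_prism {l n : ℕ} (f : Fin (l + 1) → Fin (n + 1)) (m : ℕ)
    (c : Ch (stdSimplex ℝ (Fin (l + 1))) m) :
    push (cylinderMap f) (m + 1) (prism l m c) = prism n m (push (simplexMap f) m c) := by
  have h : ∀ e m (c : Ch (stdSimplex ℝ (Fin (l + 1))) m),
      push (cylinderMap f) m (push (cylinderIncl l e) m c) =
        push (cylinderIncl n e) m (push (simplexMap f) m c) := by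
    intro e m c
    suffices h : push (cylinderMap f) m ∘ₗ push (cylinderIncl l e) m =
      push (cylinderIncl n e) m ∘ₗ push (simplexMap f) m from LinearMap.congr_fun h c
    apply TupleChain.hom_ext
    intro v
    simp only [LinearMap.comp_apply, push_single]
    rfl
  exact push_htpy _ (simplexMap f) (cylinderMap f) (fun _ _ ↦ rfl) (h 0) (h 1) m c

theorem bd_prism_zero (n : ℕ) (c : Ch (stdSimplex ℝ (Fin (n + 1))) 0) :
    bd 0 (prism n 0 c) = push (cylinderIncl n 0) 0 c + push (cylinderIncl n 1) 0 c :=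
  bd_htpy_zero _ (aug_push _) (aug_push _) c

theorem bd_prism_succ (n m : ℕ) (c : Ch (stdSimplex ℝ (Fin (n + 1))) (m + 1)) :
    bd (m + 1) (prism n (m + 1) c) =
      push (cylinderIncl n 0) (m + 1) c + push (cylinderIncl n 1) (m + 1) c +
        prism n m (bd m c) :=
  bd_htpy_succ _ (aug_push _) (aug_push _) (fun m c ↦ (push_bd _ m c).symm)
    (fun m c ↦ (push_bd _ m c).symm) m c

variable {X Y : Type*} [TopologicalSpace X] [TopologicalSpace Y]

/-- The product of a singular simplex with the unit interval. -/
def cylinderSimplex {n : ℕ} (σ : C(stdSimplex ℝ (Fin (n + 1)), X)) :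
    C(cylinder n, X × unitInterval) where
  toFun p := (σ ⟨p.1.1, p.2.1⟩, ⟨p.1.2, p.2.2⟩)
  continuous_toFun := by fun_prop

theorem evalChain_push_cylinderIncl (Φ : C(X × unitInterval, Y)) {n : ℕ}
    (F : C(stdSimplex ℝ (Fin (n + 1)), Y) → ZMod 2) (e : unitInterval)
    (σ : C(stdSimplex ℝ (Fin (n + 1)), X)) :
    evalChain (convex_cylinder n) (Φ.comp (cylinderSimplex σ)) F
        (push (cylinderIncl n e) n (tautChain n)) =
      F ((Φ.comp ((ContinuousMap.id X).prodMk (ContinuousMap.const X e))).comp σ) := by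
  rw [tautChain, push_single, evalChain_single]
  congr 1
  have : affineSimplex (convex_cylinder n) (cylinderIncl n e ∘ vertices n) =
      ⟨cylinderIncl n e, by unfold cylinderIncl; fun_prop⟩ := by
    refine ContinuousMap.ext fun t ↦ Subtype.ext ?_
    rw [affineSimplex_coe]
    refine Prod.ext ?_ ?_
    · rw [Prod.fst_sum]
      exact congrArg Subtype.val (ContinuousMap.congr_fun (affineSimplex_vertices n) t)
    · rw [Prod.snd_sum]
      change ∑ i, t i * (e : ℝ) = e
      rw [← Finset.sum_mul, stdSimplex.sum_eq_one, one_mul]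
  rw [this]
  rfl

theorem comp_cylinderSimplex_face {n : ℕ} (σ : C(stdSimplex ℝ (Fin (n + 2)), X)) (i : Fin (n + 2)) :
    cylinderSimplex (Orb.face i σ) = (cylinderSimplex σ).comp (cylinderMap i.succAbove) := rfl

end prism

namespace Orb

section homotopy

variable {G : Type*} {G' : Type*} {X Y : Type u} [Group G] [TopologicalSpace X]
  [MulAction G X] [ContinuousConstSMul G X] [Group G'] [TopologicalSpace Y] [MulAction G' Y]
  [ContinuousConstSMul G' Y]

/-- The time `e` of a homotopy. -/
def slice (Φ : C(X × unitInterval, Y)) (e : unitInterval) : C(X, Y) :=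
  Φ.comp ((ContinuousMap.id X).prodMk (ContinuousMap.const X e))

/-- Identities between tuple chains become identities between cochain values: a cocycle on orbits
vanishes on every boundary pushed into `X`. -/
theorem evalChain_bd_eq_zero {E : Type*} [AddCommGroup E] [Module ℝ E] [TopologicalSpace E]
    [ContinuousAdd E] [ContinuousSMul ℝ E] {s : Set E} (hs : Convex ℝ s) (τ : C(s, X)) {n : ℕ}
    (f : Cochain (Orb G X) n) (hf : f ∈ cocycles (Orb G X) n) (c : Ch s (n + 1)) :
    evalChain hs τ (fun σ ↦ f (mk G σ)) (bd n c) = 0 := by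
  rw [evalChain_bd]
  have : (fun σ ↦ ∑ i : Fin (n + 2), f (mk G (face i σ))) =
      fun _ : C(stdSimplex ℝ (Fin (n + 2)), X) ↦ (0 : ZMod 2) := by
    funext σ
    rw [← coboundary_mk]
    exact congrFun hf (mk G σ)
  rw [this]
  suffices h : evalChain hs τ (fun _ : C(stdSimplex ℝ (Fin (n + 2)), X) ↦ (0 : ZMod 2)) = 0 by
    rw [h, LinearMap.zero_apply]
  apply TupleChain.hom_ext
  intro v
  rw [evalChain_single, LinearMap.zero_apply]

/-- Equivariantly homotopic maps agree on the cohomology of orbit simplicial sets. -/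
theorem map_eq_of_homotopy (Φ : C(X × unitInterval, Y))
    (hΦ : ∀ g : G, ∃ g' : G', ∀ x t, Φ (g • x, t) = g' • Φ (x, t))
    (h₀ : Equivar G G' (slice Φ 0)) (h₁ : Equivar G G' (slice Φ 1)) (n : ℕ)
    (x : H (Orb G' Y) n) : SSetMod2.map (map _ h₀) n x = SSetMod2.map (map _ h₁) n x := by
  obtain ⟨f, rfl⟩ := cls_surjective n x
  rw [map_cls, map_cls, cls_eq_iff]
  cases n with
  | zero =>
    rw [mem_coboundaries_zero_iff]
    apply cochain_ext
    intro σ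
    change f.1 (mk G' ((slice Φ 0).comp σ)) + f.1 (mk G' ((slice Φ 1).comp σ)) = 0
    have h := evalChain_bd_eq_zero (convex_cylinder 0) (Φ.comp (cylinderSimplex σ)) f.1 f.2
      (prism 0 0 (tautChain 0))
    rw [bd_prism_zero, map_add, evalChain_push_cylinderIncl, evalChain_push_cylinderIncl] at h
    exact h
  | succ n =>
    -- The primitive evaluates `f` on the prism over `σ`. It descends to orbits because the homotopy
    -- sends translates to translates and `f` does not see the translating element.
    refine ⟨ofInvariant (fun σ ↦ evalChain (convex_cylinder n) (Φ.comp (cylinderSimplex σ))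
      (fun τ ↦ f.1 (mk G' τ)) (prism n n (tautChain n))) ?_, ?_⟩
    · intro g σ
      obtain ⟨g', hg'⟩ := hΦ g
      have : Φ.comp (cylinderSimplex (g • σ)) = g' • Φ.comp (cylinderSimplex σ) :=
        ContinuousMap.ext fun p ↦ hg' _ _
      rw [this]
      exact evalChain_smul _ _ _ _ (fun τ ↦ by rw [mk_smul]) _
    · apply cochain_ext
      intro σ
      rw [coboundary_mk]
      change _ = f.1 (mk G' ((slice Φ 0).comp σ)) + f.1 (mk G' ((slice Φ 1).comp σ))
      have h := evalChain_bd_eq_zero (convex_cylinder (n + 1)) (Φ.comp (cylinderSimplex σ)) f.1 f.2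
        (prism (n + 1) (n + 1) (tautChain (n + 1)))
      rw [bd_prism_succ, map_add, map_add, evalChain_push_cylinderIncl,
        evalChain_push_cylinderIncl, bd_tautChain, map_sum, map_sum] at h
      rw [CharTwo.add_eq_zero] at h
      refine Eq.trans ?_ h.symm
      refine Finset.sum_congr rfl fun i _ ↦ ?_
      rw [ofInvariant_mk, comp_cylinderSimplex_face, ← ContinuousMap.comp_assoc, ← push_prism]
      exact (evalChain_push _ _ _ _ ((simplexLin i.succAbove).prodMap LinearMap.id)
        (fun _ ↦ rfl) _ _).symm

/-- An equivariant deformation retraction induces isomorphisms. -/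
theorem map_bijective_of_retract {G₁ : Type*} {A : Type u} [Group G₁] [TopologicalSpace A]
    [MulAction G₁ A] [ContinuousConstSMul G₁ A] (i : C(A, X)) (hi : Equivar G₁ G i) (ρ : C(X, A))
    (hρ : Equivar G G₁ ρ) (hρi : ∀ a, ρ (i a) = a) (Φ : C(X × unitInterval, X))
    (hΦ : ∀ g : G, ∃ g' : G, ∀ x t, Φ (g • x, t) = g' • Φ (x, t))
    (h₀ : ∀ x, Φ (x, 0) = x) (h₁ : ∀ x, Φ (x, 1) = i (ρ x)) (n : ℕ) :
    Function.Bijective (SSetMod2.map (map i hi) n) := by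
  have hs : ∀ e, Equivar G G (slice Φ e) := by
    intro e g
    obtain ⟨g', hg'⟩ := hΦ g
    exact ⟨g', fun x ↦ hg' x e⟩
  have e₁ : map i hi ≫ map ρ hρ = 𝟙 _ := by
    rw [map_comp_map i hi ρ hρ (ContinuousMap.id A) (fun g ↦ ⟨g, fun x ↦ rfl⟩) hρi]
    exact map_id' _ _ fun _ ↦ rfl
  have e₂ : map ρ hρ ≫ map i hi = map _ (hs 1) :=
    map_comp_map _ _ _ _ _ _ fun x ↦ (h₁ x).symm
  refine Function.bijective_iff_has_inverse.2 ⟨SSetMod2.map (map ρ hρ) n, fun x ↦ ?_, fun x ↦ ?_⟩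
  · rw [← SSetMod2.map_comp, e₂, ← map_eq_of_homotopy Φ hΦ (hs 0) (hs 1), map_id' _ _ h₀,
      SSetMod2.map_id]
  · rw [← SSetMod2.map_comp, e₁, SSetMod2.map_id]

end homotopy

end Orb

/-! ## Barycentric subdivision -/

section barycentric

variable {E : Type*} [NormedAddCommGroup E] [NormedSpace ℝ E] {s : Set E} (hs : Convex ℝ s)

/-- The barycenter of a tuple in a convex set. -/
noncomputable def bary (m : ℕ) (v : Fin (m + 1) → s) : s :=
  affineSimplex hs v stdSimplex.barycenter

theorem bary_coe (m : ℕ) (v : Fin (m + 1) → s) :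
    (bary hs m v : E) = ∑ i, ((m : ℝ) + 1)⁻¹ • (v i : E) := by
  rw [bary, affineSimplex_coe]
  refine Finset.sum_congr rfl fun i _ ↦ ?_
  congr 1
  refine (stdSimplex.barycenter_apply (𝕜 := ℝ) i).trans ?_
  simp

/-- The difference is the mean of the `m + 2` vectors `v i - v k`, one of which is zero; this gives
the factor `(m + 1) / (m + 2)`. -/
theorem dist_bary_le (m : ℕ) (v : Fin (m + 2) → s) (d : ℝ) (hd : ∀ i j, dist (v i) (v j) ≤ d)
    (k : Fin (m + 2)) :
    dist (v k : E) (bary hs (m + 1) v) ≤ ((m + 1 : ℕ) / ((m + 1 : ℕ) + 1) : ℝ) * d := by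
  have hm : ((m + 1 : ℕ) + 1 : ℝ) ≠ 0 := by positivity
  have h : (bary hs (m + 1) v : E) - v k =
      ∑ i, (((m + 1 : ℕ) : ℝ) + 1)⁻¹ • ((v i : E) - v k) := by
    rw [bary_coe]
    simp only [smul_sub, Finset.sum_sub_distrib]
    congr 1
    rw [Finset.sum_const, Finset.card_univ, Fintype.card_fin, ← Nat.cast_smul_eq_nsmul ℝ, smul_smul]
    push_cast
    rw [show ((m : ℝ) + 2) = (m + 1 + 1) by ring, mul_inv_cancel₀ (by positivity), one_smul]
  rw [dist_comm, dist_eq_norm, h]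
  refine (norm_sum_le _ _).trans ?_
  rw [← Finset.sum_erase_add _ _ (Finset.mem_univ k), sub_self, smul_zero, norm_zero, add_zero]
  refine (Finset.sum_le_card_nsmul _ _ ((((m + 1 : ℕ) : ℝ) + 1)⁻¹ * d) fun i _ ↦ ?_).trans ?_
  · rw [norm_smul, Real.norm_of_nonneg (by positivity), ← dist_eq_norm]
    exact mul_le_mul_of_nonneg_left (hd i k) (by positivity)
  · rw [Finset.card_erase_of_mem (Finset.mem_univ k), Finset.card_univ, Fintype.card_fin,
      nsmul_eq_mul]
    apply le_of_eq
    field_simp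
    simp

theorem map_mem_of_mem_supported {α : Type*} {M : Type*} [AddCommGroup M] [Module (ZMod 2) M]
    {A : Set α} {c : α →₀ ZMod 2} (hc : c ∈ Finsupp.supported (ZMod 2) (ZMod 2) A)
    (f : (α →₀ ZMod 2) →ₗ[ZMod 2] M) (N : Submodule (ZMod 2) M)
    (h : ∀ v ∈ A, f (Finsupp.single v 1) ∈ N) : f c ∈ N := by
  rw [Finsupp.supported_eq_span_single] at hc
  have : Submodule.span (ZMod 2) ((fun v ↦ Finsupp.single v 1) '' A) ≤ N.comap f := by
    rw [Submodule.span_le]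
    rintro _ ⟨v, hv, rfl⟩
    exact h v hv
  exact this hc

/-- The tuples in the convex hull of a given tuple with distances bounded by `d`. -/
def fineTuples {m k : ℕ} (v : Fin (k + 1) → s) (d : ℝ) : Set (Fin (m + 1) → s) :=
  {w | (∀ i, (w i : E) ∈ convexHull ℝ (Set.range fun j ↦ (v j : E))) ∧
    ∀ i j, dist (w i) (w j) ≤ d}

/-- Keeping the entries in the convex hull is part of the induction: it puts each entry of a
subdivided face within the required distance of the barycenter. -/
theorem sd_single_mem_fineTuples (m : ℕ) (v : Fin (m + 1) → s) (d : ℝ)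
    (hd : ∀ i j, dist (v i) (v j) ≤ d) :
    sd (bary hs) m (Finsupp.single v 1) ∈ Finsupp.supported (ZMod 2) (ZMod 2)
      (fineTuples v ((m / (m + 1) : ℝ) * d)) := by
  have hd0 : 0 ≤ d := dist_nonneg.trans (hd 0 0)
  induction m with
  | zero =>
    refine Finsupp.single_mem_supported _ _ ⟨fun i ↦ subset_convexHull _ _ ⟨i, rfl⟩, fun i j ↦ ?_⟩
    rw [show i = j from Fin.ext (by omega), dist_self]
    simp
  | succ m ih =>
    rw [sd, lin_single, bd_single, map_sum, map_sum]
    refine Submodule.sum_mem _ fun k _ ↦ ?_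
    refine map_mem_of_mem_supported (ih (v ∘ k.succAbove) fun i j ↦ hd _ _) _ _ fun w hw ↦ ?_
    rw [cone_single]
    have hsub : convexHull ℝ (Set.range fun j ↦ ((v ∘ k.succAbove) j : E)) ⊆
        convexHull ℝ (Set.range fun j ↦ (v j : E)) :=
      convexHull_mono (by rintro _ ⟨j, rfl⟩; exact ⟨_, rfl⟩)
    -- Faces shrink by the factor of the lower dimension, which is the smaller one.
    have hle : ((m : ℝ) / (m + 1)) * d ≤ (((m + 1 : ℕ) : ℝ) / ((m + 1 : ℕ) + 1)) * d := by
      refine mul_le_mul_of_nonneg_right ?_ hd0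
      rw [div_le_div_iff₀ (by positivity) (by positivity)]
      push_cast
      nlinarith
    have hball : ∀ i, dist (w i : E) (bary hs (m + 1) v) ≤
        (((m + 1 : ℕ) : ℝ) / ((m + 1 : ℕ) + 1)) * d := by
      intro i
      have : convexHull ℝ (Set.range fun j ↦ (v j : E)) ⊆
          Metric.closedBall (bary hs (m + 1) v : E) ((((m + 1 : ℕ) : ℝ) / ((m + 1 : ℕ) + 1)) * d) := by
        refine convexHull_min ?_ (convex_closedBall _ _)
        rintro _ ⟨j, rfl⟩
        exact dist_bary_le hs m v d hd j
      exact this (hsub (hw.1 i))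
    refine Finsupp.single_mem_supported _ _ ⟨fun i ↦ ?_, fun i j ↦ ?_⟩
    · refine Fin.cases ?_ (fun i ↦ ?_) i
      · rw [Fin.cons_zero]
        exact (convex_convexHull ℝ _).sum_mem (fun i _ ↦ (stdSimplex.barycenter).2.1 i)
          (stdSimplex.barycenter).2.2 (fun i _ ↦ subset_convexHull ℝ (Set.range fun j ↦ (v j : E)) ⟨i, rfl⟩)
      · rw [Fin.cons_succ]
        exact hsub (hw.1 i)
    · refine Fin.cases ?_ (fun i ↦ ?_) i <;> refine Fin.cases ?_ (fun j ↦ ?_) j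
      · rw [dist_self]
        positivity
      · rw [Fin.cons_zero, Fin.cons_succ, dist_comm]
        exact hball j
      · rw [Fin.cons_zero, Fin.cons_succ]
        exact hball i
      · rw [Fin.cons_succ, Fin.cons_succ]
        exact (hw.2 i j).trans hle

theorem sd_pow_mem_supported (m : ℕ) (v : Fin (m + 1) → s) (d : ℝ)
    (hd : ∀ i j, dist (v i) (v j) ≤ d) (k : ℕ) :
    (sd (bary hs) m ^ k) (Finsupp.single v 1) ∈ Finsupp.supported (ZMod 2) (ZMod 2)
      {w | ∀ i j, dist (w i) (w j) ≤ (m / (m + 1) : ℝ) ^ k * d} := by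
  induction k with
  | zero =>
    change Finsupp.single v 1 ∈ _
    refine Finsupp.single_mem_supported _ _ fun i j ↦ ?_
    rw [pow_zero, one_mul]
    exact hd i j
  | succ k ih =>
    rw [pow_succ' (sd (bary hs) m), Module.End.mul_apply]
    refine map_mem_of_mem_supported ih _ _ fun w hw ↦ ?_
    refine Finsupp.supported_mono ?_ (sd_single_mem_fineTuples hs m w _ hw)
    intro x hx i j
    rw [pow_succ', mul_assoc]
    exact hx.2 i j

end barycentric

/-! ## Small simplices -/

section small

variable {ι : Type*} {X : Type u} [TopologicalSpace X] (U : ι → Set X)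

/-- Subdivision of chains in the standard simplex. -/
noncomputable abbrev simplexSd (n m : ℕ) : Module.End (ZMod 2) (Ch (stdSimplex ℝ (Fin (n + 1))) m) :=
  sd (bary (convex_stdSimplex ℝ (Fin (n + 1)))) m

/-- The homotopy between subdivision and the identity in the standard simplex. -/
noncomputable def simplexHtpy (n m : ℕ) :
    Ch (stdSimplex ℝ (Fin (n + 1))) m →ₗ[ZMod 2] Ch (stdSimplex ℝ (Fin (n + 1))) (m + 1) :=
  htpy (bary (convex_stdSimplex ℝ (Fin (n + 1)))) (fun _ ↦ LinearMap.id) (simplexSd n) m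

theorem aug_simplexSd (n : ℕ) (c : Ch (stdSimplex ℝ (Fin (n + 1))) 0) :
    aug (simplexSd n 0 c) = aug c := rfl

theorem bd_simplexHtpy_succ (n m : ℕ) (c : Ch (stdSimplex ℝ (Fin (n + 1))) (m + 1)) :
    bd (m + 1) (simplexHtpy n (m + 1) c) =
      c + simplexSd n (m + 1) c + simplexHtpy n m (bd m c) :=
  bd_htpy_succ _ (fun _ ↦ rfl) (aug_simplexSd n) (fun _ _ ↦ rfl) (fun m c ↦ bd_sd _ m c) m c

theorem simplexMap_bary {l n : ℕ} (f : Fin (l + 1) → Fin (n + 1)) (m : ℕ)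
    (v : Fin (m + 1) → stdSimplex ℝ (Fin (l + 1))) :
    simplexMap f (bary (convex_stdSimplex ℝ (Fin (l + 1))) m v) =
      bary (convex_stdSimplex ℝ (Fin (n + 1))) m (simplexMap f ∘ v) :=
  ContinuousMap.congr_fun (comp_affineSimplex _ _ v (simplexMap f) (simplexLin f)
    (simplexMap_coe f)) _

theorem push_simplexSd {l n : ℕ} (f : Fin (l + 1) → Fin (n + 1)) (m : ℕ)
    (c : Ch (stdSimplex ℝ (Fin (l + 1))) m) :
    push (simplexMap f) m (simplexSd l m c) = simplexSd n m (push (simplexMap f) m c) :=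
  push_sd _ _ (fun _ _ ↦ simplexMap_bary f _ _) m c

theorem push_simplexSd_pow {l n : ℕ} (f : Fin (l + 1) → Fin (n + 1)) (m k : ℕ)
    (c : Ch (stdSimplex ℝ (Fin (l + 1))) m) :
    push (simplexMap f) m ((simplexSd l m ^ k) c) =
      (simplexSd n m ^ k) (push (simplexMap f) m c) := by
  induction k with
  | zero => rfl
  | succ k ih =>
    rw [pow_succ', pow_succ', Module.End.mul_apply, Module.End.mul_apply, push_simplexSd, ih]

theorem push_simplexHtpy {l n : ℕ} (f : Fin (l + 1) → Fin (n + 1)) (m : ℕ)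
    (c : Ch (stdSimplex ℝ (Fin (l + 1))) m) :
    push (simplexMap f) (m + 1) (simplexHtpy l m c) =
      simplexHtpy n m (push (simplexMap f) m c) :=
  push_htpy _ _ _ (fun _ _ ↦ simplexMap_bary f _ _) (fun _ _ ↦ rfl)
    (fun m c ↦ push_simplexSd f m c) m c

theorem bd_simplexSd_pow (n m k : ℕ) (c : Ch (stdSimplex ℝ (Fin (n + 1))) (m + 1)) :
    bd m ((simplexSd n (m + 1) ^ k) c) = (simplexSd n m ^ k) (bd m c) := by
  induction k with
  | zero => rfl
  | succ k ih =>
    rw [pow_succ', pow_succ', Module.End.mul_apply, Module.End.mul_apply, bd_sd, ih]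

/-- The convex parts of the standard simplex which a singular simplex maps to a member of `U`. -/
def smallSets {n : ℕ} (σ : C(stdSimplex ℝ (Fin (n + 1)), X)) :
    Set (Set (stdSimplex ℝ (Fin (n + 1)))) :=
  {A | Convex ℝ (Subtype.val '' A) ∧ ∃ j, ∀ x ∈ A, σ x ∈ U j}

/-- The chains which are small with respect to `U`. -/
noncomputable def smallChains {n : ℕ} (σ : C(stdSimplex ℝ (Fin (n + 1)), X)) (m : ℕ) :
    Submodule (ZMod 2) (Ch (stdSimplex ℝ (Fin (n + 1))) m) :=
  ⨆ A ∈ smallSets U σ, supp A m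

variable {U}

theorem map_mem_smallChains {n : ℕ} {σ : C(stdSimplex ℝ (Fin (n + 1)), X)} {m k : ℕ}
    (f : Ch (stdSimplex ℝ (Fin (n + 1))) m →ₗ[ZMod 2] Ch (stdSimplex ℝ (Fin (n + 1))) k)
    (hf : ∀ A ∈ smallSets U σ, ∀ v : Fin (m + 1) → stdSimplex ℝ (Fin (n + 1)), (∀ i, v i ∈ A) →
      f (Finsupp.single v 1) ∈ supp A k) {c : Ch (stdSimplex ℝ (Fin (n + 1))) m}
    (hc : c ∈ smallChains U σ m) : f c ∈ smallChains U σ k := by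
  have : smallChains U σ m ≤ (smallChains U σ k).comap f := by
    refine iSup₂_le fun A hA c hc ↦ ?_
    exact le_iSup₂ (f := fun A (_ : A ∈ smallSets U σ) ↦ supp A k) A hA
      (map_mem_of_mem_supp hc f _ (hf A hA))
  exact this hc

theorem bary_mem {n : ℕ} {A : Set (stdSimplex ℝ (Fin (n + 1)))} (hA : Convex ℝ (Subtype.val '' A))
    (m : ℕ) (v : Fin (m + 1) → stdSimplex ℝ (Fin (n + 1))) (hv : ∀ i, v i ∈ A) :
    bary (convex_stdSimplex ℝ (Fin (n + 1))) m v ∈ A :=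
  affineSimplex_mem _ v hA hv _

theorem simplexSd_mem_smallChains {n : ℕ} {σ : C(stdSimplex ℝ (Fin (n + 1)), X)} {m : ℕ}
    {c : Ch (stdSimplex ℝ (Fin (n + 1))) m} (hc : c ∈ smallChains U σ m) :
    simplexSd n m c ∈ smallChains U σ m :=
  map_mem_smallChains _ (fun _ hA v hv ↦ sd_single_mem_supp _ (bary_mem hA.1) m v hv) hc

theorem simplexHtpy_mem_smallChains {n : ℕ} {σ : C(stdSimplex ℝ (Fin (n + 1)), X)} {m : ℕ}
    {c : Ch (stdSimplex ℝ (Fin (n + 1))) m} (hc : c ∈ smallChains U σ m) :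
    simplexHtpy n m c ∈ smallChains U σ (m + 1) :=
  map_mem_smallChains _ (fun _ hA v hv ↦ htpy_single_mem_supp _ (bary_mem hA.1)
    (fun _ _ hv ↦ single_mem_supp hv) (fun m v hv ↦ sd_single_mem_supp _ (bary_mem hA.1) m v hv)
    m v hv) hc

theorem simplexSd_pow_mem_smallChains {n : ℕ} {σ : C(stdSimplex ℝ (Fin (n + 1)), X)} {m : ℕ}
    {c : Ch (stdSimplex ℝ (Fin (n + 1))) m} {k l : ℕ} (hkl : k ≤ l)
    (hc : (simplexSd n m ^ k) c ∈ smallChains U σ m) :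
    (simplexSd n m ^ l) c ∈ smallChains U σ m := by
  induction l, hkl using Nat.le_induction with
  | base => exact hc
  | succ l _ ih =>
    rw [pow_succ', Module.End.mul_apply]
    exact simplexSd_mem_smallChains ih

theorem evalChain_eq_zero_of_small {n : ℕ} {σ : C(stdSimplex ℝ (Fin (n + 1)), X)} {m : ℕ}
    (F : C(stdSimplex ℝ (Fin (m + 1)), X) → ZMod 2) (hF : ∀ τ j, (∀ t, τ t ∈ U j) → F τ = 0)
    {c : Ch (stdSimplex ℝ (Fin (n + 1))) m} (hc : c ∈ smallChains U σ m) :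
    evalChain (convex_stdSimplex ℝ (Fin (n + 1))) σ F c = 0 := by
  have : smallChains U σ m ≤
      (⊥ : Submodule (ZMod 2) (ZMod 2)).comap (evalChain (convex_stdSimplex ℝ (Fin (n + 1))) σ F) := by
    refine iSup₂_le fun A hA c hc ↦ ?_
    obtain ⟨hA, j, hj⟩ := hA
    refine map_mem_of_mem_supp hc (evalChain (convex_stdSimplex ℝ (Fin (n + 1))) σ F) ⊥ fun v hv ↦ ?_
    rw [evalChain_single, Submodule.mem_bot]
    exact hF _ j fun t ↦ hj _ (affineSimplex_mem _ v hA hv t)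
  exact this hc

/-- Iterated subdivision shrinks all tuples below a Lebesgue number of the pulled-back cover, and
balls in the simplex are convex. -/
theorem exists_simplexSd_pow_mem (hU : ∀ j, IsOpen (U j)) (hcov : ∀ x, ∃ j, x ∈ U j) {n : ℕ}
    (σ : C(stdSimplex ℝ (Fin (n + 1)), X)) :
    ∃ k, (simplexSd n n ^ k) (tautChain n) ∈ smallChains U σ n := by
  obtain ⟨δ, hδ, hδ'⟩ := lebesgue_number_lemma_of_metric (s := Set.univ)
    (c := fun j ↦ σ ⁻¹' (U j)) isCompact_univ (fun j ↦ (hU j).preimage σ.continuous)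
    (fun x _ ↦ by
      obtain ⟨j, hj⟩ := hcov (σ x)
      exact Set.mem_iUnion.2 ⟨j, hj⟩)
  have hr0 : (0 : ℝ) ≤ (n : ℝ) / (n + 1) := by positivity
  have hr1 : (n : ℝ) / (n + 1) < 1 := by
    rw [div_lt_one (by positivity)]
    linarith
  -- The halving compensates for the bound `2` on the distances between vertices, which lie in the
  -- unit ball.
  obtain ⟨k, hk⟩ := exists_pow_lt_of_lt_one (show (0 : ℝ) < δ / 2 by positivity) hr1
  refine ⟨k, ?_⟩
  have hd : ∀ i j, dist (vertices n i) (vertices n j) ≤ 2 := by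
    intro i j
    have h : ∀ i, dist (vertices n i : Fin (n + 1) → ℝ) 0 ≤ 1 := fun i ↦
      stdSimplex_subset_closedBall (vertices n i).2
    have := dist_triangle_right (vertices n i : Fin (n + 1) → ℝ) (vertices n j) 0
    have h1 := h i
    have h2 := h j
    change dist (vertices n i : Fin (n + 1) → ℝ) (vertices n j) ≤ 2
    linarith
  refine map_mem_of_mem_supported (sd_pow_mem_supported _ n (vertices n) 2 hd k)
    (LinearMap.id : Ch (stdSimplex ℝ (Fin (n + 1))) n →ₗ[ZMod 2] _)
    (smallChains U σ n) fun w hw ↦ ?_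
  have hA : Metric.ball (w 0) δ ∈ smallSets U σ := by
    constructor
    · have : Subtype.val '' Metric.ball (w 0) δ =
          stdSimplex ℝ (Fin (n + 1)) ∩ Metric.ball (w 0 : Fin (n + 1) → ℝ) δ := by
        ext x
        constructor
        · rintro ⟨y, hy, rfl⟩
          exact ⟨y.2, hy⟩
        · rintro ⟨hx, hx'⟩
          exact ⟨⟨x, hx⟩, hx', rfl⟩
      rw [this]
      exact (convex_stdSimplex ℝ _).inter (convex_ball _ _)
    · obtain ⟨j, hj⟩ := hδ' (w 0) (Set.mem_univ _)
      exact ⟨j, fun x hx ↦ hj hx⟩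
  refine le_iSup₂ (f := fun A (_ : A ∈ smallSets U σ) ↦ supp A n) _ hA (single_mem_supp fun i ↦ ?_)
  rw [Metric.mem_ball]
  refine (hw i 0).trans_lt ?_
  linarith

variable {G : Type v} [Group G] [MulAction G X] [ContinuousConstSMul G X]

/-- A cocycle on orbits of simplices which vanishes on the small simplices is the coboundary of a
cochain which vanishes on the small simplices. -/
theorem Orb.exists_coboundary_of_small (hU : ∀ j, IsOpen (U j)) (hcov : ∀ x, ∃ j, x ∈ U j)
    (hG : ∀ (g : G) j x, x ∈ U j → g • x ∈ U j) {n : ℕ} (f : Cochain (Orb G X) (n + 1))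
    (hf : f ∈ cocycles (Orb G X) (n + 1))
    (h0 : ∀ (σ : C(stdSimplex ℝ (Fin (n + 2)), X)) j, (∀ t, σ t ∈ U j) → f (mk G σ) = 0) :
    ∃ g, coboundary (Orb G X) n g = f ∧
      ∀ (σ : C(stdSimplex ℝ (Fin (n + 1)), X)) j, (∀ t, σ t ∈ U j) → g (mk G σ) = 0 := by
  set F : C(stdSimplex ℝ (Fin (n + 2)), X) → ZMod 2 := fun σ ↦ f (mk G σ) with hF
  -- `N σ` is the least number of subdivisions that makes `σ` small. It is constant on orbits
  -- because the cover is invariant, so a primitive depending on it still descends.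
  let N : ∀ {m : ℕ} (σ : C(stdSimplex ℝ (Fin (m + 1)), X)), ℕ :=
    fun {m} σ ↦ sInf {k | (simplexSd m m ^ k) (tautChain m) ∈ smallChains U σ m}
  have hN : ∀ {m : ℕ} (σ : C(stdSimplex ℝ (Fin (m + 1)), X)) (k), N σ ≤ k →
      (simplexSd m m ^ k) (tautChain m) ∈ smallChains U σ m := fun {m} σ k hk ↦
    simplexSd_pow_mem_smallChains hk (Nat.sInf_mem (exists_simplexSd_pow_mem hU hcov σ))
  have hsets : ∀ (g : G) {m : ℕ} (σ : C(stdSimplex ℝ (Fin (m + 1)), X)),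
      smallSets U (g • σ) = smallSets U σ := by
    intro g m σ
    have key : ∀ (g : G) (σ : C(stdSimplex ℝ (Fin (m + 1)), X)),
        smallSets U σ ⊆ smallSets U (g • σ) := by
      rintro g σ A ⟨hA, j, hj⟩
      exact ⟨hA, j, fun x hx ↦ hG g j _ (hj x hx)⟩
    refine Set.Subset.antisymm ?_ (key g σ)
    have := key g⁻¹ (g • σ)
    rwa [inv_smul_smul] at this
  -- The value of `f` on the homotopy between the `k`-th and the `(k + 1)`-st subdivision. It
  -- vanishes from `k = N σ` on, so the number of summands may be enlarged at will.
  let term : C(stdSimplex ℝ (Fin (n + 1)), X) → ℕ → ZMod 2 := fun σ k ↦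
    evalChain (convex_stdSimplex ℝ (Fin (n + 1))) σ F
      (simplexHtpy n n ((simplexSd n n ^ k) (tautChain n)))
  have hterm : ∀ σ k, N σ ≤ k → term σ k = 0 := fun σ k hk ↦
    evalChain_eq_zero_of_small F h0 (simplexHtpy_mem_smallChains (hN σ k hk))
  refine ⟨ofInvariant (fun σ ↦ ∑ k ∈ Finset.range (N σ), term σ k) ?_, ?_, ?_⟩
  · intro g σ
    have h1 : N (g • σ) = N σ := by
      simp only [N, smallChains, hsets g σ]
    rw [h1]
    refine Finset.sum_congr rfl fun k _ ↦ ?_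
    exact evalChain_smul _ g σ F (fun τ ↦ by rw [hF]; simp only [mk_smul]) _
  · apply cochain_ext
    intro σ
    rw [coboundary_mk]
    simp only [ofInvariant_mk]
    -- A common bound for `σ` and all its faces, so that the sums over faces can be interchanged.
    set M := N σ + ∑ i : Fin (n + 2), N (face i σ) with hM
    have hM' : ∀ i : Fin (n + 2), N (face i σ) ≤ M := fun i ↦
      (Finset.single_le_sum (f := fun i : Fin (n + 2) ↦ N (face i σ)) (fun _ _ ↦ Nat.zero_le _)
        (Finset.mem_univ i)).trans (Nat.le_add_left _ _)
    have hsum : ∀ i : Fin (n + 2), ∑ k ∈ Finset.range (N (face i σ)), term (face i σ) k =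
        ∑ k ∈ Finset.range M, term (face i σ) k := by
      intro i
      refine Finset.sum_subset (Finset.range_mono (hM' i)) fun k _ hk ↦ hterm _ _ ?_
      simpa using hk
    simp only [hsum]
    rw [Finset.sum_comm]
    let ev := evalChain (convex_stdSimplex ℝ (Fin (n + 2))) σ F
    let a : ℕ → ZMod 2 := fun k ↦ ev ((simplexSd (n + 1) (n + 1) ^ k) (tautChain (n + 1)))
    have hk : ∀ k, ∑ i : Fin (n + 2), term (face i σ) k = a k + a (k + 1) := by
      intro k
      have h1 : ∀ i : Fin (n + 2), term (face i σ) k = ev (simplexHtpy (n + 1) n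
          ((simplexSd (n + 1) n ^ k) (push (simplexMap i.succAbove) n (tautChain n)))) := by
        intro i
        rw [← push_simplexSd_pow, ← push_simplexHtpy]
        exact (evalChain_push _ _ σ (simplexMap i.succAbove) (simplexLin i.succAbove)
          (simplexMap_coe _) F _).symm
      simp only [h1]
      rw [← map_sum, ← map_sum, ← map_sum, ← bd_tautChain, ← bd_simplexSd_pow]
      have h2 := evalChain_bd_eq_zero (convex_stdSimplex ℝ (Fin (n + 2))) σ f hf
        (simplexHtpy (n + 1) (n + 1) ((simplexSd (n + 1) (n + 1) ^ k) (tautChain (n + 1))))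
      rw [bd_simplexHtpy_succ, map_add, map_add, CharTwo.add_eq_zero] at h2
      refine h2.symm.trans ?_
      simp only [a, pow_succ']
      rfl
    simp only [hk]
    -- The sum telescopes: `a 0` is the value of `f` on `σ`, and `a M` vanishes since the `M`-th
    -- subdivision is small.
    have htel : ∀ m, ∑ k ∈ Finset.range m, (a k + a (k + 1)) = a 0 + a m := by
      intro m
      induction m with
      | zero => rw [Finset.sum_range_zero, CharTwo.add_self_eq_zero]
      | succ m ih =>
        rw [Finset.sum_range_succ, ih]
        linear_combination (CharTwo.add_self_eq_zero (a m))
    rw [htel]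
    have haM : a M = 0 := evalChain_eq_zero_of_small F h0 (hN σ M (Nat.le_add_right _ _))
    rw [haM, add_zero]
    change evalChain _ σ F (Finsupp.single (vertices (n + 1)) 1) = _
    rw [evalChain_single, affineSimplex_vertices, ContinuousMap.comp_id]
  · intro σ j hσ
    rw [ofInvariant_mk]
    -- For a small simplex the whole standard simplex is an admissible convex set, so no subdivision
    -- is needed and the primitive is an empty sum.
    have : N σ = 0 := by
      refine Nat.sInf_eq_zero.2 (Or.inl ?_)
      have hA : (Set.univ : Set (stdSimplex ℝ (Fin (n + 1)))) ∈ smallSets U σ := by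
        refine ⟨?_, j, fun x _ ↦ hσ x⟩
        rw [Set.image_univ, Subtype.range_coe]
        exact convex_stdSimplex ℝ _
      exact le_iSup₂ (f := fun A (_ : A ∈ smallSets U σ) ↦ supp A n) _ hA
        (single_mem_supp fun i ↦ Set.mem_univ _)
    rw [this, Finset.sum_range_zero]

end small

/-! ## The Mayer–Vietoris situation for orbits of simplices -/

/-- A map into the range of an embedding lifts. -/
theorem ContinuousMap.exists_lift_of_isEmbedding {A X Y : Type*} [TopologicalSpace A]
    [TopologicalSpace X] [TopologicalSpace Y] (j : C(A, X)) (hj : Topology.IsEmbedding j) (σ : C(Y, X))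
    (h : ∀ y, σ y ∈ Set.range j) : ∃ τ : C(Y, A), j.comp τ = σ := by
  choose τ hτ using h
  refine ⟨⟨τ, hj.continuous_iff.2 ?_⟩, ContinuousMap.ext hτ⟩
  rw [show j ∘ τ = σ from funext hτ]
  exact σ.continuous

namespace Orb

section

variable {G : Type*} [Group G] {A B C X : Type u} [TopologicalSpace A] [TopologicalSpace B]
  [TopologicalSpace C] [TopologicalSpace X] [MulAction G A] [MulAction G B] [MulAction G C]
  [MulAction G X] [ContinuousConstSMul G A] [ContinuousConstSMul G B] [ContinuousConstSMul G C]
  [ContinuousConstSMul G X]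

omit [ContinuousConstSMul G A] [ContinuousConstSMul G B] in
theorem equivar_of_smul {φ : C(A, B)} (h : ∀ (g : G) x, φ (g • x) = g • φ x) : Equivar G G φ :=
  fun g ↦ ⟨g, h g⟩

theorem map_app_injective (φ : C(A, B)) (h : ∀ (g : G) x, φ (g • x) = g • φ x)
    (hφ : Function.Injective φ) (n : ℕ) :
    Function.Injective ((map φ (equivar_of_smul h)).app (op (SimplexCategory.mk n))) := by
  intro σ τ hστ
  obtain ⟨σ, rfl⟩ := mk_surjective σ
  obtain ⟨τ, rfl⟩ := mk_surjective τ
  rw [map_app_mk, map_app_mk, mk_eq_mk_iff] at hστ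
  obtain ⟨g, hg⟩ := hστ
  refine (mk_eq_mk_iff _ _).2 ⟨g, ContinuousMap.ext fun x ↦ hφ ?_⟩
  exact (h g (τ x)).trans (DFunLike.congr_fun hg x)

/-- An equivariant open cover by two sets is excisive. -/
theorem excisive (jA : C(A, X)) (jB : C(B, X)) (iA : C(C, A)) (iB : C(C, B))
    (hjA : ∀ (g : G) x, jA (g • x) = g • jA x) (hjB : ∀ (g : G) x, jB (g • x) = g • jB x)
    (hiA : ∀ (g : G) x, iA (g • x) = g • iA x) (hiB : ∀ (g : G) x, iB (g • x) = g • iB x)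
    (oA : Topology.IsOpenEmbedding jA) (oB : Topology.IsOpenEmbedding jB)
    (eA : Topology.IsEmbedding iA) (hcomm : ∀ c, jA (iA c) = jB (iB c))
    (hcov : ∀ x, x ∈ Set.range jA ∨ x ∈ Set.range jB)
    (hint : ∀ a b, jA a = jB b → a ∈ Set.range iA) :
    Excisive (map jA (equivar_of_smul hjA)) (map jB (equivar_of_smul hjB))
      (map iA (equivar_of_smul hiA)) (map iB (equivar_of_smul hiB)) := by
  have hz : ∀ n (f : Cochain (Orb G X) n), cochainMap (map jA (equivar_of_smul hjA)) n f = 0 →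
      ∀ σ : C(stdSimplex ℝ (Fin (n + 1)), X), (∀ t, σ t ∈ Set.range jA) → f (mk G σ) = 0 := by
    intro n f hf σ hσ
    obtain ⟨τ, rfl⟩ := ContinuousMap.exists_lift_of_isEmbedding jA oA.isEmbedding σ hσ
    exact congrFun hf (mk G τ)
  have hz' : ∀ n (f : Cochain (Orb G X) n), cochainMap (map jB (equivar_of_smul hjB)) n f = 0 →
      ∀ σ : C(stdSimplex ℝ (Fin (n + 1)), X), (∀ t, σ t ∈ Set.range jB) → f (mk G σ) = 0 := by
    intro n f hf σ hσ
    obtain ⟨τ, rfl⟩ := ContinuousMap.exists_lift_of_isEmbedding jB oB.isEmbedding σ hσ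
    exact congrFun hf (mk G τ)
  constructor
  · apply hom_ext
    intro n σ
    change mk G (jA.comp (iA.comp σ)) = mk G (jB.comp (iB.comp σ))
    congr 1
    exact ContinuousMap.ext fun x ↦ hcomm (σ x)
  · intro n
    exact (map_app_injective iA hiA eA.injective n).surjective_comp_right
  · intro n f₁ f₂ h
    have hA := map_app_injective jA hjA oA.injective n
    have hB := map_app_injective jB hjB oB.injective n
    classical
    -- The glued cochain takes the value zero on simplices lying in neither piece; such simplices
    -- are handled by subdivision.
    refine ⟨fun τ ↦ if h : ∃ a, (map jA (equivar_of_smul hjA)).app _ a = τ then f₁ h.choose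
      else if h : ∃ b, (map jB (equivar_of_smul hjB)).app _ b = τ then f₂ h.choose else 0, ?_, ?_⟩
    · funext a
      rw [cochainMap_apply, dif_pos ⟨a, rfl⟩]
      congr 1
      exact hA (Exists.choose_spec (⟨a, rfl⟩ : ∃ a', (map jA (equivar_of_smul hjA)).app _ a' =
        (map jA (equivar_of_smul hjA)).app _ a))
    · funext b
      rw [cochainMap_apply]
      split_ifs with h1 h2
      · have h3 := h1.choose_spec
        set a := h1.choose
        obtain ⟨a', ha'⟩ := mk_surjective a
        obtain ⟨b', rfl⟩ := mk_surjective b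
        rw [← ha'] at h3 ⊢
        rw [map_app_mk, map_app_mk, mk_eq_mk_iff] at h3
        obtain ⟨g, hg⟩ := h3
        -- Representatives of one orbit in the two pieces agree only after a translation; once
        -- translated, they lift to the intersection.
        have hg' : ∀ t, jA (a' t) = jB (g • b' t) := fun t ↦
          (DFunLike.congr_fun hg t).symm.trans (hjB g (b' t)).symm
        obtain ⟨c, rfl⟩ := ContinuousMap.exists_lift_of_isEmbedding iA eA a' fun t ↦ hint _ _ (hg' t)
        have hc : iB.comp c = g • b' := ContinuousMap.ext fun t ↦ oB.injective
          ((hcomm (c t)).symm.trans (hg' t))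
        refine (congrFun h (mk G c)).trans ?_
        rw [cochainMap_apply, map_app_mk, hc, mk_smul]
      · congr 1
        exact hB h2.choose_spec
      · exact absurd ⟨b, rfl⟩ h2
  · intro f h₁ h₂
    apply cochain_ext
    intro σ
    have hsub : ∀ t, t = vertices 0 0 := fun t ↦ Subsingleton.elim _ _
    rcases hcov (σ (vertices 0 0)) with h | h
    · exact hz _ f h₁ σ fun t ↦ by rwa [hsub t]
    · exact hz' _ f h₂ σ fun t ↦ by rwa [hsub t]
  · intro n f hf h₁ h₂
    obtain ⟨g, hg, hg'⟩ := exists_coboundary_of_small (G := G)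
      (U := fun b : Bool ↦ if b then Set.range jA else Set.range jB) (by
        rintro (_ | _)
        exacts [oB.isOpen_range, oA.isOpen_range]) (fun x ↦ by
        rcases hcov x with h | h
        exacts [⟨true, h⟩, ⟨false, h⟩]) (by
        rintro g (_ | _) x ⟨y, rfl⟩
        exacts [⟨g • y, hjB g y⟩, ⟨g • y, hjA g y⟩]) f hf (by
        rintro σ (_ | _) hσ
        exacts [hz' _ f h₂ σ hσ, hz _ f h₁ σ hσ])
    refine ⟨g, hg, ?_, ?_⟩
    · apply cochain_ext
      intro σ
      exact hg' _ true fun t ↦ ⟨σ t, rfl⟩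
    · apply cochain_ext
      intro σ
      exact hg' _ false fun t ↦ ⟨σ t, rfl⟩

end

/-! ## The class of a character -/

/-- The trivial group acts on every space. -/
instance trivialAction (X : Type*) : MulAction Unit X where
  smul _ x := x
  one_smul _ := rfl
  mul_smul _ _ _ := rfl

instance (X : Type*) [TopologicalSpace X] : ContinuousConstSMul Unit X :=
  ⟨fun _ ↦ continuous_id⟩

section character

variable {G : Type*} [Group G] {X : Type u} [TopologicalSpace X] [MulAction G X]
  [ContinuousConstSMul G X]

/-- Functions with values in `ZMod 2` which transform by a character. -/
def Odd (χ : G → ZMod 2) (θ : X → ZMod 2) : Prop := ∀ g x, θ (g • x) = θ x + χ g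

variable {χ : G → ZMod 2} {θ θ' : X → ZMod 2}

/-- The cocycle which measures the change of `θ` along a singular edge. -/
noncomputable def charCochain (hθ : Odd χ θ) : Cochain (Orb G X) 1 :=
  ofInvariant (fun σ ↦ ∑ i : Fin 2, θ (face i σ (vertices 0 0))) (by
    intro g σ
    rw [Fin.sum_univ_two, Fin.sum_univ_two]
    have h : ∀ i, θ (face i (g • σ) (vertices 0 0)) = θ (face i σ (vertices 0 0)) + χ g :=
      fun i ↦ hθ g _
    rw [h, h, add_add_add_comm, CharTwo.add_self_eq_zero, add_zero])

theorem charCochain_mk (hθ : Odd χ θ) (σ : C(stdSimplex ℝ (Fin 2), X)) :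
    charCochain hθ (mk G σ) = ∑ i : Fin 2, θ (face i σ (vertices 0 0)) := rfl

variable {G₁ : Type*} [Group G₁] [MulAction G₁ X] [ContinuousConstSMul G₁ X]

/-- The 0-cochain of an invariant function. -/
noncomputable def pointCochain (hθ : ∀ (g : G₁) (x : X), θ (g • x) = θ x) : Cochain (Orb G₁ X) 0 :=
  ofInvariant (fun σ ↦ θ (σ (vertices 0 0))) fun g _ ↦ hθ g _

theorem pointCochain_mk (hθ : ∀ (g : G₁) (x : X), θ (g • x) = θ x)
    (σ : C(stdSimplex ℝ (Fin 1), X)) : pointCochain hθ (mk G₁ σ) = θ (σ (vertices 0 0)) := rfl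

theorem coboundary_pointCochain (hθ : Odd χ θ) (h : Equivar G₁ G (ContinuousMap.id X))
    (hθ' : ∀ (g : G₁) (x : X), θ (g • x) = θ x) :
    cochainMap (map _ h) 1 (charCochain hθ) = coboundary (Orb G₁ X) 0 (pointCochain hθ') := by
  apply cochain_ext
  intro σ
  rw [coboundary_mk, cochainMap_apply, map_app_mk, charCochain_mk]
  rfl

theorem cochainMap_injective (h : Equivar G₁ G (ContinuousMap.id X)) (n : ℕ) :
    Function.Injective (cochainMap (map _ h) n) := by
  intro f g hfg
  apply cochain_ext
  intro σ
  exact congrFun hfg (mk G₁ σ)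

/-- Before dividing by the group, the cochain is the coboundary of `θ`, and pulling back to
simplices of `X` is injective. -/
theorem charCochain_mem (hθ : Odd χ θ) : charCochain hθ ∈ cocycles (Orb G X) 1 := by
  have h : Equivar Unit G (ContinuousMap.id X) := fun _ ↦ ⟨1, fun x ↦ (one_smul _ _).symm⟩
  apply cochainMap_injective h
  rw [← coboundary_cochainMap, coboundary_pointCochain hθ h fun _ _ ↦ rfl, coboundary_coboundary,
    map_zero]

/-- The class of the character `χ`. -/
noncomputable def charCls (hθ : Odd χ θ) : H (Orb G X) 1 :=
  cls _ 1 ⟨charCochain hθ, charCochain_mem hθ⟩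

/-- Two odd functions differ by an invariant one, which is a 0-cochain on orbits. No continuity is
involved, so the class can be represented by whichever odd function is convenient. -/
theorem charCls_eq (hθ : Odd χ θ) (hθ' : Odd χ θ') : charCls hθ = charCls hθ' := by
  rw [charCls, charCls, cls_eq_iff, mem_coboundaries_succ_iff]
  have h : ∀ (g : G) (x : X), (θ + θ') (g • x) = (θ + θ') x := by
    intro g x
    change θ (g • x) + θ' (g • x) = θ x + θ' x
    rw [hθ, hθ', add_add_add_comm, CharTwo.add_self_eq_zero, add_zero]
  refine ⟨pointCochain h, ?_⟩
  apply cochain_ext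
  intro σ
  rw [coboundary_mk]
  exact Finset.sum_add_distrib

variable {G' : Type*} [Group G'] {Y : Type u} [TopologicalSpace Y] [MulAction G' Y]
  [ContinuousConstSMul G' Y] {χ' : G' → ZMod 2}

theorem map_charCls (φ : C(X, Y)) (hφ : Equivar G G' φ) {η : Y → ZMod 2} (hη : Odd χ' η)
    (hθ : Odd χ θ) (h : ∀ g, ∃ g', χ' g' = χ g ∧ ∀ x, φ (g • x) = g' • φ x) :
    SSetMod2.map (map φ hφ) 1 (charCls hη) = charCls hθ := by
  have hη' : Odd χ (η ∘ φ) := by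
    intro g x
    obtain ⟨g', h1, h2⟩ := h g
    change η (φ (g • x)) = η (φ x) + χ g
    rw [h2, hη, h1]
  rw [charCls_eq hθ hη', charCls, charCls, map_cls]
  congr 2
  apply cochain_ext
  intro σ
  rfl

theorem front_mk {p n : ℕ} (h : p ≤ n) (σ : C(stdSimplex ℝ (Fin (n + 1)), X)) :
    front (Orb G X) h (mk G σ) =
      mk G (σ.comp (simplexMap (SimplexCategory.subinterval 0 p (by omega)).toOrderHom)) := rfl

theorem back_mk {p q n : ℕ} (h : p + q = n) (σ : C(stdSimplex ℝ (Fin (n + 1)), X)) :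
    back (Orb G X) h (mk G σ) =
      mk G (σ.comp (simplexMap (SimplexCategory.subinterval p q (by omega)).toOrderHom)) := rfl

/-- A continuous function to a discrete set is constant on the connected simplex, so it agrees at
the two endpoints. -/
theorem charCochain_eq_zero (hθ : Odd χ θ) {U : Set X} (hU : ContinuousOn θ U)
    (σ : C(stdSimplex ℝ (Fin 2), X)) (hσ : ∀ t, σ t ∈ U) : charCochain hθ (mk G σ) = 0 := by
  have hc : Continuous (θ ∘ σ) := hU.comp_continuous σ.continuous hσ
  have : PreconnectedSpace (stdSimplex ℝ (Fin 2)) :=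
    isPreconnected_iff_preconnectedSpace.1 (convex_stdSimplex ℝ (Fin 2)).isPreconnected
  rw [charCochain_mk, Fin.sum_univ_two, CharTwo.add_eq_zero]
  exact PreconnectedSpace.constant inferInstance hc

/-- If `X` is covered by `N` invariant open sets with locally constant odd functions, then the
`N`-th power of the class of the character vanishes. -/
theorem charCls_pow_eq_zero {N : ℕ} (hN : 0 < N) (U : Fin N → Set X) (η : Fin N → X → ZMod 2)
    (hU : ∀ j, IsOpen (U j)) (hcov : ∀ x, ∃ j, x ∈ U j)
    (hG : ∀ (g : G) j x, x ∈ U j → g • x ∈ U j) (hη : ∀ j, Odd χ (η j))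
    (hc : ∀ j, ContinuousOn (η j) (U j)) (hθ : Odd χ θ) :
    Lm (Orb G X) (charCls hθ) ^ N = 0 := by
  set A := Lm (Orb G X) (charCls hθ) with hA
  have hlt : ∀ (k m : ℕ) (t : T (Orb G X)), m < k → (A ^ k) t m = 0 := by
    intro k
    induction k with
    | zero => intro m t h; omega
    | succ k ih =>
      intro m t h
      rw [pow_succ', Module.End.mul_apply]
      cases m with
      | zero => rfl
      | succ m => rw [hA, Lm_succ, ← hA, ih m t (by omega), map_zero]
  -- The `k`-th factor is represented through `η k`, whose cochain vanishes on simplices in `U k`.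
  -- The product of all `N` factors vanishes on every small simplex and is therefore a coboundary.
  have key : ∀ (k n : ℕ) (t : T (Orb G X)), k ≤ N → ∃ F : cocycles (Orb G X) (n + k),
      cls _ _ F = (A ^ k) t (n + k) ∧ ∀ (σ : C(stdSimplex ℝ (Fin (n + k + 1)), X)) (j : Fin N),
        (j : ℕ) < k → (∀ x, σ x ∈ U j) → F.1 (mk G σ) = 0 := by
    intro k n t
    induction k with
    | zero =>
      intro _
      obtain ⟨F, hF⟩ := cls_surjective n (t n)
      exact ⟨F, hF, fun _ _ h ↦ absurd h (Nat.not_lt_zero _)⟩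
    | succ k ih =>
      intro hk
      obtain ⟨F, hF, hF0⟩ := ih (by omega)
      have hcls : charCls hθ = charCls (hη ⟨k, hk⟩) := charCls_eq _ _
      refine ⟨⟨cochainCup _ (add_comm 1 (n + k)) (charCochain (hη ⟨k, hk⟩)) F.1,
        cochainCup_mem_cocycles _ _ _ _ (charCochain_mem _) F.2⟩, ?_, ?_⟩
      · rw [pow_succ', Module.End.mul_apply]
        change _ = A ((A ^ k) t) (n + k + 1)
        rw [hA, Lm_succ, ← hA, ← hF, hcls]
        rfl
      · intro σ j hj hσ
        change charCochain (hη ⟨k, hk⟩) (front (Orb G X) (Nat.le.intro (add_comm 1 (n + k)))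
          (mk G (n := n + k + 1) σ)) *
            F.1 (back (Orb G X) (add_comm 1 (n + k)) (mk G (n := n + k + 1) σ)) = 0
        obtain hj | hj := Nat.lt_succ_iff_lt_or_eq.1 hj
        · refine mul_eq_zero_of_right _ ?_
          rw [back_mk]
          exact hF0 _ j hj fun x ↦ hσ _
        · refine mul_eq_zero_of_left ?_ _
          obtain rfl : j = ⟨k, hk⟩ := Fin.ext hj
          rw [front_mk]
          exact charCochain_eq_zero _ (hc _) _ fun x ↦ hσ _
  apply LinearMap.ext
  intro t
  funext m
  by_cases hm : m < N
  · exact hlt N m t hm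
  · obtain ⟨n, rfl⟩ := Nat.exists_eq_add_of_le' (not_lt.1 hm)
    obtain ⟨F, hF, hF0⟩ := key N n t le_rfl
    rw [← hF, LinearMap.zero_apply, Pi.zero_apply, cls_eq_zero_iff]
    obtain ⟨N, rfl⟩ := Nat.exists_eq_succ_of_ne_zero hN.ne'
    obtain ⟨g, hg, -⟩ := exists_coboundary_of_small hU hcov hG F.1 F.2 fun σ j hσ ↦
      hF0 σ j j.2 hσ
    exact ⟨g, hg⟩

end character

/-- The double cover defined by a subgroup of index two. -/
theorem doubleCover {G : Type*} [CommGroup G] {X : Type u} [TopologicalSpace X] [MulAction G X]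
    [ContinuousConstSMul G X] {G₁ : Type*} [Group G₁] [MulAction G₁ X] [ContinuousConstSMul G₁ X]
    {χ : G → ZMod 2} {θ : X → ZMod 2} (hθ : Odd χ θ) (h : Equivar G₁ G (ContinuousMap.id X))
    (hθ₁ : ∀ (g : G₁) (x : X), θ (g • x) = θ x) (t : G) (htt : t * t = 1) (ht : χ t = 1)
    (h₁ : ∀ g : G, ∃ g₁ : G₁, (∀ x : X, g • x = g₁ • x) ∨ ∀ x : X, g • x = t • g₁ • x)
    (ht₁ : Equivar G₁ G₁ (⟨fun x ↦ t • x, continuous_const_smul t⟩ : C(X, X))) :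
    DoubleCover (map _ h) (map _ ht₁) (pointCochain hθ₁) where
  surj n τ := by
    obtain ⟨σ, rfl⟩ := mk_surjective τ
    exact ⟨mk G₁ σ, rfl⟩
  eq_or {n σ τ} hστ := by
    obtain ⟨σ, rfl⟩ := mk_surjective σ
    obtain ⟨τ, rfl⟩ := mk_surjective τ
    rw [map_app_mk, map_app_mk, eq_comm, mk_eq_mk_iff] at hστ
    obtain ⟨g, hg⟩ := hστ
    have hg : ∀ x, g • σ x = τ x := fun x ↦ DFunLike.congr_fun hg x
    rw [map_app_mk]
    obtain ⟨g₁, h1 | h1⟩ := h₁ g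
    · exact Or.inl ((mk_eq_mk_iff _ _).2 ⟨g₁, ContinuousMap.ext fun x ↦ (h1 _).symm.trans (hg x)⟩)
    · obtain ⟨g₂, hg₂⟩ := ht₁ g₁
      exact Or.inr ((mk_eq_mk_iff _ _).2
        ⟨g₂, ContinuousMap.ext fun x ↦ (hg₂ (σ x)).symm.trans ((h1 _).symm.trans (hg x))⟩)
  app_t {n} σ := by
    obtain ⟨σ, rfl⟩ := mk_surjective σ
    exact (mk_eq_mk_iff _ _).2 ⟨t, rfl⟩
  t_t {n} σ := by
    obtain ⟨σ, rfl⟩ := mk_surjective σ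
    rw [map_app_mk, map_app_mk]
    congr 1
    refine ContinuousMap.ext fun x ↦ ?_
    change t • t • σ x = σ x
    rw [smul_smul, htt, one_smul]
  odd σ := by
    obtain ⟨σ, rfl⟩ := mk_surjective σ
    rw [map_app_mk, pointCochain_mk, pointCochain_mk, ← ht]
    exact hθ t _

end Orb

/-! ## Homogeneous elements of the total cohomology -/

namespace SSetMod2

variable {K L : SSet.{u}}

/-- Elements concentrated in degree `n`. -/
def Homog (n : ℕ) (t : T K) : Prop := ∀ m, m ≠ n → t m = 0

theorem homog_T1 : Homog 0 (T1 K) := fun _ hm ↦ Pi.single_eq_of_ne hm _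

theorem Homog.Lm {n : ℕ} {t : T K} (ht : Homog n t) (c : H K 1) : Homog (n + 1) (Lm K c t) := by
  intro m hm
  cases m with
  | zero => rfl
  | succ m => rw [Lm_succ, ht m (by omega), map_zero]

theorem Homog.Lm_pow {n : ℕ} {t : T K} (ht : Homog n t) (c : H K 1) (k : ℕ) :
    Homog (n + k) ((SSetMod2.Lm K c ^ k) t) := by
  induction k with
  | zero => exact ht
  | succ k ih =>
    rw [pow_succ', Module.End.mul_apply]
    exact ih.Lm c

theorem homog_Lm_pow_T1 (c : H K 1) (k : ℕ) : Homog k ((Lm K c ^ k) (T1 K)) := by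
  have := (homog_T1 (K := K)).Lm_pow c k
  rwa [zero_add] at this

theorem Homog.eq_zero {n : ℕ} {t : T K} (ht : Homog n t) (h : t n = 0) : t = 0 := by
  funext m
  by_cases hm : m = n
  · rw [hm, h]
    rfl
  · exact ht m hm

theorem Homog.apply_ne_zero {n : ℕ} {t : T K} (ht : Homog n t) (h : t ≠ 0) : t n ≠ 0 :=
  fun h' ↦ h (ht.eq_zero h')

theorem Homog.single_apply {n : ℕ} {t : T K} (ht : Homog n t) : Pi.single n (t n) = t := by
  funext m
  by_cases hm : m = n
  · subst hm
    exact Pi.single_eq_same _ _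
  · rw [ht m hm, Pi.single_eq_of_ne hm]

theorem sum_smul_apply {ι : Type*} (s : Finset ι) (c : ι → ZMod 2) (t : ι → T K) (n : ℕ) :
    (∑ i ∈ s, c i • t i) n = ∑ i ∈ s, c i • t i n := by
  rw [Finset.sum_apply]
  rfl

/-- If a nonzero power of `c` spans together with the lower ones, it and the lower ones are
independent. -/
theorem linearIndependent_Lm_pow (c : H K 1) (r : ℕ) (h : (Lm K c ^ r) (T1 K) ≠ 0) :
    LinearIndependent (ZMod 2) fun j : Fin (r + 1) ↦ (Lm K c ^ (j : ℕ)) (T1 K) := by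
  rw [Fintype.linearIndependent_iff]
  intro g hg j
  have hj : (Lm K c ^ (j : ℕ)) (T1 K) ≠ 0 := by
    intro h0
    apply h
    rw [← Nat.sub_add_cancel (Nat.lt_succ_iff.1 j.2), pow_add, Module.End.mul_apply, h0, map_zero]
  have h1 := congrFun hg j
  rw [sum_smul_apply, Finset.sum_eq_single j] at h1
  · exact (smul_eq_zero.1 h1).resolve_right ((homog_Lm_pow_T1 c j).apply_ne_zero hj)
  · intro i _ hij
    rw [homog_Lm_pow_T1 c i j (fun h ↦ hij (Fin.ext h.symm)), smul_zero]
  · simp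

theorem T1_ne_zero (σ : K.obj (op (SimplexCategory.mk 0))) : T1 K ≠ 0 := by
  intro h
  have h1 := congrFun h 0
  change (Pi.single 0 (one K) : T K) 0 = 0 at h1
  rw [Pi.single_eq_same, one, cls_eq_zero_iff, mem_coboundaries_zero_iff] at h1
  exact one_ne_zero (congrFun h1 σ)

end SSetMod2

namespace Orb

theorem subsingleton_T {G : Type*} [Group G] {X : Type u} [TopologicalSpace X] [MulAction G X]
    [ContinuousConstSMul G X] [IsEmpty X] : Subsingleton (T (Orb G X)) := by
  constructor
  intro s t
  funext n
  obtain ⟨f, hf⟩ := cls_surjective n (s n)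
  obtain ⟨g, hg⟩ := cls_surjective n (t n)
  rw [← hf, ← hg]
  congr 1
  apply Subtype.ext
  apply cochain_ext
  intro σ
  exact isEmptyElim (σ (vertices n 0))

theorem T1_ne_zero (G : Type*) [Group G] {X : Type u} [TopologicalSpace X] [MulAction G X]
    [ContinuousConstSMul G X] (x : X) : T1 (Orb G X) ≠ 0 :=
  SSetMod2.T1_ne_zero (mk G (ContinuousMap.const _ x))

/-! ### Odd functions and locally defined odd functions. -/

section odd

variable {G : Type*} [Group G] {X : Type u} [MulAction G X] {χ : G → ZMod 2}

/-- Choose a base point in each orbit and apply `χ` to an element carrying it to `x`. That element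
is unique up to stabilizers, on which `χ` vanishes. -/
theorem exists_odd (hχ : ∀ g h, χ (g * h) = χ g + χ h) (h : ∀ g (x : X), g • x = x → χ g = 0) :
    ∃ θ : X → ZMod 2, Odd χ θ := by
  have hq : ∀ x : X, ∃ g : G, g • (Quotient.mk (MulAction.orbitRel G X) x).out = x := by
    intro x
    have h1 := Quotient.exact (s := MulAction.orbitRel G X)
      (Quotient.out_eq (Quotient.mk (MulAction.orbitRel G X) x))
    obtain ⟨g, hg⟩ := (MulAction.orbitRel G X).symm h1
    exact ⟨g, hg⟩
  choose c hc using hq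
  refine ⟨fun x ↦ χ (c x), fun g x ↦ ?_⟩
  have hx : Quotient.mk (MulAction.orbitRel G X) (g • x) = Quotient.mk (MulAction.orbitRel G X) x :=
    Quotient.sound ⟨g, rfl⟩
  have h1 := hc (g • x)
  rw [hx] at h1
  have h2 : ((c (g • x))⁻¹ * (g * c x)) • (Quotient.mk (MulAction.orbitRel G X) x).out =
      (Quotient.mk (MulAction.orbitRel G X) x).out := by
    rw [mul_smul, mul_smul, hc x, inv_smul_eq_iff, h1]
  have h3 := h _ _ h2
  have h4 : χ (c (g • x)) + χ ((c (g • x))⁻¹ * (g * c x)) = χ g + χ (c x) := by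
    rw [← hχ, mul_inv_cancel_left, hχ]
  rw [h3, add_zero] at h4
  exact h4.trans (add_comm _ _)

variable [TopologicalSpace X] [ContinuousConstSMul G X] {θ : X → ZMod 2}

/-- A local odd function on the invariant set `U j` is extended by the arbitrary odd function `θ`
outside; only its continuity on `U j` matters. -/
theorem charCls_pow_eq_zero' {N : ℕ} (hN : 0 < N) (U : Fin N → Set X) (η : Fin N → X → ZMod 2)
    (hU : ∀ j, IsOpen (U j)) (hcov : ∀ x, ∃ j, x ∈ U j)
    (hG : ∀ (g : G) j x, x ∈ U j → g • x ∈ U j)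
    (hη : ∀ j g x, x ∈ U j → η j (g • x) = η j x + χ g)
    (hc : ∀ j, ContinuousOn (η j) (U j)) (hθ : Odd χ θ) :
    Lm (Orb G X) (charCls hθ) ^ N = 0 := by
  classical
  refine charCls_pow_eq_zero hN U (fun j ↦ (U j).piecewise (η j) θ) hU hcov hG (fun j g x ↦ ?_)
    (fun j ↦ (hc j).congr fun x hx ↦ Set.piecewise_eq_of_mem _ _ _ hx) hθ
  by_cases hx : x ∈ U j
  · rw [Set.piecewise_eq_of_mem _ _ _ hx, Set.piecewise_eq_of_mem _ _ _ (hG g j x hx), hη j g x hx]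
  · have hx' : g • x ∉ U j := fun h ↦ hx (by simpa using hG g⁻¹ j _ h)
    rw [Set.piecewise_eq_of_notMem _ _ _ hx, Set.piecewise_eq_of_notMem _ _ _ hx', hθ]

end odd

end Orb

/-! ## Invariant subsets -/

/-- Subsets which are invariant under a group. -/
class InvSet (G : Type*) {E : Type*} [Group G] [MulAction G E] (s : Set E) : Prop where
  smul_mem (g : G) {x : E} : x ∈ s → g • x ∈ s

section invset

variable {G : Type*} {E : Type*} [Group G] [MulAction G E] (s : Set E) [InvSet G s]

instance InvSet.mulAction : MulAction G s where
  smul g x := ⟨g • x.1, InvSet.smul_mem g x.2⟩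
  one_smul x := Subtype.ext (one_smul G x.1)
  mul_smul g h x := Subtype.ext (mul_smul g h x.1)

theorem InvSet.coe_smul (g : G) (x : s) : ((g • x : s) : E) = g • (x : E) := rfl

instance InvSet.continuousConstSMul [TopologicalSpace E] [ContinuousConstSMul G E] :
    ContinuousConstSMul G s :=
  ⟨fun g ↦ ((continuous_const_smul g).comp continuous_subtype_val).subtype_mk _⟩

end invset

/-! ## Spheres -/

section sphere

variable (V : Type u) [NormedAddCommGroup V] [InnerProductSpace ℝ V]

/-- The nonzero vectors. -/
def Sph : Set V := {v | v ≠ 0}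

variable {V}

/-- The part of `v` orthogonal to the unit vector `e`. -/
noncomputable def orthPart (e : V) : V →ₗ[ℝ] V :=
  LinearMap.id - (innerₛₗ ℝ e).smulRight e

theorem orthPart_apply (e v : V) : orthPart e v = v - inner ℝ e v • e := rfl

theorem continuous_orthPart (e : V) : Continuous (orthPart e) := by
  have : (orthPart e : V → V) = fun v ↦ v - inner ℝ e v • e := rfl
  rw [this]
  fun_prop

variable {e : V} (he : inner ℝ e e = (1 : ℝ))

include he in
theorem inner_orthPart (v : V) : inner ℝ e (orthPart e v) = (0 : ℝ) := by
  rw [orthPart_apply, inner_sub_right, inner_smul_right, he, mul_one, sub_self]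

theorem orthPart_of_inner_eq_zero {v : V} (h : inner ℝ e v = (0 : ℝ)) : orthPart e v = v := by
  rw [orthPart_apply, h, zero_smul, sub_zero]

include he in
theorem orthPart_self : orthPart e e = 0 := by
  rw [orthPart_apply, he, one_smul, sub_self]

theorem orthPart_neg (e v : V) : orthPart (-e) v = orthPart e v := by
  rw [orthPart_apply, orthPart_apply, inner_neg_left, smul_neg, neg_smul, neg_neg]

/-- The vectors off the ray opposite to `e`. -/
def OffRay (e : V) : Set V := {v | orthPart e v ≠ 0 ∨ 0 < inner ℝ e v}

/-- The vectors off the line of `e`. -/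
def OffLine (e : V) : Set V := {v | orthPart e v ≠ 0}

theorem isOpen_offLine (e : V) : IsOpen (OffLine e) :=
  isOpen_ne_fun (continuous_orthPart e) continuous_const

theorem isOpen_offRay (e : V) : IsOpen (OffRay e) :=
  (isOpen_offLine e).union (isOpen_lt continuous_const
    (continuous_const.inner (𝕜 := ℝ) continuous_id))

theorem offRay_ne_zero {v : V} (h : v ∈ OffRay e) : v ≠ 0 := by
  rintro rfl
  rcases h with h | h
  · exact h (map_zero _)
  · rw [inner_zero_right] at h
    exact lt_irrefl _ h

theorem offLine_subset_offRay (e : V) : OffLine e ⊆ OffRay e := fun _ h ↦ Or.inl h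

theorem mem_offLine_iff {v : V} : v ∈ OffLine e ↔ v ∈ OffRay e ∧ v ∈ OffRay (-e) := by
  refine ⟨fun h ↦ ⟨Or.inl h, Or.inl (by rwa [orthPart_neg])⟩, ?_⟩
  rintro ⟨h | h, h' | h'⟩
  · exact h
  · exact h
  · rwa [orthPart_neg] at h'
  · rw [inner_neg_left] at h'
    linarith

theorem offRay_or {v : V} (hv : v ≠ 0) : v ∈ OffRay e ∨ v ∈ OffRay (-e) := by
  by_cases h : orthPart e v = 0
  · rcases lt_trichotomy 0 (inner ℝ e v : ℝ) with h1 | h1 | h1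
    · exact Or.inl (Or.inr h1)
    · rw [orthPart_of_inner_eq_zero h1.symm] at h
      exact absurd h hv
    · refine Or.inr (Or.inr ?_)
      rw [inner_neg_left]
      linarith
  · exact Or.inl (Or.inl h)

include he in
theorem self_mem_offRay : e ∈ OffRay e := Or.inr (by rw [he]; exact one_pos)

include he in
-- The complement of the ray opposite to `e` is star-shaped about `e`; this contracts each piece of
-- the cover of the sphere.
theorem segment_mem_offRay {v : V} (hv : v ∈ OffRay e) (t : unitInterval) :
    (1 - (t : ℝ)) • v + (t : ℝ) • e ∈ OffRay e := by
  have h1 : orthPart e ((1 - (t : ℝ)) • v + (t : ℝ) • e) = (1 - (t : ℝ)) • orthPart e v := by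
    rw [map_add, map_smul, map_smul, orthPart_self he, smul_zero, add_zero]
  have h2 : inner ℝ e ((1 - (t : ℝ)) • v + (t : ℝ) • e) = (1 - (t : ℝ)) * inner ℝ e v + t := by
    rw [inner_add_right, inner_smul_right, inner_smul_right, he, mul_one]
  have t0 := t.2.1
  have t1 := t.2.2
  unfold OffRay
  rw [Set.mem_ofPred_eq, h1, h2]
  by_cases ht : (t : ℝ) = 1
  · right
    rw [ht]
    norm_num
  · have : 0 < 1 - (t : ℝ) := by
      have := lt_of_le_of_ne t1 ht
      linarith
    rcases hv with hv | hv
    · exact Or.inl (smul_ne_zero this.ne' hv)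
    · right
      have := mul_pos this hv
      linarith

theorem orthPart_sub_smul (he : inner ℝ e e = (1 : ℝ)) (v : V) (t : ℝ) :
    orthPart e (v - (t * inner ℝ e v) • e) = orthPart e v := by
  rw [map_sub, map_smul, orthPart_self he, smul_zero, sub_zero]

end sphere

/-! ## Excision for subsets -/

/-- The inclusion of a subset. -/
def inclMap {E : Type*} [TopologicalSpace E] {s t : Set E} (h : s ⊆ t) : C(s, t) :=
  ⟨Set.inclusion h, continuous_inclusion h⟩

theorem Orb.excisive_subset {G : Type*} [Group G] {E : Type u} [TopologicalSpace E]
    {p a b c : Set E} [MulAction G p] [MulAction G a] [MulAction G b] [MulAction G c]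
    [ContinuousConstSMul G p] [ContinuousConstSMul G a] [ContinuousConstSMul G b]
    [ContinuousConstSMul G c] (ha : a ⊆ p) (hb : b ⊆ p) (hca : c ⊆ a) (hcb : c ⊆ b)
    (hc : ∀ x, x ∈ a → x ∈ b → x ∈ c) (hcov : ∀ x ∈ p, x ∈ a ∨ x ∈ b)
    (oa : IsOpen (Subtype.val ⁻¹' a : Set p)) (ob : IsOpen (Subtype.val ⁻¹' b : Set p))
    (ea : ∀ (g : G) x, inclMap ha (g • x) = g • inclMap ha x)
    (eb : ∀ (g : G) x, inclMap hb (g • x) = g • inclMap hb x)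
    (eca : ∀ (g : G) x, inclMap hca (g • x) = g • inclMap hca x)
    (ecb : ∀ (g : G) x, inclMap hcb (g • x) = g • inclMap hcb x) :
    Excisive (map (inclMap ha) (equivar_of_smul ea)) (map (inclMap hb) (equivar_of_smul eb))
      (map (inclMap hca) (equivar_of_smul eca)) (map (inclMap hcb) (equivar_of_smul ecb)) := by
  refine excisive _ _ _ _ ea eb eca ecb (Topology.IsOpenEmbedding.inclusion ha oa)
    (Topology.IsOpenEmbedding.inclusion hb ob) (Topology.IsEmbedding.inclusion hca) (fun _ ↦ rfl)
    ?_ ?_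
  · rintro ⟨x, hx⟩
    rcases hcov x hx with h | h
    · exact Or.inl ⟨⟨x, h⟩, rfl⟩
    · exact Or.inr ⟨⟨x, h⟩, rfl⟩
  · rintro ⟨x, hx⟩ ⟨y, hy⟩ hxy
    obtain rfl : x = y := congrArg Subtype.val hxy
    exact ⟨⟨x, hc x hx hy⟩, rfl⟩

/-! ## The cohomology of spheres -/

theorem span_eq_top_of_bijective {ι M N : Type*} [AddCommGroup M] [AddCommGroup N]
    [Module (ZMod 2) M] [Module (ZMod 2) N] (f : M →ₗ[ZMod 2] N) (hf : Function.Bijective f)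
    {β : ι → M} (h : Submodule.span (ZMod 2) (Set.range fun i ↦ f (β i)) = ⊤) :
    Submodule.span (ZMod 2) (Set.range β) = ⊤ := by
  rw [eq_top_iff]
  intro x _
  have hx : f x ∈ Submodule.span (ZMod 2) (Set.range fun i ↦ f (β i)) := by
    rw [h]
    trivial
  have : (Set.range fun i ↦ f (β i)) = f '' Set.range β := by
    rw [← Set.range_comp]
    rfl
  rw [this, Submodule.span_image] at hx
  obtain ⟨y, hy, hyx⟩ := hx
  rwa [← hf.1 hyx]

theorem finite_and_finrank_of_bijective {M N : Type*} [AddCommGroup M] [AddCommGroup N]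
    [Module (ZMod 2) M] [Module (ZMod 2) N] (f : M →ₗ[ZMod 2] N) (hf : Function.Bijective f)
    [Module.Finite (ZMod 2) N] :
    Module.Finite (ZMod 2) M ∧ Module.finrank (ZMod 2) M = Module.finrank (ZMod 2) N :=
  ⟨Module.Finite.equiv (LinearEquiv.ofBijective f hf).symm,
    (LinearEquiv.ofBijective f hf).finrank_eq⟩

namespace Orb

/-- There is one simplex in each degree, and the coboundary from degree `n` multiplies by the number
`n + 2` of faces, so the cochain complex alternates between zero and the identity. -/
theorem span_T1_of_subsingleton (G : Type*) [Group G] (X : Type u) [TopologicalSpace X]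
    [MulAction G X] [ContinuousConstSMul G X] [Subsingleton X] [Nonempty X] :
    Submodule.span (ZMod 2) (Set.range fun _ : Fin 1 ↦ T1 (Orb G X)) = ⊤ := by
  obtain ⟨x₀⟩ := ‹Nonempty X›
  have hmk : ∀ n (σ τ : C(stdSimplex ℝ (Fin (n + 1)), X)), σ = τ := fun n σ τ ↦
    ContinuousMap.ext fun _ ↦ Subsingleton.elim _ _
  have hcob : ∀ n (f : Cochain (Orb G X) n) (a : ZMod 2), (∀ σ, f (mk G σ) = a) →
      ∀ σ, coboundary (Orb G X) n f (mk G σ) = (n + 2 : ℕ) * a := by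
    intro n f a hf σ
    rw [coboundary_mk]
    simp only [hf, Finset.sum_const, Finset.card_univ, Fintype.card_fin, nsmul_eq_mul]
  rw [eq_top_iff]
  intro t _
  have hpos : ∀ n, t (n + 1) = 0 := by
    intro n
    obtain ⟨f, hf⟩ := cls_surjective (n + 1) (t (n + 1))
    rw [← hf, cls_eq_zero_iff]
    set a := f.1 (mk G (ContinuousMap.const _ x₀)) with ha
    have hfa : ∀ σ, f.1 (mk G σ) = a := fun σ ↦ by rw [hmk _ σ]
    have h0 : ((n + 3 : ℕ) : ZMod 2) * a = 0 := by
      rw [← hcob _ f.1 a hfa (ContinuousMap.const _ x₀)]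
      exact congrFun f.2 _
    rcases Nat.even_or_odd n with hn | hn
    · have h1 : ((n + 3 : ℕ) : ZMod 2) = 1 := by
        rw [ZMod.natCast_eq_one_iff_odd]
        exact hn.add_odd (by decide)
      rw [h1, one_mul] at h0
      have : f.1 = 0 := cochain_ext fun σ ↦ (hfa σ).trans h0
      rw [this]
      exact Submodule.zero_mem _
    · refine ⟨fun _ ↦ a, cochain_ext fun σ ↦ ?_⟩
      rw [hcob n (fun _ ↦ a) a (fun _ ↦ rfl), hfa]
      have h1 : ((n + 2 : ℕ) : ZMod 2) = 1 := by
        rw [ZMod.natCast_eq_one_iff_odd]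
        exact hn.add_even (by decide)
      rw [h1, one_mul]
  obtain ⟨f, hf⟩ := cls_surjective 0 (t 0)
  set a := f.1 (mk G (ContinuousMap.const _ x₀)) with ha
  have : t = a • T1 (Orb G X) := by
    funext n
    cases n with
    | zero =>
      change _ = a • (Pi.single 0 (one _) : T (Orb G X)) 0
      rw [← hf, Pi.single_eq_same, one, ← map_smul]
      congr 1
      apply Subtype.ext
      apply cochain_ext
      intro σ
      change f.1 (mk G σ) = a * 1
      rw [mul_one, ha, hmk _ σ]
    | succ n =>
      rw [hpos]
      change 0 = a • (Pi.single 0 (one _) : T (Orb G X)) (n + 1)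
      rw [Pi.single_eq_of_ne (by omega), smul_zero]
  rw [this]
  exact Submodule.smul_mem _ _ (Submodule.subset_span ⟨0, rfl⟩)

end Orb

/-! ### Mayer–Vietoris for nonzero vectors, covered by the complements of two opposite rays. -/

section sphere

open Orb

variable {V : Type u} [NormedAddCommGroup V] [InnerProductSpace ℝ V] {e : V}

theorem span_T1_offRay (he : inner ℝ e e = (1 : ℝ)) :
    Submodule.span (ZMod 2) (Set.range fun _ : Fin 1 ↦ T1 (Orb Unit (OffRay e))) = ⊤ := by
  have hi : Equivar Unit Unit (ContinuousMap.const PUnit.{u + 1} (⟨e, self_mem_offRay he⟩ : OffRay e)) :=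
    fun g ↦ ⟨g, fun _ ↦ rfl⟩
  have hb := map_bijective_of_retract _ hi (ContinuousMap.const (OffRay e) PUnit.unit)
    (fun g ↦ ⟨g, fun _ ↦ rfl⟩) (fun _ ↦ rfl)
    ⟨fun p ↦ ⟨(1 - (p.2 : ℝ)) • (p.1 : V) + (p.2 : ℝ) • e, segment_mem_offRay he p.1.2 p.2⟩, by
      refine Continuous.subtype_mk ?_ _
      fun_prop⟩ (fun g ↦ ⟨g, fun _ _ ↦ rfl⟩) (fun x ↦ Subtype.ext (by simp))
      (fun x ↦ Subtype.ext (by simp))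
  refine span_eq_top_of_bijective _ (Tmap_bijective _ hb) ?_
  simp only [Tmap_T1]
  exact span_T1_of_subsingleton Unit PUnit.{u + 1}

/-- The projection to the orthogonal complement of a unit vector. -/
noncomputable def toOrth (he : inner ℝ e e = (1 : ℝ)) (v : V) : (ℝ ∙ e)ᗮ :=
  ⟨orthPart e v, Submodule.mem_orthogonal_singleton_iff_inner_right.2 (inner_orthPart he v)⟩

theorem inner_orth (x : (ℝ ∙ e)ᗮ) : inner ℝ e (x : V) = (0 : ℝ) :=
  Submodule.mem_orthogonal_singleton_iff_inner_right.1 x.2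

theorem finrank_orth {m : ℕ} (he : inner ℝ e e = (1 : ℝ)) (hV : Module.finrank ℝ V = m + 1) :
    Module.finrank ℝ (ℝ ∙ e)ᗮ = m := by
  have := Fact.mk hV
  refine Submodule.finrank_orthogonal_span_singleton ?_
  rintro rfl
  simp at he

theorem exists_unit {m : ℕ} (hV : Module.finrank ℝ V = m + 1) :
    ∃ e : V, inner ℝ e e = (1 : ℝ) := by
  have : Nontrivial V := Module.nontrivial_of_finrank_pos (R := ℝ) (by omega)
  obtain ⟨e, he⟩ := exists_norm_eq V (c := 1) zero_le_one
  exact ⟨e, by rw [real_inner_self_eq_norm_sq, he, one_pow]⟩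

/-- The inclusion of the sphere of the orthogonal complement. -/
def orthIncl (e : V) : C(Sph (ℝ ∙ e)ᗮ, OffLine e) where
  toFun x := ⟨x.1.1, by
    change orthPart e _ ≠ 0
    rw [orthPart_of_inner_eq_zero (inner_orth x.1)]
    exact fun h ↦ x.2 (Subtype.ext h)⟩
  continuous_toFun := by fun_prop

/-- Shrinking the component along `e` linearly leaves the orthogonal part unchanged, hence nonzero
throughout. -/
theorem map_orthIncl_bijective (he : inner ℝ e e = (1 : ℝ)) (n : ℕ) :
    Function.Bijective (SSetMod2.map
      (Orb.map (orthIncl e) (fun g ↦ ⟨g, fun _ ↦ rfl⟩ : Equivar Unit Unit _)) n) := by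
  refine map_bijective_of_retract (orthIncl e) _
    (⟨fun x ↦ ⟨toOrth he x, fun h ↦ x.2 (congrArg Subtype.val h)⟩, ?_⟩ : C(OffLine e, Sph (ℝ ∙ e)ᗮ))
    (fun g ↦ ⟨g, fun _ ↦ rfl⟩) ?_
    ⟨fun p ↦ ⟨p.1.1 - ((p.2 : ℝ) * inner ℝ e p.1.1) • e, by
      change orthPart e _ ≠ 0
      rw [orthPart_sub_smul he]
      exact p.1.2⟩, ?_⟩ (fun g ↦ ⟨g, fun _ _ ↦ rfl⟩) ?_ ?_ n
  · refine Continuous.subtype_mk (Continuous.subtype_mk ?_ _) _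
    exact (continuous_orthPart e).comp continuous_subtype_val
  · intro x
    exact Subtype.ext (Subtype.ext (orthPart_of_inner_eq_zero (inner_orth x.1)))
  · refine Continuous.subtype_mk ?_ _
    fun_prop
  · intro x
    exact Subtype.ext (by simp)
  · intro x
    refine Subtype.ext ?_
    change x.1 - ((1 : unitInterval) * inner ℝ e x.1 : ℝ) • e = _
    simp
    rfl

theorem inner_neg_self (he : inner ℝ e e = (1 : ℝ)) : inner ℝ (-e) (-e) = (1 : ℝ) := by
  rw [inner_neg_neg, he]

theorem isEmpty_offLine (he : inner ℝ e e = (1 : ℝ)) (hV : Module.finrank ℝ V = 1) :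
    IsEmpty (OffLine e) := by
  have : FiniteDimensional ℝ V := Module.finite_of_finrank_pos (by omega)
  have h0 := Module.finrank_zero_iff.1 (finrank_orth he hV)
  exact ⟨fun x ↦ x.2 (congrArg Subtype.val (Subsingleton.elim (toOrth he x.1) 0))⟩

theorem offRay_subset_sph (e : V) : OffRay e ⊆ Sph V := fun _ hv ↦ offRay_ne_zero hv

theorem offLine_subset_offRay_neg (e : V) : OffLine e ⊆ OffRay (-e) :=
  fun _ hv ↦ (mem_offLine_iff.1 hv).2

theorem excisive_sphere (e : V) :
    Excisive (Orb.map (G := Unit) (G' := Unit) (inclMap (offRay_subset_sph e))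
        (equivar_of_smul fun _ _ ↦ rfl))
      (Orb.map (G := Unit) (G' := Unit) (inclMap (offRay_subset_sph (-e)))
        (equivar_of_smul fun _ _ ↦ rfl))
      (Orb.map (G := Unit) (G' := Unit) (inclMap (offLine_subset_offRay e))
        (equivar_of_smul fun _ _ ↦ rfl))
      (Orb.map (G := Unit) (G' := Unit) (inclMap (offLine_subset_offRay_neg e))
        (equivar_of_smul fun _ _ ↦ rfl)) :=
  excisive_subset (offRay_subset_sph e) (offRay_subset_sph (-e)) (offLine_subset_offRay e)
    (offLine_subset_offRay_neg e) (fun _ h h' ↦ mem_offLine_iff.2 ⟨h, h'⟩)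
    (fun _ hv ↦ offRay_or hv) ((isOpen_offRay e).preimage continuous_subtype_val)
    ((isOpen_offRay (-e)).preimage continuous_subtype_val) (fun _ _ ↦ rfl) (fun _ _ ↦ rfl)
    (fun _ _ ↦ rfl) (fun _ _ ↦ rfl)

theorem linearIndependent_T1 (G : Type*) [Group G] {X : Type u} [TopologicalSpace X] [MulAction G X]
    [ContinuousConstSMul G X] (x : X) :
    LinearIndependent (ZMod 2) fun _ : Fin 1 ↦ T1 (Orb G X) :=
  linearIndependent_unique_iff.2 (Orb.T1_ne_zero G x)

theorem notMem_span_of_Tmap {K L : SSet.{u}} (φ : K ⟶ L) {ι : Type*} {β : ι → T L} {t : T L}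
    (h : Tmap φ t ∉ Submodule.span (ZMod 2) (Set.range fun i ↦ Tmap φ (β i))) :
    t ∉ Submodule.span (ZMod 2) (Set.range β) := by
  intro ht
  apply h
  have h1 := Submodule.mem_map_of_mem (f := Tmap φ) ht
  rwa [← Submodule.span_image, ← Set.range_comp] at h1

/-- The cohomology of the sphere of dimension `m`. -/
theorem sphere_cohomology (m : ℕ) : ∀ (V : Type u) [NormedAddCommGroup V] [InnerProductSpace ℝ V]
    (_ : Module.finrank ℝ V = m + 1),
    Module.Finite (ZMod 2) (T (Orb Unit (Sph V))) ∧
      Module.finrank (ZMod 2) (T (Orb Unit (Sph V))) ≤ 2 ∧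
      ∃ x : H (Orb Unit (Sph V)) m, Pi.single m x ∉
        Submodule.span (ZMod 2) (Set.range fun _ : Fin 1 ↦ T1 (Orb Unit (Sph V))) := by
  induction m with
  | zero =>
    intro V _ _ hV
    obtain ⟨e, he⟩ := exists_unit hV
    have := isEmpty_offLine he hV
    -- In dimension one the intersection of the two pieces is empty: this is the 0-sphere, whose
    -- extra class equals one on a single component.
    have := subsingleton_T (G := Unit) (X := OffLine e)
    have s₁ := span_T1_offRay he
    have s₂ := span_T1_offRay (inner_neg_self he)
    obtain ⟨h1, h2⟩ := (excisive_sphere e).finite_and_finrank_le_of_subsingleton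
      (fun _ : Fin 1 ↦ T1 (Orb Unit (Sph V))) (by simpa only [Tmap_T1]) (by simpa only [Tmap_T1])
    refine ⟨h1, h2, (excisive_sphere e).exists_notMem_span_of_subsingleton
      (fun _ : Fin 1 ↦ T1 (Orb Unit (Sph V))) 0 homog_T1 ?_ ?_⟩
    · simp only [Tmap_T1]
      exact linearIndependent_T1 Unit (⟨e, self_mem_offRay he⟩ : OffRay e)
    · simp only [Tmap_T1]
      exact linearIndependent_T1 Unit (⟨-e, self_mem_offRay (inner_neg_self he)⟩ : OffRay (-e))
  | succ m ih =>
    intro V _ _ hV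
    obtain ⟨e, he⟩ := exists_unit hV
    have s₁ := span_T1_offRay he
    have s₂ := span_T1_offRay (inner_neg_self he)
    obtain ⟨hf, hr, x, hx⟩ := ih (ℝ ∙ e)ᗮ (finrank_orth he hV)
    obtain ⟨e', he'⟩ := exists_unit (finrank_orth he hV)
    have hb := map_orthIncl_bijective he
    obtain ⟨hf₀, hr₀⟩ := finite_and_finrank_of_bijective _ (Tmap_bijective _ hb)
    have hli : LinearIndependent (ZMod 2) fun _ : Fin 1 ↦ T1 (Orb Unit (OffLine e)) :=
      linearIndependent_T1 Unit (orthIncl e ⟨e', fun h ↦ by simp [h] at he'⟩)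
    obtain ⟨h1, h2⟩ := (excisive_sphere e).finite_and_finrank_le
      (fun _ : Fin 1 ↦ T1 (Orb Unit (Sph V))) (by simpa only [Tmap_T1]) (by simpa only [Tmap_T1])
      (by simpa only [Tmap_T1])
    refine ⟨h1, h2.trans (hr₀.trans_le hr), ?_⟩
    -- The class found on the equator extends to the off-line vectors, and the connecting map raises
    -- it by one degree.
    obtain ⟨c, rfl⟩ := (hb m).2 x
    refine (excisive_sphere e).exists_notMem_span
      (fun _ : Fin 1 ↦ T1 (Orb Unit (Sph V))) (by omega) (fun j k hk ↦ homog_T1 k (by omega))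
      (by simpa only [Tmap_T1]) (by simpa only [Tmap_T1]) c ?_
    simp only [Tmap_T1]
    refine notMem_span_of_Tmap
      (Orb.map (orthIncl e) (fun g ↦ ⟨g, fun _ ↦ rfl⟩ : Equivar Unit Unit _)) ?_
    simp only [Tmap_T1, Tmap_single]
    exact hx

end sphere

/-! ## The cohomology of real projective spaces -/

/-- The sign character. -/
def sgn (g : ℤˣ) : ZMod 2 := if g = 1 then 0 else 1

theorem sgn_mul : ∀ g h, sgn (g * h) = sgn g + sgn h := by decide

theorem units_smul_eq_or {V : Type*} [AddCommGroup V] (g : ℤˣ) :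
    (sgn g = 0 ∧ ∀ x : V, g • x = x) ∨ (sgn g = 1 ∧ ∀ x : V, g • x = -x) := by
  rcases Int.units_eq_one_or g with rfl | rfl
  · exact Or.inl ⟨rfl, fun x ↦ one_smul _ x⟩
  · exact Or.inr ⟨rfl, fun x ↦ by rw [Units.neg_smul, one_smul]⟩

theorem sgn_eq_zero_of_smul_eq {V : Type*} [AddCommGroup V] [Module ℝ V] {g : ℤˣ} {x : V}
    (hx : x ≠ 0) (h : g • x = x) : sgn g = 0 := by
  rcases units_smul_eq_or (V := V) g with hg | hg
  · exact hg.1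
  · rw [hg.2, neg_eq_iff_add_eq_zero, ← two_smul ℝ] at h
    exact absurd ((smul_eq_zero.1 h).resolve_left two_ne_zero) hx

theorem continuousOn_sign {X : Type*} [TopologicalSpace X] (l : X → ℝ) (hl : Continuous l) :
    ContinuousOn (fun x ↦ if 0 < l x then (0 : ZMod 2) else 1) {x | l x ≠ 0} := by
  intro x hx
  apply ContinuousAt.continuousWithinAt
  rcases lt_or_gt_of_ne (show l x ≠ 0 from hx) with h | h
  · have : (fun x ↦ if 0 < l x then (0 : ZMod 2) else 1) =ᶠ[nhds x] fun _ ↦ 1 := by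
      filter_upwards [(isOpen_lt hl continuous_const).mem_nhds h] with y hy
      exact if_neg (not_lt.2 (le_of_lt hy))
    exact continuousAt_const.congr this.symm
  · have : (fun x ↦ if 0 < l x then (0 : ZMod 2) else 1) =ᶠ[nhds x] fun _ ↦ 0 := by
      filter_upwards [(isOpen_lt continuous_const hl).mem_nhds h] with y hy
      exact if_pos hy
    exact continuousAt_const.congr this.symm

namespace Orb

/-- Where an odd real function is nonzero, its sign is a locally constant odd function. `N` such
functions without a common zero thus kill the `N`-th power. -/
theorem charCls_pow_eq_zero_of_coords {G : Type*} [Group G] {X : Type u} [TopologicalSpace X]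
    [MulAction G X] [ContinuousConstSMul G X] {χ : G → ZMod 2} {θ : X → ZMod 2} (hθ : Odd χ θ)
    {N : ℕ} (hN : 0 < N) (l : Fin N → X → ℝ) (hl : ∀ j, Continuous (l j))
    (hodd : ∀ g, (χ g = 0 ∧ ∀ j x, l j (g • x) = l j x) ∨ (χ g = 1 ∧ ∀ j x, l j (g • x) = -l j x))
    (hcov : ∀ x, ∃ j, l j x ≠ 0) : Lm (Orb G X) (charCls hθ) ^ N = 0 := by
  refine charCls_pow_eq_zero' hN (fun j ↦ {x | l j x ≠ 0})
    (fun j x ↦ if 0 < l j x then (0 : ZMod 2) else 1) (fun j ↦ isOpen_ne_fun (hl j) continuous_const)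
    hcov ?_ ?_ (fun j ↦ continuousOn_sign _ (hl j)) hθ
  · intro g j x hx
    change l j (g • x) ≠ 0
    rcases hodd g with h | h
    · rwa [h.2]
    · rw [h.2]
      exact neg_ne_zero.2 hx
  · intro j g x hx
    rcases hodd g with h | h
    · rw [h.2, h.1, add_zero]
    · rw [h.2, h.1]
      rcases lt_or_gt_of_ne (show l j x ≠ 0 from hx) with h | h
      · rw [if_pos (by linarith), if_neg (by linarith)]
        rfl
      · rw [if_neg (by linarith), if_pos (by linarith)]
        rfl

end Orb

section rp

open Orb

variable {V : Type u} [NormedAddCommGroup V] [InnerProductSpace ℝ V]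

instance unitsAction (V : Type*) [NormedAddCommGroup V] : MulAction ℤˣ V := Units.instMulAction

instance (V : Type*) [NormedAddCommGroup V] : ContinuousConstSMul ℤˣ V :=
  Units.continuousConstSMul

instance : InvSet ℤˣ (Sph V) where
  smul_mem g x hx := by
    change g • x ≠ 0
    rcases units_smul_eq_or (V := V) g with h | h
    · rwa [h.2]
    · rw [h.2]
      exact neg_ne_zero.2 hx

instance : MulAction ℤˣ (Sph V) := InvSet.mulAction (Sph V)

instance : ContinuousConstSMul ℤˣ (Sph V) := InvSet.continuousConstSMul (Sph V)

theorem exists_odd_sph (V : Type u) [NormedAddCommGroup V] [InnerProductSpace ℝ V] :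
    ∃ θ : Sph V → ZMod 2, Odd sgn θ :=
  exists_odd sgn_mul fun _ x h ↦ sgn_eq_zero_of_smul_eq x.2 (congrArg Subtype.val h)

theorem odd_sph (V : Type u) [NormedAddCommGroup V] [InnerProductSpace ℝ V] :
    Odd sgn (exists_odd_sph V).choose := (exists_odd_sph V).choose_spec

/-- The class of degree one of a projective space. -/
noncomputable def rpCls (V : Type u) [NormedAddCommGroup V] [InnerProductSpace ℝ V] :
    H (Orb ℤˣ (Sph V)) 1 := charCls (odd_sph V)

theorem rpCls_pow {m : ℕ} (hV : Module.finrank ℝ V = m + 1) :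
    Lm (Orb ℤˣ (Sph V)) (rpCls V) ^ (m + 1) = 0 := by
  have : FiniteDimensional ℝ V := Module.finite_of_finrank_pos (by omega)
  let b := Module.finBasisOfFinrankEq ℝ V hV
  refine charCls_pow_eq_zero_of_coords (odd_sph V) m.succ_pos (fun j x ↦ b.coord j x)
    (fun j ↦ (LinearMap.continuous_of_finiteDimensional (b.coord j)).comp continuous_subtype_val)
    (fun g ↦ ?_) fun x ↦ ?_
  · rcases units_smul_eq_or (V := V) g with h | h
    · refine Or.inl ⟨h.1, fun j x ↦ ?_⟩
      rw [InvSet.coe_smul, h.2]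
    · refine Or.inr ⟨h.1, fun j x ↦ ?_⟩
      rw [InvSet.coe_smul, h.2, map_neg]
  · by_contra! h
    exact x.2 (b.forall_coord_eq_zero_iff.1 h)

theorem doubleCover_sph (V : Type u) [NormedAddCommGroup V] [InnerProductSpace ℝ V] :
    DoubleCover (Orb.map (ContinuousMap.id (Sph V)) (fun _ ↦ ⟨1, fun x ↦ (one_smul _ x).symm⟩ :
        Equivar Unit ℤˣ _))
      (Orb.map ⟨fun x : Sph V ↦ (-1 : ℤˣ) • x, continuous_const_smul _⟩
        (fun _ ↦ ⟨1, fun _ ↦ rfl⟩ : Equivar Unit Unit _))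
      (pointCochain (G₁ := Unit) (θ := (exists_odd_sph V).choose) fun _ _ ↦ rfl) :=
  doubleCover (odd_sph V) _ _ (-1) (by decide) rfl (fun g ↦ ⟨1, by
    rcases Int.units_eq_one_or g with rfl | rfl
    · exact Or.inl fun x ↦ one_smul _ x
    · exact Or.inr fun x ↦ rfl⟩) _

/-- The sphere has total dimension at most two, so by the Gysin triangle the unit generates the base
over the powers of `w`. The base cannot vanish in degree `m`, where only `w ^ m` lives; hence this
power is nonzero, and it and the lower powers are independent. -/
theorem rp_cohomology {m : ℕ} (hV : Module.finrank ℝ V = m + 1) :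
    (LinearIndependent (ZMod 2) fun j : Fin (m + 1) ↦
      (Lm (Orb ℤˣ (Sph V)) (rpCls V) ^ (j : ℕ)) (T1 _)) ∧
    Submodule.span (ZMod 2) (Set.range fun j : Fin (m + 1) ↦
      (Lm (Orb ℤˣ (Sph V)) (rpCls V) ^ (j : ℕ)) (T1 _)) = ⊤ := by
  obtain ⟨hf, hr, x, hx⟩ := sphere_cohomology m V hV
  obtain ⟨e, he⟩ := exists_unit hV
  have D := doubleCover_sph V
  have hw := coboundary_pointCochain (G₁ := Unit) (odd_sph V)
    (fun _ ↦ ⟨1, fun x ↦ (one_smul _ x).symm⟩) fun _ _ ↦ rfl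
  have hspan := D.span_eq_top (w := ⟨_, charCochain_mem (odd_sph V)⟩) hw (rpCls_pow hV) (r := 1) hr
    (fun _ ↦ T1 _) (by
      simp only [Tmap_T1]
      exact linearIndependent_T1 Unit (⟨e, fun h ↦ by simp [h] at he⟩ : Sph V))
  change Submodule.span (ZMod 2) (Set.range fun ij : Fin (m + 1) × Fin 1 ↦
    (Lm _ (rpCls V) ^ (ij.1 : ℕ)) (T1 (Orb ℤˣ (Sph V)))) = ⊤ at hspan
  have hspan' : Submodule.span (ZMod 2) (Set.range fun j : Fin (m + 1) ↦
      (Lm (Orb ℤˣ (Sph V)) (rpCls V) ^ (j : ℕ)) (T1 _)) = ⊤ := by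
    rw [← hspan]
    congr 1
    ext y
    constructor
    · rintro ⟨j, rfl⟩
      exact ⟨(j, 0), rfl⟩
    · rintro ⟨⟨j, _⟩, rfl⟩
      exact ⟨j, rfl⟩
  refine ⟨linearIndependent_Lm_pow _ _ ?_, hspan'⟩
  obtain ⟨y, hy⟩ := D.exists_ne_zero x (by
    rintro rfl
    rw [Pi.single_zero] at hx
    exact hx (Submodule.zero_mem _))
  intro h0
  apply hy
  have hmem : (Pi.single m y : T (Orb ℤˣ (Sph V))) ∈ Submodule.span (ZMod 2)
      (Set.range fun j : Fin (m + 1) ↦ (Lm (Orb ℤˣ (Sph V)) (rpCls V) ^ (j : ℕ)) (T1 _)) := by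
    rw [hspan']
    trivial
  obtain ⟨c, hc⟩ := (Submodule.mem_span_range_iff_exists_fun _).1 hmem
  have h1 := congrFun hc m
  rw [sum_smul_apply, Pi.single_eq_same] at h1
  rw [← h1]
  refine Finset.sum_eq_zero fun j _ ↦ ?_
  by_cases hj : m = j
  · rw [← hj, h0]
    exact smul_zero _
  · rw [homog_Lm_pow_T1 _ _ _ hj, smul_zero]

end rp

/-! ## Pairs of orthogonal vectors -/

/-- The factorwise action on a product. -/
instance prodAction {M N A B : Type*} [Group M] [Group N] [MulAction M A] [MulAction N B] :
    MulAction (M × N) (A × B) where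
  smul g x := (g.1 • x.1, g.2 • x.2)
  one_smul x := Prod.ext (one_smul M x.1) (one_smul N x.2)
  mul_smul g h x := Prod.ext (mul_smul g.1 h.1 x.1) (mul_smul g.2 h.2 x.2)

theorem prodAction_smul {M N A B : Type*} [Group M] [Group N] [MulAction M A] [MulAction N B]
    (g : M × N) (x : A × B) : g • x = (g.1 • x.1, g.2 • x.2) := rfl

instance {M N A B : Type*} [Group M] [Group N] [MulAction M A] [MulAction N B]
    [TopologicalSpace A] [TopologicalSpace B] [ContinuousConstSMul M A] [ContinuousConstSMul N B] :
    ContinuousConstSMul (M × N) (A × B) :=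
  ⟨fun g ↦ ((continuous_const_smul g.1).comp continuous_fst).prodMk
    ((continuous_const_smul g.2).comp continuous_snd)⟩

section geometry

variable {V : Type u} [NormedAddCommGroup V] [InnerProductSpace ℝ V]

/-- The projection of `x` to the orthogonal complement of `w` in the direction of `v`. -/
noncomputable def shear (x v w : V) : V := x - (inner ℝ x w / inner ℝ v w : ℝ) • v

theorem inner_shear {x v w : V} (h : inner ℝ v w ≠ (0 : ℝ)) : inner ℝ (shear x v w) w = (0 : ℝ) := by
  rw [shear, inner_sub_left, real_inner_smul_left, div_mul_cancel₀ _ h, sub_self]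

/-- If the sheared vector vanished, `x` would be a multiple of `v`; orthogonality to `y`, to which
`v` is not orthogonal, would then force `x = 0`. -/
theorem shear_ne_zero {x v w y : V} (hx : x ≠ 0) (hxy : inner ℝ x y = (0 : ℝ))
    (h : inner ℝ v y ≠ (0 : ℝ)) : shear x v w ≠ 0 := by
  intro h0
  rw [shear, sub_eq_zero] at h0
  have h1 := hxy
  rw [h0, real_inner_smul_left, mul_eq_zero, or_iff_left h] at h1
  rw [h1, zero_smul] at h0
  exact hx h0

theorem shear_of_inner_eq_zero {x v w : V} (h : inner ℝ x w = (0 : ℝ)) : shear x v w = x := by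
  rw [shear, h, zero_div, zero_smul, sub_zero]

theorem shear_smul (g : ℤˣ) (x v w : V) : shear (g • x) v w = g • shear x v w := by
  rcases units_smul_eq_or (V := V) g with h | h
  · rw [h.2, h.2]
  · rw [h.2, h.2, shear, shear, inner_neg_left, neg_div, neg_smul]
    abel

/-- The point on the segment from `y` to `e`. -/
def towards (e y : V) (t : ℝ) : V := (1 - t) • y + t • e

/-- A vector on the bisector of `y` and `w`. -/
noncomputable def bisector (y w : V) : V := ‖w‖ • y + ‖y‖ • w

theorem bisector_comm (y w : V) : bisector y w = bisector w y := add_comm _ _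

/-- Orthogonality would be equality in Cauchy–Schwarz for `-y` and `w`, making them positively
proportional, and then the bisector is zero. -/
theorem inner_bisector {y w : V} (h : bisector y w ≠ 0) (hw : w ≠ 0) :
    inner ℝ (bisector y w) w ≠ (0 : ℝ) := by
  intro h0
  rw [bisector, inner_add_left, real_inner_smul_left, real_inner_smul_left,
    real_inner_self_eq_norm_sq, pow_two] at h0
  have hw' : ‖w‖ ≠ 0 := norm_ne_zero_iff.2 hw
  have h1 : inner ℝ (-y) w = ‖-y‖ * ‖w‖ := by
    rw [inner_neg_left, norm_neg]
    have : ‖w‖ * (inner ℝ y w + ‖y‖ * ‖w‖) = 0 := by linarith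
    have := (mul_eq_zero.1 this).resolve_left hw'
    linarith
  rw [inner_eq_norm_mul_iff_real, norm_neg, smul_neg] at h1
  exact h (by rw [bisector, ← h1, add_neg_cancel])

variable {e : V} (he : inner ℝ e e = (1 : ℝ))

include he in
theorem smul_add_smul_mem_offRay {y : V} (hy : y ∈ OffRay e) {c d : ℝ} (hc : 0 < c) (hd : 0 ≤ d) :
    c • y + d • e ∈ OffRay e := by
  rcases hy with hy | hy
  · left
    rw [map_add, map_smul, map_smul, orthPart_self he, smul_zero, add_zero]
    exact smul_ne_zero hc.ne' hy
  · right
    rw [inner_add_right, inner_smul_right, inner_smul_right, he, mul_one]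
    have := mul_pos hc hy
    linarith

include he in
theorem towards_mem {y : V} (hy : y ∈ OffRay e) (t : unitInterval) : towards e y t ∈ OffRay e :=
  segment_mem_offRay he hy t

include he in
-- The bisector is a combination of `y` and `e` with positive coefficient on `y` and nonnegative
-- coefficient on `e`, so it stays off the opposite ray.
theorem bisector_towards_ne_zero {y : V} (hy : y ∈ OffRay e) (t : unitInterval) :
    bisector y (towards e y t) ≠ 0 := by
  have h : bisector y (towards e y t) =
      (‖towards e y t‖ + ‖y‖ * (1 - (t : ℝ))) • y + (‖y‖ * (t : ℝ)) • e := by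
    rw [bisector, towards, smul_add, smul_smul, smul_smul, ← add_assoc, ← add_smul]
  have t0 := t.2.1
  have t1 := t.2.2
  rw [h]
  refine offRay_ne_zero (smul_add_smul_mem_offRay he hy ?_ (by positivity))
  have := norm_pos_iff.2 (offRay_ne_zero (towards_mem he hy t))
  have : 0 ≤ ‖y‖ * (1 - (t : ℝ)) := mul_nonneg (norm_nonneg _) (by linarith)
  linarith

variable (W : Submodule ℝ V)

/-- Pairs of nonzero orthogonal vectors, the second one in `W`. -/
def ZSet : Set (V × V) := {p | p.1 ≠ 0 ∧ p.2 ≠ 0 ∧ p.2 ∈ W ∧ inner ℝ p.1 p.2 = (0 : ℝ)}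

/-- The part where the second vector is off the ray opposite to `e`. -/
def ZRay (e : V) : Set (V × V) := {p | p ∈ ZSet W ∧ p.2 ∈ OffRay e}

/-- The part where the second vector is off the line of `e`. -/
def ZLine (e : V) : Set (V × V) := {p | p ∈ ZSet W ∧ p.2 ∈ OffLine e}

instance : InvSet (ℤˣ × ℤˣ) (ZSet W) where
  smul_mem g p hp := by
    obtain ⟨h1, h2, h3, h4⟩ := hp
    rw [prodAction_smul]
    rcases units_smul_eq_or (V := V) g.1 with h | h <;>
      rcases units_smul_eq_or (V := V) g.2 with h' | h' <;> rw [h.2, h'.2]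
    · exact ⟨h1, h2, h3, h4⟩
    · exact ⟨h1, neg_ne_zero.2 h2, W.neg_mem h3, by rw [inner_neg_right, h4, neg_zero]⟩
    · exact ⟨neg_ne_zero.2 h1, h2, h3, by rw [inner_neg_left, h4, neg_zero]⟩
    · exact ⟨neg_ne_zero.2 h1, neg_ne_zero.2 h2, W.neg_mem h3, by rw [inner_neg_neg, h4]⟩

instance : InvSet (ℤˣ × Unit) (ZSet W) where
  smul_mem g p hp := by
    have := InvSet.smul_mem (G := ℤˣ × ℤˣ) ((g.1, 1) : ℤˣ × ℤˣ) hp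
    rwa [prodAction_smul, one_smul] at this

instance : MulAction (ℤˣ × ℤˣ) (ZSet W) := InvSet.mulAction (ZSet W)

instance : ContinuousConstSMul (ℤˣ × ℤˣ) (ZSet W) := InvSet.continuousConstSMul (ZSet W)

instance : MulAction (ℤˣ × Unit) (ZSet W) := InvSet.mulAction (ZSet W)

instance : ContinuousConstSMul (ℤˣ × Unit) (ZSet W) := InvSet.continuousConstSMul (ZSet W)

instance (e : V) : InvSet (ℤˣ × Unit) (ZRay W e) where
  smul_mem g _ hp := ⟨InvSet.smul_mem g hp.1, hp.2⟩

instance (e : V) : InvSet (ℤˣ × Unit) (ZLine W e) where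
  smul_mem g _ hp := ⟨InvSet.smul_mem g hp.1, hp.2⟩

open Orb

theorem zray_subset (e : V) : ZRay W e ⊆ ZSet W := fun _ h ↦ h.1

theorem zline_subset (e : V) : ZLine W e ⊆ ZRay W e :=
  fun _ h ↦ ⟨h.1, offLine_subset_offRay e h.2⟩

theorem zline_subset_neg (e : V) : ZLine W e ⊆ ZRay W (-e) :=
  fun _ h ↦ ⟨h.1, (mem_offLine_iff.1 h.2).2⟩

/-- The inclusion of `ZRay W e`. -/
noncomputable def rayMap (e : V) :
    Orb (ℤˣ × Unit) (ZRay W e) ⟶ Orb (ℤˣ × Unit) (ZSet W) :=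
  Orb.map (inclMap (zray_subset W e)) (equivar_of_smul fun _ _ ↦ rfl)

/-- The inclusion of `ZLine W e` into `ZRay W e`. -/
noncomputable def lineMap (e : V) :
    Orb (ℤˣ × Unit) (ZLine W e) ⟶ Orb (ℤˣ × Unit) (ZRay W e) :=
  Orb.map (inclMap (zline_subset W e)) (equivar_of_smul fun _ _ ↦ rfl)

/-- The inclusion of `ZLine W e` into `ZRay W (-e)`. -/
noncomputable def lineMapNeg (e : V) :
    Orb (ℤˣ × Unit) (ZLine W e) ⟶ Orb (ℤˣ × Unit) (ZRay W (-e)) :=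
  Orb.map (inclMap (zline_subset_neg W e)) (equivar_of_smul fun _ _ ↦ rfl)

theorem excisive_Z (e : V) :
    Excisive (rayMap W e) (rayMap W (-e)) (lineMap W e) (lineMapNeg W e) := by
  have key : ∀ e : V, IsOpen (Subtype.val ⁻¹' ZRay W e : Set (ZSet W)) := by
    intro e
    have : (Subtype.val ⁻¹' ZRay W e : Set (ZSet W)) = (fun p : ZSet W ↦ p.1.2) ⁻¹' OffRay e := by
      ext p
      exact ⟨fun h ↦ h.2, fun h ↦ ⟨p.2, h⟩⟩
    rw [this]
    exact (isOpen_offRay e).preimage (by fun_prop)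
  exact excisive_subset (zray_subset W e) (zray_subset W (-e)) (zline_subset W e)
    (zline_subset_neg W e)
    (fun _ h h' ↦ ⟨h.1, mem_offLine_iff.2 ⟨h.2, h'.2⟩⟩)
    (fun x hx ↦ (offRay_or hx.2.1).imp (fun h ↦ ⟨hx, h⟩) fun h ↦ ⟨hx, h⟩) (key e) (key (-e))
    (fun _ _ ↦ rfl) (fun _ _ ↦ rfl) (fun _ _ ↦ rfl) (fun _ _ ↦ rfl)

/-! ### The fibers -/

variable {W}

/-- The deformation of `ZRay W e` to the fiber over `e`. -/
noncomputable def rayMove (e : V) (p : V × V) (t : ℝ) : V × V :=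
  (shear p.1 (bisector p.2 (towards e p.2 t)) (towards e p.2 t), towards e p.2 t)

include he in
-- While `y` moves straight to `e`, `x` must follow to stay orthogonal and nonzero. Projecting along
-- the moved `y` itself could kill `x` when it becomes orthogonal to the old `y`; the bisector is
-- orthogonal to neither.
theorem rayMove_mem (heW : e ∈ W) {p : V × V} (hp : p ∈ ZRay W e) (t : unitInterval) :
    rayMove e p t ∈ ZRay W e := by
  obtain ⟨⟨h1, h2, h3, h4⟩, h5⟩ := hp
  have hw := towards_mem he h5 t
  have hb := bisector_towards_ne_zero he h5 t
  refine ⟨⟨?_, offRay_ne_zero hw, ?_, ?_⟩, hw⟩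
  · refine shear_ne_zero h1 h4 ?_
    rw [bisector_comm] at hb ⊢
    exact inner_bisector hb h2
  · exact W.add_mem (W.smul_mem _ h3) (W.smul_mem _ heW)
  · exact inner_shear (inner_bisector hb (offRay_ne_zero hw))

include he in
theorem continuous_rayMove :
    Continuous fun q : ZRay W e × unitInterval ↦ rayMove e (q.1 : V × V) (q.2 : ℝ) := by
  have hd : ∀ q : ZRay W e × unitInterval, (inner ℝ (bisector (q.1 : V × V).2
      (towards e (q.1 : V × V).2 q.2)) (towards e (q.1 : V × V).2 q.2) : ℝ) ≠ 0 := fun q ↦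
    inner_bisector (bisector_towards_ne_zero he q.1.2.2 q.2)
      (offRay_ne_zero (towards_mem he q.1.2.2 q.2))
  have ht : Continuous fun q : ZRay W e × unitInterval ↦ towards e (q.1 : V × V).2 (q.2 : ℝ) := by
    unfold towards
    fun_prop
  have hb : Continuous fun q : ZRay W e × unitInterval ↦
      bisector (q.1 : V × V).2 (towards e (q.1 : V × V).2 (q.2 : ℝ)) := by
    unfold bisector
    fun_prop
  have hx : Continuous fun q : ZRay W e × unitInterval ↦ (q.1 : V × V).1 := by fun_prop
  refine Continuous.prodMk ?_ ht
  exact hx.sub ((Continuous.div (hx.inner ht) (hb.inner ht) hd).smul hb)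

theorem towards_one (e y : V) : towards e y 1 = e := by simp [towards]

theorem towards_zero (e y : V) : towards e y 0 = y := by simp [towards]

theorem rayMove_zero {p : V × V} (hp : p ∈ ZSet W) : rayMove e p 0 = p := by
  rw [rayMove, towards_zero, shear_of_inner_eq_zero hp.2.2.2]

theorem rayMove_smul (g : ℤˣ × Unit) (p : V × V) (t : ℝ) : rayMove e (g • p) t = g • rayMove e p t :=
  Prod.ext (shear_smul g.1 _ _ _) rfl

/-- The inclusion of the fiber over `e`. -/
def fiberIncl (heW : e ∈ W) : C(Sph (ℝ ∙ e)ᗮ, ZSet W) where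
  toFun x := ⟨(x.1.1, e), fun h ↦ x.2 (Subtype.ext h), by
    rintro rfl
    simp at he, heW, by rw [real_inner_comm]; exact inner_orth x.1⟩
  continuous_toFun := by fun_prop

/-- The inclusion of the fiber over `e` into `ZRay W e`. -/
def rayIncl (heW : e ∈ W) : C(Sph (ℝ ∙ e)ᗮ, ZRay W e) where
  toFun x := ⟨(x.1.1, e), (fiberIncl he heW x).2, self_mem_offRay he⟩
  continuous_toFun := by fun_prop

/-- The inclusion of the fiber, on orbits of simplices. -/
noncomputable def fiberMap (heW : e ∈ W) :
    Orb ℤˣ (Sph (ℝ ∙ e)ᗮ) ⟶ Orb (ℤˣ × Unit) (ZRay W e) :=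
  Orb.map (rayIncl he heW) fun g ↦ ⟨(g, ()), fun _ ↦ rfl⟩

/-- Over the contractible part of second vectors the space of pairs retracts, compatibly with the
sign of `x`, onto the fiber over `e`, whose orbits give a projective space. -/
theorem map_fiberMap_bijective (heW : e ∈ W) (n : ℕ) :
    Function.Bijective (SSetMod2.map (fiberMap he heW) n) := by
  have hc := continuous_rayMove (W := W) he
  refine map_bijective_of_retract (rayIncl he heW) _
    (⟨fun p ↦ ⟨⟨(rayMove e p 1).1, ?_⟩, ?_⟩, ?_⟩ : C(ZRay W e, Sph (ℝ ∙ e)ᗮ))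
    (fun g ↦ ⟨g.1, ?_⟩) ?_
    ⟨fun q ↦ ⟨rayMove e q.1 q.2, rayMove_mem he heW q.1.2 q.2⟩, hc.subtype_mk _⟩
    (fun g ↦ ⟨g, fun p t ↦ Subtype.ext (rayMove_smul g p.1 t)⟩) ?_ ?_ n
  · rw [Submodule.mem_orthogonal_singleton_iff_inner_right, real_inner_comm]
    have := (rayMove_mem he heW p.2 1).1.2.2.2
    change inner ℝ (rayMove e p 1).1 (towards e p.1.2 1) = (0 : ℝ) at this
    rwa [towards_one] at this
  · intro h
    exact (rayMove_mem he heW p.2 1).1.1 (congrArg Subtype.val h)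
  · refine Continuous.subtype_mk (Continuous.subtype_mk ?_ _) _
    exact continuous_fst.comp (hc.comp (continuous_id.prodMk continuous_const : Continuous fun p ↦
      (p, (1 : unitInterval))))
  · intro p
    exact Subtype.ext (Subtype.ext (congrArg Prod.fst (rayMove_smul g p.1 1)))
  · intro x
    refine Subtype.ext (Subtype.ext ?_)
    refine shear_of_inner_eq_zero ?_
    rw [towards_one, real_inner_comm]
    exact inner_orth x.1
  · intro p
    exact Subtype.ext (rayMove_zero p.2.1)
  · intro p
    exact Subtype.ext (Prod.ext rfl (towards_one e p.1.2))

/-! ### The induction step -/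

/-- The deformation of `ZLine W e` to the pairs with second vector orthogonal to `e`. -/
noncomputable def lineMove (e : V) (p : V × V) (t : ℝ) : V × V :=
  (shear p.1 (p.2 - (t * inner ℝ e p.2) • e) (p.2 - (t * inner ℝ e p.2) • e),
    p.2 - (t * inner ℝ e p.2) • e)

include he in
-- The inner product equals the squared length of the orthogonal part plus `1 - t` times the square
-- of the component along `e`. It is positive, so here orthogonal projection of `x` suffices and no
-- bisector is needed.
theorem inner_lineMove {y : V} (hy : y ∈ OffLine e) (t : unitInterval) :
    inner ℝ (y - ((t : ℝ) * inner ℝ e y) • e) y ≠ (0 : ℝ) := by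
  have h1 : y = orthPart e y + inner ℝ e y • e := by rw [orthPart_apply, sub_add_cancel]
  have h2 : inner ℝ y y = inner ℝ (orthPart e y) (orthPart e y) + inner ℝ e y * inner ℝ e y := by
    conv_lhs => rw [h1]
    rw [inner_add_left, inner_add_right, inner_add_right, real_inner_smul_left,
      real_inner_smul_left, real_inner_smul_right, real_inner_smul_right, he, inner_orthPart he,
      real_inner_comm e, inner_orthPart he]
    ring
  have h3 : (0 : ℝ) < inner ℝ (orthPart e y) (orthPart e y) := real_inner_self_pos.2 hy
  rw [inner_sub_left, real_inner_smul_left, h2]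
  have t1 := t.2.2
  have : 0 ≤ (1 - (t : ℝ)) * (inner ℝ e y * inner ℝ e y) :=
    mul_nonneg (by linarith) (mul_self_nonneg _)
  apply ne_of_gt
  linarith

theorem lineMove_snd_mem (he : inner ℝ e e = (1 : ℝ)) {y : V} (hy : y ∈ OffLine e) (t : ℝ) :
    y - (t * inner ℝ e y) • e ∈ OffLine e := by
  change orthPart e _ ≠ 0
  rwa [orthPart_sub_smul he]

theorem offLine_ne_zero {y : V} (hy : y ∈ OffLine e) : y ≠ 0 :=
  offRay_ne_zero (offLine_subset_offRay e hy)

include he in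
theorem lineMove_mem (heW : e ∈ W) {p : V × V} (hp : p ∈ ZLine W e) (t : unitInterval) :
    lineMove e p t ∈ ZLine W e := by
  obtain ⟨⟨h1, h2, h3, h4⟩, h5⟩ := hp
  have hw := lineMove_snd_mem he h5 t
  refine ⟨⟨?_, offLine_ne_zero hw, ?_, ?_⟩, hw⟩
  · exact shear_ne_zero h1 h4 (inner_lineMove he h5 t)
  · exact W.sub_mem h3 (W.smul_mem _ heW)
  · exact inner_shear (real_inner_self_pos.2 (offLine_ne_zero hw)).ne'

include he in
theorem continuous_lineMove :
    Continuous fun q : ZLine W e × unitInterval ↦ lineMove e (q.1 : V × V) (q.2 : ℝ) := by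
  have ht : Continuous fun q : ZLine W e × unitInterval ↦
      (q.1 : V × V).2 - ((q.2 : ℝ) * inner ℝ e (q.1 : V × V).2) • e := by
    fun_prop
  have hx : Continuous fun q : ZLine W e × unitInterval ↦ (q.1 : V × V).1 := by fun_prop
  refine Continuous.prodMk ?_ ht
  exact hx.sub ((Continuous.div (hx.inner ht) (ht.inner ht) fun q ↦
    (real_inner_self_pos.2 (offLine_ne_zero (lineMove_snd_mem he q.1.2.2 q.2))).ne').smul ht)

theorem lineMove_zero {p : V × V} (hp : p ∈ ZSet W) : lineMove e p 0 = p := by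
  rw [lineMove, zero_mul, zero_smul, sub_zero, shear_of_inner_eq_zero hp.2.2.2]

theorem lineMove_smul (g : ℤˣ × Unit) (p : V × V) (t : ℝ) :
    lineMove e (g • p) t = g • lineMove e p t :=
  Prod.ext (shear_smul g.1 _ _ _) rfl

theorem zset_orth_subset (e : V) : ZSet ((ℝ ∙ e)ᗮ ⊓ W) ⊆ ZLine W e := by
  rintro p ⟨h1, h2, h3, h4⟩
  refine ⟨⟨h1, h2, h3.2, h4⟩, ?_⟩
  change orthPart e p.2 ≠ 0
  rwa [orthPart_of_inner_eq_zero (Submodule.mem_orthogonal_singleton_iff_inner_right.1 h3.1)]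

/-- The inclusion of the pairs with second vector orthogonal to `e` into `ZLine W e`. -/
noncomputable def orthMap (W : Submodule ℝ V) (e : V) :
    Orb (ℤˣ × Unit) (ZSet ((ℝ ∙ e)ᗮ ⊓ W)) ⟶ Orb (ℤˣ × Unit) (ZLine W e) :=
  Orb.map (inclMap (zset_orth_subset (W := W) e)) (equivar_of_smul fun _ _ ↦ rfl)

include he in
theorem map_orthMap_bijective (heW : e ∈ W) (n : ℕ) :
    Function.Bijective (SSetMod2.map (orthMap W e) n) := by
  have hc := continuous_lineMove (W := W) he
  have hmem : ∀ p : ZLine W e, lineMove e p 1 ∈ ZSet ((ℝ ∙ e)ᗮ ⊓ W) := by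
    intro p
    obtain ⟨⟨h1, h2, h3, h4⟩, h5⟩ := lineMove_mem he heW p.2 1
    refine ⟨h1, h2, ⟨?_, h3⟩, h4⟩
    refine Submodule.mem_orthogonal_singleton_iff_inner_right.2 ?_
    change inner ℝ e (_ - (1 * _) • e) = (0 : ℝ)
    rw [one_mul]
    exact inner_orthPart he _
  have hfix : ∀ p ∈ ZSet ((ℝ ∙ e)ᗮ ⊓ W), lineMove e p 1 = p := by
    intro p hp
    have : inner ℝ e p.2 = (0 : ℝ) :=
      Submodule.mem_orthogonal_singleton_iff_inner_right.1 hp.2.2.1.1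
    rw [lineMove, this, mul_zero, zero_smul, sub_zero, shear_of_inner_eq_zero hp.2.2.2]
  refine map_bijective_of_retract (inclMap (zset_orth_subset (W := W) e)) _
    (⟨fun p ↦ ⟨lineMove e p 1, hmem p⟩, ?_⟩ : C(ZLine W e, ZSet ((ℝ ∙ e)ᗮ ⊓ W)))
    (fun g ↦ ⟨g, fun p ↦ Subtype.ext (lineMove_smul g p.1 1)⟩)
    (fun p ↦ Subtype.ext (hfix p.1 p.2))
    ⟨fun q ↦ ⟨lineMove e q.1 q.2, lineMove_mem he heW q.1.2 q.2⟩, hc.subtype_mk _⟩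
    (fun g ↦ ⟨g, fun p t ↦ Subtype.ext (lineMove_smul g p.1 t)⟩)
    (fun p ↦ Subtype.ext (lineMove_zero p.2.1)) (fun p ↦ rfl) n
  refine Continuous.subtype_mk ?_ _
  exact hc.comp (continuous_id.prodMk continuous_const : Continuous fun p ↦ (p, (1 : unitInterval)))

end geometry

theorem SSetMod2.Tmap_Lm_pow_T1 {K L : SSet.{u}} (φ : K ⟶ L) (c : H L 1) (k : ℕ) :
    Tmap φ ((Lm L c ^ k) (T1 L)) = (Lm K (SSetMod2.map φ 1 c) ^ k) (T1 K) :=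
  (Tmap_Lm_pow φ c k (T1 L)).trans (congrArg _ (Tmap_T1 φ))

/-! ### Cohomology of pairs of orthogonal vectors modulo the sign of the first. -/

section zcohomology

open Orb

variable {V : Type u} [NormedAddCommGroup V] [InnerProductSpace ℝ V] {e : V}

/-- The powers of the class of degree one of a projective space. -/
noncomputable def rpPow (V : Type u) [NormedAddCommGroup V] [InnerProductSpace ℝ V] (j : ℕ) :
    T (Orb ℤˣ (Sph V)) := (Lm (Orb ℤˣ (Sph V)) (rpCls V) ^ j) (T1 _)

/-- The inclusion of a subsphere. -/
def sphIncl (e : V) : C(Sph (ℝ ∙ e)ᗮ, Sph V) where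
  toFun x := ⟨x.1.1, fun h ↦ x.2 (Subtype.ext h)⟩
  continuous_toFun := by fun_prop

theorem sphIncl_smul (e : V) (g : ℤˣ) (x : Sph (ℝ ∙ e)ᗮ) :
    sphIncl e (g • x) = g • sphIncl e x := by
  apply Subtype.ext
  rw [InvSet.coe_smul]
  change (((g • x).1 : (ℝ ∙ e)ᗮ) : V) = g • (x.1 : V)
  rw [InvSet.coe_smul]
  rcases Int.units_eq_one_or g with rfl | rfl
  · rw [one_smul, one_smul]
  · rw [Units.neg_smul, Units.neg_smul, one_smul, one_smul]
    rfl

theorem equivar_sphIncl (e : V) : Equivar ℤˣ ℤˣ (sphIncl e) := equivar_of_smul (sphIncl_smul e)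

theorem map_sphIncl_rpCls (e : V) :
    SSetMod2.map (Orb.map (sphIncl e) (equivar_sphIncl e)) 1 (rpCls V) = rpCls (ℝ ∙ e)ᗮ :=
  map_charCls (sphIncl e) (equivar_sphIncl e) (odd_sph V) (odd_sph (ℝ ∙ e)ᗮ)
    fun g ↦ ⟨g, rfl, sphIncl_smul e g⟩

theorem Tmap_sphIncl (e : V) (j : ℕ) :
    Tmap (Orb.map (sphIncl e) (equivar_sphIncl e)) (rpPow V j) = rpPow (ℝ ∙ e)ᗮ j :=
  (Tmap_Lm_pow_T1 _ (rpCls V) j).trans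
    (congrArg (fun c ↦ (Lm (Orb ℤˣ (Sph (ℝ ∙ e)ᗮ)) c ^ j) (T1 _)) (map_sphIncl_rpCls e))

/-- The first projection. -/
def prX (W : Submodule ℝ V) : C(ZSet W, Sph V) where
  toFun p := ⟨p.1.1, p.2.1⟩
  continuous_toFun := by fun_prop

theorem equivar_prX (W : Submodule ℝ V) : Equivar (ℤˣ × Unit) ℤˣ (prX W) :=
  fun g ↦ ⟨g.1, fun _ ↦ rfl⟩

/-- The pullbacks of the powers of the class of degree one. -/
noncomputable def zPow (W : Submodule ℝ V) (j : ℕ) : T (Orb (ℤˣ × Unit) (ZSet W)) :=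
  Tmap (Orb.map (prX W) (equivar_prX W)) (rpPow V j)

theorem homog_zPow (W : Submodule ℝ V) (j : ℕ) : Homog j (zPow W j) := by
  rw [zPow, rpPow, Tmap_Lm_pow_T1]
  exact homog_Lm_pow_T1 _ _

variable {W : Submodule ℝ V}

theorem fiberMap_comp (he : inner ℝ e e = (1 : ℝ)) (heW : e ∈ W) :
    (fiberMap he heW ≫ rayMap W e) ≫ Orb.map (prX W) (equivar_prX W) =
      Orb.map (sphIncl e) (equivar_sphIncl e) := by
  apply Orb.hom_ext
  intro n σ
  rfl

theorem Tmap_fiberMap (he : inner ℝ e e = (1 : ℝ)) (heW : e ∈ W) (j : ℕ) :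
    Tmap (fiberMap he heW) (Tmap (rayMap W e) (zPow W j)) = rpPow (ℝ ∙ e)ᗮ j := by
  rw [← Tmap_sphIncl, zPow, ← Tmap_comp, ← Tmap_comp, fiberMap_comp]

theorem orthMap_comp (W : Submodule ℝ V) (e : V) :
    ((orthMap W e ≫ lineMap W e) ≫ rayMap W e) ≫ Orb.map (prX W) (equivar_prX W) =
      Orb.map (prX ((ℝ ∙ e)ᗮ ⊓ W)) (equivar_prX _) := by
  apply Orb.hom_ext
  intro n σ
  rfl

theorem Tmap_orthMap (W : Submodule ℝ V) (e : V) (j : ℕ) :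
    Tmap (orthMap W e) (Tmap (lineMap W e) (Tmap (rayMap W e) (zPow W j))) =
      zPow ((ℝ ∙ e)ᗮ ⊓ W) j := by
  rw [zPow, ← Tmap_comp, ← Tmap_comp, ← Tmap_comp, orthMap_comp, zPow]

/-- On the fiber, a projective space of dimension `m`, the pulled-back powers become the powers of
its own generator. -/
theorem ray_cohomology {m : ℕ} (hV : Module.finrank ℝ V = m + 2) (he : inner ℝ e e = (1 : ℝ))
    (heW : e ∈ W) :
    (LinearIndependent (ZMod 2) fun j : Fin (m + 1) ↦ Tmap (rayMap W e) (zPow W j)) ∧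
    Submodule.span (ZMod 2) (Set.range fun j : Fin (m + 1) ↦ Tmap (rayMap W e) (zPow W j)) = ⊤ := by
  have hb := Tmap_bijective _ (map_fiberMap_bijective he heW)
  obtain ⟨h1, h2⟩ := rp_cohomology (finrank_orth he hV)
  constructor
  · refine LinearIndependent.of_comp (Tmap (fiberMap he heW)) ?_
    convert h1 using 1
    funext j
    exact Tmap_fiberMap he heW j
  · refine span_eq_top_of_bijective _ hb ?_
    simp only [Tmap_fiberMap]
    exact h2

theorem linearIndependent_zPow {m : ℕ} (hV : Module.finrank ℝ V = m + 2)
    (he : inner ℝ e e = (1 : ℝ)) (heW : e ∈ W) :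
    LinearIndependent (ZMod 2) fun j : Fin (m + 1) ↦ zPow W j :=
  LinearIndependent.of_comp (Tmap (rayMap W e)) (ray_cohomology hV he heW).1

theorem finrank_orth_inf {s : ℕ} [FiniteDimensional ℝ V] (he : inner ℝ e e = (1 : ℝ)) (heW : e ∈ W)
    (hW : Module.finrank ℝ W = s + 1) : Module.finrank ℝ ((ℝ ∙ e)ᗮ ⊓ W : Submodule ℝ V) = s := by
  have h := Submodule.finrank_add_inf_finrank_orthogonal (K₁ := ℝ ∙ e) (K₂ := W)
    ((Submodule.span_singleton_le_iff_mem _ _).2 heW)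
  rw [finrank_span_singleton (by rintro rfl; simp at he), hW] at h
  omega

theorem exists_unit_mem {s : ℕ} (hW : Module.finrank ℝ W = s + 1) :
    ∃ e ∈ W, inner ℝ e e = (1 : ℝ) := by
  obtain ⟨e, he⟩ := exists_unit hW
  exact ⟨e, e.2, he⟩

theorem isEmpty_zline [FiniteDimensional ℝ V] (he : inner ℝ e e = (1 : ℝ)) (heW : e ∈ W)
    (hW : Module.finrank ℝ W = 1) : IsEmpty (ZLine W e) := by
  have h0 := finrank_orth_inf he heW hW
  rw [Submodule.finrank_eq_zero, Submodule.eq_bot_iff] at h0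
  refine ⟨fun p ↦ p.2.2 (h0 _ ⟨?_, ?_⟩)⟩
  · exact Submodule.mem_orthogonal_singleton_iff_inner_right.2 (inner_orthPart he _)
  · exact W.sub_mem p.2.1.2.2.1 (W.smul_mem _ heW)

/-- The cohomology of the space of pairs of orthogonal vectors up to the sign of the first one. -/
theorem z_cohomology {m : ℕ} (hV : Module.finrank ℝ V = m + 2) (s : ℕ) : ∀ W : Submodule ℝ V,
    Module.finrank ℝ W = s + 1 →
    Module.Finite (ZMod 2) (T (Orb (ℤˣ × Unit) (ZSet W))) ∧
      Module.finrank (ZMod 2) (T (Orb (ℤˣ × Unit) (ZSet W))) ≤ 2 * (m + 1) ∧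
      ∃ x : H (Orb (ℤˣ × Unit) (ZSet W)) (m + s), Pi.single (m + s) x ∉
        Submodule.span (ZMod 2) (Set.range fun j : Fin (m + 1) ↦ zPow W j) := by
  have : FiniteDimensional ℝ V := Module.finite_of_finrank_pos (by omega)
  induction s with
  | zero =>
    intro W hW
    obtain ⟨e, heW, he⟩ := exists_unit_mem hW
    have := isEmpty_zline he heW hW
    have := subsingleton_T (G := ℤˣ × Unit) (X := ZLine W e)
    obtain ⟨i₁, s₁⟩ := ray_cohomology hV he heW
    obtain ⟨i₂, s₂⟩ := ray_cohomology hV (inner_neg_self he) (W.neg_mem heW)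
    obtain ⟨h1, h2⟩ := (excisive_Z W e).finite_and_finrank_le_of_subsingleton
      (fun j : Fin (m + 1) ↦ zPow W j) s₁ s₂
    refine ⟨h1, h2, ?_⟩
    -- For a one-dimensional `W` the two pieces are disjoint; the extra class is the last power, of
    -- degree `m`, taken on one piece only.
    exact (excisive_Z W e).exists_notMem_span_of_subsingleton
      (fun j : Fin (m + 1) ↦ zPow W j) (Fin.last m) (homog_zPow W _) i₁ i₂
  | succ s ih =>
    intro W hW
    obtain ⟨e, heW, he⟩ := exists_unit_mem hW
    have hW' := finrank_orth_inf he heW hW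
    obtain ⟨i₁, s₁⟩ := ray_cohomology hV he heW
    obtain ⟨i₂, s₂⟩ := ray_cohomology hV (inner_neg_self he) (W.neg_mem heW)
    obtain ⟨hf, hr, x, hx⟩ := ih _ hW'
    have hb := map_orthMap_bijective he heW
    obtain ⟨e', heW', he'⟩ := exists_unit_mem hW'
    obtain ⟨hf₀, hr₀⟩ := finite_and_finrank_of_bijective _ (Tmap_bijective _ hb)
    -- The intersection retracts to the pairs with second vector in `W ∩ e^⊥`, where the powers are
    -- independent since that space is still nonzero.
    have hli : LinearIndependent (ZMod 2) fun j : Fin (m + 1) ↦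
        Tmap (lineMap W e) (Tmap (rayMap W e) (zPow W j)) := by
      refine LinearIndependent.of_comp (Tmap (orthMap W e)) ?_
      convert linearIndependent_zPow hV he' heW' using 1
      funext j
      exact Tmap_orthMap W e j
    obtain ⟨h1, h2⟩ := (excisive_Z W e).finite_and_finrank_le
      (fun j : Fin (m + 1) ↦ zPow W j) s₁ s₂ hli
    refine ⟨h1, h2.trans (hr₀.trans_le hr), ?_⟩
    obtain ⟨c, rfl⟩ := (hb (m + s)).2 x
    refine (excisive_Z W e).exists_notMem_span (n := m + s)
      (fun j : Fin (m + 1) ↦ zPow W j) (by omega) (fun j k hk ↦ homog_zPow W j k hk) s₁ s₂ c ?_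
    refine notMem_span_of_Tmap (orthMap W e) ?_
    rw [Tmap_single]
    simp only [Tmap_orthMap]
    exact hx

end zcohomology

/-! ## Algebras generated by two classes of degree one -/

namespace SSetMod2

variable {K L : SSet.{u}}

/-- The monomial `aⁱ bʲ`. -/
def mon (a b : H K 1) (i j : ℕ) : T K := (Lm K a ^ i) ((Lm K b ^ j) (T1 K))

theorem homog_mon (a b : H K 1) (i j : ℕ) : Homog (i + j) (mon a b i j) := by
  rw [add_comm]
  exact (homog_Lm_pow_T1 b j).Lm_pow a i

theorem Lm_pow_comm (a b : H K 1) (i j : ℕ) (t : T K) :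
    (Lm K a ^ i) ((Lm K b ^ j) t) = (Lm K b ^ j) ((Lm K a ^ i) t) :=
  LinearMap.congr_fun ((Lm_commute a b).pow_pow i j).eq t

theorem mon_swap (a b : H K 1) (i j : ℕ) : mon a b i j = mon b a j i := Lm_pow_comm a b i j _

theorem Lm_pow_mon_left (a b : H K 1) (i j k : ℕ) : (Lm K a ^ k) (mon a b i j) = mon a b (k + i) j := by
  rw [mon, mon, pow_add]
  rfl

theorem Lm_pow_mon_right (a b : H K 1) (i j k : ℕ) : (Lm K b ^ k) (mon a b i j) = mon a b i (k + j) := by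
  rw [mon_swap, Lm_pow_mon_left, mon_swap]

theorem Lm_mon_left (a b : H K 1) (i j : ℕ) : Lm K a (mon a b i j) = mon a b (i + 1) j := by
  rw [add_comm]
  exact Lm_pow_mon_left a b i j 1

theorem Lm_mon_right (a b : H K 1) (i j : ℕ) : Lm K b (mon a b i j) = mon a b i (j + 1) := by
  rw [add_comm]
  exact Lm_pow_mon_right a b i j 1

theorem Tmap_mon (φ : K ⟶ L) (a b : H L 1) (i j : ℕ) :
    Tmap φ (mon a b i j) = mon (map φ 1 a) (map φ 1 b) i j := by
  rw [mon, Tmap_Lm_pow, Tmap_Lm_pow_T1]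
  rfl

/-- The total cohomology is generated by two classes with `a ^ (s + 1) = 0` and a nonzero top
class `aˢ bᵐ`. -/
structure Milnor (a b : H K 1) (m s : ℕ) : Prop where
  span : Submodule.span (ZMod 2)
    (Set.range fun ij : Fin (s + 1) × Fin (m + 1) ↦ mon a b ij.1 ij.2) = ⊤
  pow : Lm K a ^ (s + 1) = 0
  top : mon a b s m ≠ 0

namespace Milnor

variable {a b : H K 1} {m s : ℕ} (h : Milnor a b m s)
include h

theorem mon_eq_zero {i : ℕ} (hi : s < i) (j : ℕ) : mon a b i j = 0 := by
  rw [mon, ← Nat.sub_add_cancel (show s + 1 ≤ i from hi), pow_add, h.pow, mul_zero,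
    LinearMap.zero_apply]

theorem top_apply : mon a b s m (s + m) ≠ 0 := (homog_mon a b s m).apply_ne_zero h.top

/-- A triangular system: multiplying by `a ^ (s - i) b ^ (m - j)` and reading off the top degree
isolates the coefficient of `aⁱ bʲ`. Larger powers of `a` vanish, smaller ones are settled by
induction, and the other `bʲ` have the wrong degree. -/
theorem coeff_eq_zero (c : Fin (s + 1) × Fin (m + 1) → ZMod 2)
    (hc : ∀ k l, (Lm K a ^ k) ((Lm K b ^ l)
      (∑ ij : Fin (s + 1) × Fin (m + 1), c ij • mon a b ij.1 ij.2)) (s + m) = 0) : c = 0 := by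
  suffices key : ∀ (i : ℕ) (hi : i < s + 1) (j : Fin (m + 1)), c (⟨i, hi⟩, j) = 0 from
    funext fun ij ↦ key ij.1 ij.1.2 ij.2
  intro i
  induction i using Nat.strong_induction_on with
  | _ i ih =>
    intro hi j
    have h1 := hc (s - i) (m - j)
    rw [map_sum, map_sum, Finset.sum_apply, Finset.sum_eq_single (⟨i, hi⟩, j)] at h1
    · rw [map_smul, map_smul, Lm_pow_mon_right, Lm_pow_mon_left,
        Nat.sub_add_cancel (show i ≤ s by omega), Nat.sub_add_cancel (show (j : ℕ) ≤ m by omega)] at h1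
      exact (smul_eq_zero.1 (show c (⟨i, hi⟩, j) • (mon a b s m (s + m)) = 0 from h1)).resolve_right
        h.top_apply
    · rintro ⟨i', j'⟩ _ hne
      rw [map_smul, map_smul, Lm_pow_mon_right, Lm_pow_mon_left]
      rcases lt_trichotomy (i' : ℕ) i with hlt | heq | hgt
      · rw [show c (i', j') = 0 from ih i' hlt i'.2 j', zero_smul]
        rfl
      · have hj : (j' : ℕ) ≠ j := fun hj ↦ hne (Prod.ext (Fin.ext heq) (Fin.ext hj))
        change c (i', j') • (mon a b _ _ (s + m)) = 0
        rw [homog_mon a b _ _ _ (by simp only; omega), smul_zero]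
      · change c (i', j') • (mon a b _ _ (s + m)) = 0
        rw [h.mon_eq_zero (by simp only; omega)]
        exact smul_zero _
    · intro h'
      exact absurd (Finset.mem_univ _) h'

theorem linearIndependent :
    LinearIndependent (ZMod 2) fun ij : Fin (s + 1) × Fin (m + 1) ↦ mon a b ij.1 ij.2 := by
  rw [Fintype.linearIndependent_iff]
  intro c hc
  refine congrFun (h.coeff_eq_zero c fun k l ↦ ?_)
  rw [hc, map_zero, map_zero]
  rfl

theorem exists_coeff (t : T K) : ∃ c : Fin (s + 1) × Fin (m + 1) → ZMod 2,
    ∑ ij : Fin (s + 1) × Fin (m + 1), c ij • mon a b ij.1 ij.2 = t := by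
  rw [← Submodule.mem_span_range_iff_exists_fun, h.span]
  trivial

theorem finrank_eq : Module.Finite (ZMod 2) (T K) ∧
    Module.finrank (ZMod 2) (T K) = (s + 1) * (m + 1) := by
  have B := Module.Basis.mk h.linearIndependent h.span.ge
  refine ⟨Module.Finite.of_basis B, ?_⟩
  rw [Module.finrank_eq_card_basis B]
  simp

/-- Nondegeneracy of the cup product. -/
theorem eq_zero_of_forall {n : ℕ} {t : T K} (ht : Homog n t)
    (h0 : ∀ k l, k + l + n = s + m → (Lm K a ^ k) ((Lm K b ^ l) t) = 0) : t = 0 := by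
  obtain ⟨c, rfl⟩ := h.exists_coeff t
  rw [h.coeff_eq_zero c]
  · simp
  · intro k l
    by_cases hkl : k + l + n = s + m
    · rw [h0 k l hkl]
      rfl
    · exact (ht.Lm_pow b l).Lm_pow a k _ (by omega)

theorem eq_zero_or_eq_top {t : T K} (ht : Homog (s + m) t) : t = 0 ∨ t = mon a b s m := by
  obtain ⟨c, hc⟩ := h.exists_coeff t
  have h1 : t (s + m) = c (Fin.last s, Fin.last m) • mon a b s m (s + m) := by
    rw [← hc, sum_smul_apply, Finset.sum_eq_single (Fin.last s, Fin.last m)]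
    · rfl
    · rintro ⟨i, j⟩ _ hne
      rw [homog_mon a b _ _ _ _, smul_zero]
      intro h'
      simp only at h'
      exact hne (Prod.ext (Fin.ext (by simp only [Fin.val_last]; omega))
        (Fin.ext (by simp only [Fin.val_last]; omega)))
    · intro h'
      exact absurd (Finset.mem_univ _) h'
  have h2 : ∀ x : ZMod 2, x = 0 ∨ x = 1 := by decide
  rcases h2 (c (Fin.last s, Fin.last m)) with h3 | h3
  · rw [h3, zero_smul] at h1
    exact Or.inl (ht.eq_zero h1)
  · rw [h3, one_smul] at h1
    right
    rw [← ht.single_apply, h1, (homog_mon a b s m).single_apply]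

end Milnor

theorem T_add_self (t : T K) : t + t = 0 := funext fun n ↦ H_add_self (t n)

theorem T_add_eq_zero_iff {t t' : T K} : t + t' = 0 ↔ t = t' := by
  constructor
  · intro h
    have := congrArg (· + t') h
    simpa only [add_assoc, T_add_self, add_zero, zero_add] using this
  · rintro rfl
    exact T_add_self _

/-- The relation in the symmetric case. -/
theorem Milnor.sum_mon_eq_zero_of_swap {a b : H K 1} {m : ℕ} (h : Milnor a b m (m + 1))
    (hb : Lm K b ^ (m + 2) = 0) (φ : K ⟶ K) (ha' : map φ 1 a = b) (hb' : map φ 1 b = a) :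
    ∑ i ∈ Finset.range (m + 2), mon a b i (m + 1 - i) = 0 := by
  set t := ∑ i ∈ Finset.range (m + 2), mon a b i (m + 1 - i) with ht
  have hom : Homog (m + 1) t := by
    intro n hn
    rw [ht, Finset.sum_apply]
    refine Finset.sum_eq_zero fun i hi ↦ homog_mon a b _ _ _ ?_
    rw [Finset.mem_range] at hi
    omega
  have hb0 : ∀ i j, m + 1 < j → mon a b i j = 0 := by
    intro i j hj
    rw [mon_swap, mon, ← Nat.sub_add_cancel (show m + 2 ≤ j from hj), pow_add, hb, mul_zero,
      LinearMap.zero_apply]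
  -- The product `(a + b) t` telescopes to `a ^ (m + 2) + b ^ (m + 2)`, which is zero.
  have hAB : Lm K a t = Lm K b t := by
    rw [ht, map_sum, map_sum]
    simp only [Lm_mon_left, Lm_mon_right]
    rw [Finset.sum_range_succ, Finset.sum_range_succ' (fun i ↦ mon a b i (m + 1 - i + 1)),
      h.mon_eq_zero (by omega), hb0 0 _ (by omega)]
    congr 1
    refine Finset.sum_congr rfl fun i hi ↦ ?_
    rw [Finset.mem_range] at hi
    congr 1
    omega
  have hpow : ∀ k, (Lm K b ^ k) t = (Lm K a ^ k) t := by
    intro k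
    induction k with
    | zero => rfl
    | succ k ih =>
      rw [pow_succ', pow_succ, Module.End.mul_apply, Module.End.mul_apply, ih, hAB]
      exact (Lm_pow_comm a b k 1 t).symm
  -- Only `aᵐ b ^ (m + 1)` and `a ^ (m + 1) bᵐ` survive. The symmetry exchanges them, and the top
  -- degree has a single nonzero class, so they are equal and cancel.
  have hτ : (Lm K a ^ m) t = 0 := by
    have h1 : (Lm K a ^ m) t = mon a b m (m + 1) + mon a b (m + 1) m := by
      rw [ht, map_sum, Finset.sum_eq_add_of_mem 0 1 (by simp) (by simp) (by omega)]
      · rw [Lm_pow_mon_left, Lm_pow_mon_left]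
        rfl
      · intro i _ hi
        rw [Lm_pow_mon_left]
        exact h.mon_eq_zero (by omega) _
    rw [h1, T_add_eq_zero_iff]
    have h2 : Tmap φ (mon a b (m + 1) m) = mon a b m (m + 1) := by
      rw [Tmap_mon, ha', hb', mon_swap]
    have h3 : Tmap φ (mon a b m (m + 1)) = mon a b (m + 1) m := by
      rw [Tmap_mon, ha', hb', mon_swap]
    rcases h.eq_zero_or_eq_top (t := mon a b m (m + 1)) (by
      rw [show m + 1 + m = m + (m + 1) by omega]
      exact homog_mon a b _ _) with h4 | h4
    · rw [h4, map_zero] at h3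
      exact absurd h3.symm h.top
    · exact h4
  -- Since `a t = b t`, every product of `t` with a monomial of complementary degree `m` equals `aᵐ
  -- t`; nondegeneracy then gives `t = 0`.
  refine h.eq_zero_of_forall hom fun k l hkl ↦ ?_
  rw [hpow, ← Module.End.mul_apply, ← pow_add, show k + l = m by omega, hτ]

end SSetMod2

/-! ## Pairs of orthogonal lines -/

section pairs

open Orb

variable {V : Type u} [NormedAddCommGroup V] [InnerProductSpace ℝ V]

/-- The sign of the first vector. -/
def sgnX (g : ℤˣ × ℤˣ) : ZMod 2 := sgn g.1

/-- The sign of the second vector. -/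
def sgnY (g : ℤˣ × ℤˣ) : ZMod 2 := sgn g.2

/-- The sign of the first vector, for the smaller group. -/
def sgnX' (g : ℤˣ × Unit) : ZMod 2 := sgn g.1

/-- An odd function of the first vector. -/
noncomputable def thetaX (W : Submodule ℝ V) (p : ZSet W) : ZMod 2 :=
  (exists_odd_sph V).choose ⟨p.1.1, p.2.1⟩

/-- An odd function of the second vector. -/
noncomputable def thetaY (W : Submodule ℝ V) (p : ZSet W) : ZMod 2 :=
  (exists_odd_sph V).choose ⟨p.1.2, p.2.2.1⟩

theorem odd_thetaX (W : Submodule ℝ V) : Odd sgnX (thetaX W) := fun g p ↦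
  odd_sph V g.1 ⟨p.1.1, p.2.1⟩

theorem odd_thetaY (W : Submodule ℝ V) : Odd sgnY (thetaY W) := fun g p ↦
  odd_sph V g.2 ⟨p.1.2, p.2.2.1⟩

theorem odd_thetaX' (W : Submodule ℝ V) : Odd sgnX' (thetaX W) := fun g p ↦
  odd_sph V g.1 ⟨p.1.1, p.2.1⟩

/-- The class of the first line. -/
noncomputable def zB (W : Submodule ℝ V) : H (Orb (ℤˣ × ℤˣ) (ZSet W)) 1 := charCls (odd_thetaX W)

/-- The class of the second line. -/
noncomputable def zA (W : Submodule ℝ V) : H (Orb (ℤˣ × ℤˣ) (ZSet W)) 1 := charCls (odd_thetaY W)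

theorem zB_pow {m : ℕ} (hV : Module.finrank ℝ V = m + 1) (W : Submodule ℝ V) :
    Lm _ (zB W) ^ (m + 1) = 0 := by
  have : FiniteDimensional ℝ V := Module.finite_of_finrank_pos (by omega)
  let b := Module.finBasisOfFinrankEq ℝ V hV
  refine charCls_pow_eq_zero_of_coords (odd_thetaX W) m.succ_pos (fun j p ↦ b.coord j p.1.1)
    (fun j ↦ (LinearMap.continuous_of_finiteDimensional (b.coord j)).comp
      (continuous_fst.comp continuous_subtype_val))
    (fun g ↦ ?_) fun p ↦ ?_
  · rcases units_smul_eq_or (V := V) g.1 with h | h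
    · exact Or.inl ⟨h.1, fun j p ↦ congrArg (b.coord j) (h.2 p.1.1)⟩
    · exact Or.inr ⟨h.1, fun j p ↦ (congrArg (b.coord j) (h.2 p.1.1)).trans (map_neg _ _)⟩
  · by_contra! h
    exact p.2.1 (b.forall_coord_eq_zero_iff.1 h)

theorem zA_pow {s : ℕ} [FiniteDimensional ℝ V] {W : Submodule ℝ V}
    (hW : Module.finrank ℝ W = s + 1) : Lm _ (zA W) ^ (s + 1) = 0 := by
  let b := Module.finBasisOfFinrankEq ℝ W hW
  refine charCls_pow_eq_zero_of_coords (odd_thetaY W) s.succ_pos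
    (fun j p ↦ b.coord j ⟨p.1.2, p.2.2.2.1⟩)
    (fun j ↦ (LinearMap.continuous_of_finiteDimensional (b.coord j)).comp
      ((continuous_snd.comp continuous_subtype_val).subtype_mk _))
    (fun g ↦ ?_) fun p ↦ ?_
  · rcases units_smul_eq_or (V := V) g.2 with h | h
    · exact Or.inl ⟨h.1, fun j p ↦ congrArg (b.coord j) (Subtype.ext (h.2 p.1.2))⟩
    · refine Or.inr ⟨h.1, fun j p ↦ Eq.trans ?_ (map_neg _ _)⟩
      exact congrArg (b.coord j) (Subtype.ext (h.2 p.1.2))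
  · by_contra! h
    exact p.2.2.1 (congrArg Subtype.val (b.forall_coord_eq_zero_iff.1 h))

theorem equivar_quot (W : Submodule ℝ V) :
    Equivar (ℤˣ × Unit) (ℤˣ × ℤˣ) (ContinuousMap.id (ZSet W)) :=
  fun g ↦ ⟨(g.1, 1), fun p ↦ Subtype.ext (Prod.ext rfl (one_smul ℤˣ p.1.2).symm)⟩

/-- The quotient by the sign of the second vector. -/
noncomputable def quotMap (W : Submodule ℝ V) : Orb (ℤˣ × Unit) (ZSet W) ⟶ Orb (ℤˣ × ℤˣ) (ZSet W) :=
  Orb.map _ (equivar_quot W)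

theorem thetaY_smul (W : Submodule ℝ V) (g : ℤˣ × Unit) (p : ZSet W) :
    thetaY W (g • p) = thetaY W p := rfl

theorem equivar_flip (W : Submodule ℝ V) : Equivar (ℤˣ × Unit) (ℤˣ × Unit)
    (⟨fun p ↦ ((1, -1) : ℤˣ × ℤˣ) • p, continuous_const_smul _⟩ : C(ZSet W, ZSet W)) := by
  intro g
  refine ⟨g, fun p ↦ Subtype.ext (Prod.ext ?_ rfl)⟩
  exact smul_comm (1 : ℤˣ) g.1 p.1.1

theorem doubleCover_Z (W : Submodule ℝ V) :
    DoubleCover (quotMap W) (Orb.map _ (equivar_flip W)) (pointCochain (thetaY_smul W)) := by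
  refine doubleCover (odd_thetaY W) (equivar_quot W) (thetaY_smul W) (1, -1) (by decide) rfl
    (fun g ↦ ⟨(g.1, ()), ?_⟩) (equivar_flip W)
  obtain ⟨g₁, g₂⟩ := g
  rcases Int.units_eq_one_or g₂ with rfl | rfl
  · exact Or.inl fun p ↦ Subtype.ext (Prod.ext rfl (one_smul ℤˣ p.1.2))
  · exact Or.inr fun p ↦ Subtype.ext (Prod.ext (one_smul ℤˣ (g₁ • p.1.1)).symm rfl)

theorem map_quotMap_zB (W : Submodule ℝ V) :
    SSetMod2.map (quotMap W) 1 (zB W) = charCls (odd_thetaX' W) :=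
  map_charCls _ _ _ _ fun g ↦ ⟨(g.1, 1), rfl, fun p ↦
    Subtype.ext (Prod.ext rfl (one_smul ℤˣ p.1.2).symm)⟩

theorem map_prX_rpCls (W : Submodule ℝ V) :
    SSetMod2.map (Orb.map (prX W) (equivar_prX W)) 1 (rpCls V) = charCls (odd_thetaX' W) :=
  map_charCls _ _ _ _ fun g ↦ ⟨g.1, rfl, fun _ ↦ rfl⟩

theorem Tmap_quotMap (W : Submodule ℝ V) (j : ℕ) :
    Tmap (quotMap W) ((Lm _ (zB W) ^ j) (T1 _)) = zPow W j := by
  rw [zPow, rpPow, Tmap_Lm_pow_T1, Tmap_Lm_pow_T1, map_quotMap_zB, map_prX_rpCls]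

/-- The double cover dividing by the sign of `y` has total dimension at most `2 * (m + 1)`, and the
powers of `b` restrict to `m + 1` independent classes, so they generate over the powers of `a`. The
cover has cohomology in degree `m + s`, hence so has the base, and `aˢ bᵐ` is the only monomial
there. -/
theorem milnor_Z {m s : ℕ} (hV : Module.finrank ℝ V = m + 2) (W : Submodule ℝ V)
    (hW : Module.finrank ℝ W = s + 1) : Milnor (zA W) (zB W) m s := by
  have : FiniteDimensional ℝ V := Module.finite_of_finrank_pos (by omega)
  obtain ⟨hf, hr, x, hx⟩ := z_cohomology hV s W hW
  obtain ⟨e, heW, he⟩ := exists_unit_mem hW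
  have D := doubleCover_Z W
  have hw := coboundary_pointCochain (odd_thetaY W) (equivar_quot W) (thetaY_smul W)
  have hspan := D.span_eq_top (w := ⟨_, charCochain_mem (odd_thetaY W)⟩) hw (zA_pow hW) hr
    (fun j ↦ (Lm _ (zB W) ^ (j : ℕ)) (T1 _)) (by
      simp only [Tmap_quotMap]
      exact linearIndependent_zPow hV he heW)
  have hspan : Submodule.span (ZMod 2) (Set.range fun ij : Fin (s + 1) × Fin (m + 1) ↦
    mon (zA W) (zB W) ij.1 ij.2) = ⊤ := hspan
  refine ⟨hspan, zA_pow hW, fun h0 ↦ ?_⟩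
  obtain ⟨y, hy⟩ := D.exists_ne_zero x (by
    rintro rfl
    rw [Pi.single_zero] at hx
    exact hx (Submodule.zero_mem _))
  apply hy
  have hmem : (Pi.single (m + s) y : T (Orb (ℤˣ × ℤˣ) (ZSet W))) ∈ Submodule.span (ZMod 2)
      (Set.range fun ij : Fin (s + 1) × Fin (m + 1) ↦ mon (zA W) (zB W) ij.1 ij.2) := by
    rw [hspan]
    trivial
  obtain ⟨c, hc⟩ := (Submodule.mem_span_range_iff_exists_fun _).1 hmem
  have h1 := congrFun hc (m + s)
  rw [sum_smul_apply, Pi.single_eq_same] at h1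
  rw [← h1]
  refine Finset.sum_eq_zero fun ij _ ↦ ?_
  by_cases hj : m + s = ij.1 + ij.2
  · have h2 : mon (zA W) (zB W) ij.1 ij.2 = 0 := by
      rw [show (ij.1 : ℕ) = s by omega, show (ij.2 : ℕ) = m by omega, h0]
    rw [h2]
    exact smul_zero _
  · rw [homog_mon _ _ _ _ _ hj, smul_zero]

/-- The exchange of the two vectors. -/
def swapZ (V : Type u) [NormedAddCommGroup V] [InnerProductSpace ℝ V] :
    C(ZSet (⊤ : Submodule ℝ V), ZSet (⊤ : Submodule ℝ V)) where
  toFun p := ⟨(p.1.2, p.1.1), p.2.2.1, p.2.1, trivial, (real_inner_comm _ _).trans p.2.2.2.2⟩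
  continuous_toFun := by fun_prop

theorem equivar_swapZ : Equivar (ℤˣ × ℤˣ) (ℤˣ × ℤˣ) (swapZ V) :=
  fun g ↦ ⟨(g.2, g.1), fun _ ↦ rfl⟩

theorem sum_mon_top {m : ℕ} (hV : Module.finrank ℝ V = m + 2) :
    ∑ i ∈ Finset.range (m + 2), mon (zA (⊤ : Submodule ℝ V)) (zB ⊤) i (m + 1 - i) = 0 := by
  refine (milnor_Z hV ⊤ (by rw [finrank_top, hV])).sum_mon_eq_zero_of_swap (zB_pow hV ⊤)
    (Orb.map (swapZ V) equivar_swapZ) ?_ ?_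
  · exact map_charCls _ _ _ _ fun g ↦ ⟨(g.2, g.1), rfl, fun _ ↦ rfl⟩
  · exact map_charCls _ _ _ _ fun g ↦ ⟨(g.2, g.1), rfl, fun _ ↦ rfl⟩

theorem zset_subset_top (W : Submodule ℝ V) : ZSet W ⊆ ZSet (⊤ : Submodule ℝ V) :=
  fun _ h ↦ ⟨h.1, h.2.1, trivial, h.2.2.2⟩

/-- The relation between the classes of the two lines. -/
theorem sum_mon_Z {m s : ℕ} (hV : Module.finrank ℝ V = m + 2) (W : Submodule ℝ V)
    (hW : Module.finrank ℝ W = s + 1) (hs : s ≤ m + 1) :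
    ∑ i ∈ Finset.range (s + 1), mon (zA W) (zB W) i (m + 1 - i) = 0 := by
  have : FiniteDimensional ℝ V := Module.finite_of_finrank_pos (by omega)
  let φ : Orb (ℤˣ × ℤˣ) (ZSet W) ⟶ Orb (ℤˣ × ℤˣ) (ZSet (⊤ : Submodule ℝ V)) :=
    Orb.map (inclMap (zset_subset_top W)) (equivar_of_smul fun _ _ ↦ rfl)
  have hA : SSetMod2.map φ 1 (zA ⊤) = zA W := map_charCls _ _ _ _ fun g ↦ ⟨g, rfl, fun _ ↦ rfl⟩
  have hB : SSetMod2.map φ 1 (zB ⊤) = zB W := map_charCls _ _ _ _ fun g ↦ ⟨g, rfl, fun _ ↦ rfl⟩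
  have h := congrArg (Tmap φ) (sum_mon_top hV)
  rw [map_sum, map_zero] at h
  simp only [Tmap_mon, hA, hB] at h
  rw [← h]
  -- After restriction to `W` the terms with `i > s` vanish, which truncates the sum.
  refine Finset.sum_subset (Finset.range_mono (by omega)) fun i _ hi ↦ ?_
  rw [Finset.mem_range] at hi
  exact (milnor_Z hV W hW).mon_eq_zero (by omega) _

end pairs

/-! ## Orbits of singular simplices and singular simplices of the quotient -/

namespace Orb

section toSing

variable {G : Type*} [Group G] {X Y : Type u} [TopologicalSpace X] [TopologicalSpace Y]
  [MulAction G X] [ContinuousConstSMul G X]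

/-- The map to the singular simplices of `Y` given by an invariant map `X → Y`. -/
noncomputable def toSing (ψ : C(X, Y)) (hψ : ∀ (g : G) x, ψ (g • x) = ψ x) :
    Orb G X ⟶ TopCat.toSSet.obj (TopCat.of Y) where
  app n := ↾(Quotient.lift (s := MulAction.orbitRel G C(stdSimplex ℝ (Fin (n.unop.len + 1)), X))
    (fun σ ↦ ((TopCat.of Y).toSSetObjEquiv n).symm (ψ.comp σ)) (by
      rintro _ σ ⟨g, rfl⟩
      exact congrArg _ (ContinuousMap.ext fun x ↦ hψ g (σ x))))
  naturality m n f := by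
    ext ⟨σ⟩
    exact (TopCat.toSSetObjEquiv_symm_naturality (X := TopCat.of Y) f.unop (ψ.comp σ)).symm

theorem toSing_app_mk (ψ : C(X, Y)) (hψ : ∀ (g : G) x, ψ (g • x) = ψ x) {n : ℕ}
    (σ : C(stdSimplex ℝ (Fin (n + 1)), X)) :
    (toSing ψ hψ).app (op (SimplexCategory.mk n)) (mk G σ) =
      ((TopCat.of Y).toSSetObjEquiv (op (SimplexCategory.mk n))).symm (ψ.comp σ) := rfl

/-- Existence and uniqueness of lifts up to the group make the map bijective on simplices, so no
homotopy argument is needed. -/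
theorem map_toSing_bijective (ψ : C(X, Y)) (hψ : ∀ (g : G) x, ψ (g • x) = ψ x)
    (hlift : ∀ n (τ : C(stdSimplex ℝ (Fin (n + 1)), Y)),
      ∃ σ : C(stdSimplex ℝ (Fin (n + 1)), X), ψ.comp σ = τ)
    (huniq : ∀ n (σ σ' : C(stdSimplex ℝ (Fin (n + 1)), X)), ψ.comp σ = ψ.comp σ' →
      ∃ g : G, g • σ' = σ) (n : ℕ) :
    Function.Bijective (SSetMod2.map (toSing ψ hψ) n) := by
  refine map_bijective_of_cochainMap_bijective _ (fun n ↦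
    cochainMap_bijective_of_bijective _ _ ⟨fun x y h ↦ ?_, fun τ ↦ ?_⟩) n
  · obtain ⟨σ, rfl⟩ := mk_surjective x
    obtain ⟨σ', rfl⟩ := mk_surjective y
    rw [toSing_app_mk, toSing_app_mk] at h
    exact (mk_eq_mk_iff _ _).2 (huniq n σ σ' (Equiv.injective _ h))
  · obtain ⟨σ, hσ⟩ := hlift n ((TopCat.of Y).toSSetObjEquiv (op (SimplexCategory.mk n)) τ)
    exact ⟨mk G σ, (toSing_app_mk _ _ _).trans (by rw [hσ, Equiv.symm_apply_apply])⟩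

end toSing

section id

variable {X : Type u} [TopologicalSpace X]

/-- The singular simplices of `X` are the orbits of the trivial group. -/
noncomputable def unitToSing (X : Type u) [TopologicalSpace X] :
    Orb Unit X ⟶ TopCat.toSSet.obj (TopCat.of X) :=
  toSing (ContinuousMap.id X) fun _ _ ↦ rfl

theorem map_unitToSing_bijective (n : ℕ) : Function.Bijective (SSetMod2.map (unitToSing X) n) :=
  map_toSing_bijective _ _ (fun _ τ ↦ ⟨τ, rfl⟩) (fun _ _ _ h ↦ ⟨1, h.symm⟩) n

end id

end Orb

/-! ## The covering of real projective space by the sphere -/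

section covering

/-- The unit sphere. -/
def USph (n : ℕ) : Set (EuclideanSpace ℝ (Fin (n + 1))) := {v | ‖v‖ = 1}

instance (n : ℕ) : InvSet ℤˣ (USph n) where
  smul_mem g v hv := by
    have hv' : ‖v‖ = 1 := hv
    rcases units_smul_eq_or (V := EuclideanSpace ℝ (Fin (n + 1))) g with h | h
    · rw [h.2]
      exact hv
    · rw [h.2]
      exact (norm_neg v).trans hv'

noncomputable instance (n : ℕ) : MulAction ℤˣ (USph n) := InvSet.mulAction (USph n)

instance (n : ℕ) : ContinuousConstSMul ℤˣ (USph n) := InvSet.continuousConstSMul (USph n)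

theorem ofLp_ne_zero {n : ℕ} {v : EuclideanSpace ℝ (Fin (n + 1))} (hv : ‖v‖ = 1) : v.ofLp ≠ 0 := by
  intro h
  have : v = 0 := (WithLp.ofLp_eq_zero 2).1 h
  rw [this, norm_zero] at hv
  exact zero_ne_one hv

/-- The line spanned by a unit vector. -/
noncomputable def lineOf (n : ℕ) (v : USph n) : RealProjectiveSpace n :=
  Projectivization.mk ℝ v.1.ofLp (ofLp_ne_zero v.2)

theorem continuous_lineOf (n : ℕ) : Continuous (lineOf n) := by
  have h : Continuous (fun v : {v : Fin (n + 1) → ℝ // v ≠ 0} ↦ Projectivization.mk' ℝ v) :=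
    continuous_coinduced_rng
  refine h.comp (f := fun v : USph n ↦ (⟨v.1.ofLp, ofLp_ne_zero v.2⟩ : {v : Fin (n + 1) → ℝ // v ≠ 0})) ?_
  exact ((PiLp.continuous_ofLp 2 _).comp continuous_subtype_val).subtype_mk _

theorem lineOf_eq_iff {n : ℕ} (v w : USph n) : lineOf n v = lineOf n w ↔ ∃ g : ℤˣ, g • w = v := by
  rw [lineOf, lineOf, Projectivization.mk_eq_mk_iff']
  have hv : ‖v.1‖ = 1 := v.2
  have hw : ‖w.1‖ = 1 := w.2
  constructor
  · rintro ⟨a, ha⟩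
    have ha' : a • w.1 = v.1 := congrArg (WithLp.toLp 2) ha
    have h1 : |a| = 1 := by
      rw [← ha', norm_smul, hw, mul_one] at hv
      exact hv
    rcases eq_or_eq_neg_of_abs_eq h1 with rfl | rfl
    · exact ⟨1, Subtype.ext ((one_smul ℤˣ w.1).trans ((one_smul ℝ w.1).symm.trans ha'))⟩
    · refine ⟨-1, Subtype.ext (Eq.trans ?_ ha')⟩
      change (-1 : ℤˣ) • w.1 = _
      rw [neg_smul, one_smul]
      exact Units.neg_smul _ _ |>.trans (by rw [one_smul])
  · rintro ⟨g, rfl⟩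
    rcases units_smul_eq_or (V := EuclideanSpace ℝ (Fin (n + 1))) g with h | h
    · refine ⟨1, ?_⟩
      rw [one_smul]
      exact congrArg WithLp.ofLp (h.2 w.1).symm
    · refine ⟨-1, ?_⟩
      rw [neg_smul, one_smul]
      exact congrArg WithLp.ofLp (h.2 w.1).symm

/-- Normalization followed by `lineOf` is the defining quotient map from nonzero vectors, and the
second factor of a quotient map is a quotient map. -/
theorem isQuotientMap_lineOf (n : ℕ) : Topology.IsQuotientMap (lineOf n) := by
  have hq : Topology.IsQuotientMap
      (fun v : {v : Fin (n + 1) → ℝ // v ≠ 0} ↦ Projectivization.mk' ℝ v) :=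
    ⟨⟨rfl⟩, Quotient.mk''_surjective⟩
  have hn : ∀ v : {v : Fin (n + 1) → ℝ // v ≠ 0}, ‖WithLp.toLp 2 v.1‖ ≠ 0 := fun v ↦
    norm_ne_zero_iff.2 fun h ↦ v.2 ((WithLp.toLp_eq_zero 2).1 h)
  let N : {v : Fin (n + 1) → ℝ // v ≠ 0} → USph n := fun v ↦
    ⟨‖WithLp.toLp 2 v.1‖⁻¹ • WithLp.toLp 2 v.1, by
      change ‖_‖ = (1 : ℝ)
      rw [norm_smul, norm_inv, norm_norm, inv_mul_cancel₀ (hn v)]⟩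
  have hN : Continuous N := by
    have h : Continuous fun v : {v : Fin (n + 1) → ℝ // v ≠ 0} ↦ (WithLp.toLp 2 v.1) :=
      (PiLp.continuous_toLp 2 _).comp continuous_subtype_val
    exact ((h.norm.inv₀ hn).smul h).subtype_mk _
  refine .of_comp hN (continuous_lineOf n) ?_
  convert hq using 1
  funext v
  exact (Projectivization.mk_eq_mk_iff' _ _ _ _ _).2 ⟨‖WithLp.toLp 2 v.1‖⁻¹, rfl⟩

/-- The open hemisphere around `v` is disjoint from its antipode. -/
theorem isCoveringMap_lineOf (n : ℕ) : IsCoveringMap (lineOf n) := by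
  have h : IsQuotientCoveringMap (lineOf n) ℤˣ :=
    { isQuotientMap_lineOf n with
      continuous_const_smul := continuous_const_smul
      apply_eq_iff_mem_orbit := fun {v w} ↦ lineOf_eq_iff v w
      disjoint := fun v ↦ by
        refine ⟨{x | 0 < inner ℝ x.1 v.1}, ?_, ?_⟩
        · refine (isOpen_lt continuous_const
            (continuous_subtype_val.inner continuous_const)).mem_nhds ?_
          have hv : ‖v.1‖ = 1 := v.2
          change 0 < inner ℝ v.1 v.1
          rw [real_inner_self_eq_norm_sq, hv, one_pow]
          exact one_pos
        · rintro g ⟨_, ⟨x, hx, rfl⟩, hx'⟩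
          rcases Int.units_eq_one_or g with rfl | rfl
          · rfl
          · have h1 : (0 : ℝ) < inner ℝ (-x.1) v.1 := by
              rcases units_smul_eq_or (V := EuclideanSpace ℝ (Fin (n + 1))) (-1) with h | h
              · exact absurd h.1 (by decide)
              · rw [← h.2]
                exact hx'
            rw [inner_neg_left] at h1
            have h2 : (0 : ℝ) < inner ℝ x.1 v.1 := hx
            linarith }
  exact h.isCoveringMap

theorem exists_lift_lineOf {n k : ℕ} (τ : C(stdSimplex ℝ (Fin (k + 1)), RealProjectiveSpace n)) :
    ∃ σ : C(stdSimplex ℝ (Fin (k + 1)), USph n), ∀ x, lineOf n (σ x) = τ x := by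
  have : ContractibleSpace (stdSimplex ℝ (Fin (k + 1))) :=
    (convex_stdSimplex ℝ (Fin (k + 1))).contractibleSpace ⟨_, (stdSimplex.vertex 0).2⟩
  have : LocallyPathConnectedSpace (stdSimplex ℝ (Fin (k + 1))) :=
    (convex_stdSimplex ℝ (Fin (k + 1))).locallyPathConnectedSpace
  obtain ⟨e, he⟩ := (isQuotientMap_lineOf n).surjective (τ (stdSimplex.vertex 0))
  obtain ⟨σ, ⟨-, hσ⟩, -⟩ := (isCoveringMap_lineOf n).existsUnique_continuousMap_lifts τ _ _ he
  exact ⟨σ, fun x ↦ congrFun hσ x⟩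

theorem lift_lineOf_unique {n k : ℕ} (σ σ' : C(stdSimplex ℝ (Fin (k + 1)), USph n))
    (h : ∀ x, lineOf n (σ x) = lineOf n (σ' x)) : ∃ g : ℤˣ, g • σ' = σ := by
  have : PreconnectedSpace (stdSimplex ℝ (Fin (k + 1))) :=
    isPreconnected_iff_preconnectedSpace.1 (convex_stdSimplex ℝ (Fin (k + 1))).isPreconnected
  let x₀ := stdSimplex.vertex (S := ℝ) (0 : Fin (k + 1))
  obtain ⟨g, hg⟩ := (lineOf_eq_iff _ _).1 (h x₀)
  refine ⟨g, DFunLike.coe_injective ?_⟩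
  refine (isCoveringMap_lineOf n).eq_of_comp_eq (map_continuous (g • σ')) (map_continuous σ) ?_ x₀ hg
  funext x
  exact ((lineOf_eq_iff _ _).2 ⟨g, rfl⟩).trans (h x).symm

end covering

/-! ## Isomorphisms of total cohomology -/

namespace SSetMod2

/-- A linear isomorphism of total cohomology compatible with the unit and with products with
classes of degree one. -/
structure TotalIso (K : SSet.{u}) (L : SSet.{v}) where
  /-- The isomorphism in degree one. -/
  one : H K 1 ≃ₗ[ZMod 2] H L 1
  /-- The isomorphism. -/
  total : T K ≃ₗ[ZMod 2] T L
  total_Lm (c : H K 1) (t : T K) : total (Lm K c t) = Lm L (one c) (total t)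
  total_T1 : total (T1 K) = T1 L

namespace TotalIso

variable {K : SSet.{u}} {L : SSet.{v}}

/-- The inverse. -/
def symm (e : TotalIso K L) : TotalIso L K where
  one := e.one.symm
  total := e.total.symm
  total_Lm c t := by
    rw [LinearEquiv.symm_apply_eq, e.total_Lm, LinearEquiv.apply_symm_apply,
      LinearEquiv.apply_symm_apply]
  total_T1 := by rw [LinearEquiv.symm_apply_eq, e.total_T1]

/-- The isomorphism induced by a map. -/
noncomputable def ofMap {K L : SSet.{u}} (φ : K ⟶ L)
    (hφ : ∀ n, Function.Bijective (map φ n)) : TotalIso L K where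
  one := LinearEquiv.ofBijective (map φ 1) (hφ 1)
  total := LinearEquiv.ofBijective (Tmap φ) (Tmap_bijective φ hφ)
  total_Lm c t := Tmap_Lm φ c t
  total_T1 := Tmap_T1 φ

theorem total_Lm_pow (e : TotalIso K L) (c : H K 1) (k : ℕ) (t : T K) :
    e.total ((Lm K c ^ k) t) = (Lm L (e.one c) ^ k) (e.total t) := by
  induction k with
  | zero => rfl
  | succ k ih => rw [pow_succ', pow_succ', Module.End.mul_apply, Module.End.mul_apply, e.total_Lm, ih]

theorem total_mon (e : TotalIso K L) (a b : H K 1) (i j : ℕ) :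
    e.total (mon a b i j) = mon (e.one a) (e.one b) i j := by
  rw [mon, mon, e.total_Lm_pow, e.total_Lm_pow, e.total_T1]

theorem Lm_pow_eq_zero (e : TotalIso K L) {c : H K 1} {k : ℕ} (h : Lm K c ^ k = 0) :
    Lm L (e.one c) ^ k = 0 := by
  apply LinearMap.ext
  intro t
  obtain ⟨t, rfl⟩ := e.total.surjective t
  rw [← e.total_Lm_pow, h, LinearMap.zero_apply, map_zero, LinearMap.zero_apply]

end TotalIso

/-- The structure of the cohomology algebra of a Milnor manifold. -/
structure MilnorAlg {K : SSet.{u}} (a b : H K 1) (m s : ℕ) : Prop extends Milnor a b m s where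
  pow' : Lm K b ^ (m + 2) = 0
  rel : ∑ i ∈ Finset.range (s + 1), mon a b i (m + 1 - i) = 0

theorem MilnorAlg.transport {K : SSet.{u}} {L : SSet.{v}} {a b : H K 1} {m s : ℕ}
    (h : MilnorAlg a b m s) (e : TotalIso K L) : MilnorAlg (e.one a) (e.one b) m s where
  span := by
    have h1 := congrArg (Submodule.map e.total.toLinearMap) h.span
    rw [Submodule.map_span, Submodule.map_top, LinearEquiv.range, ← Set.range_comp] at h1
    rw [← h1]
    congr 2
    funext ij
    exact (e.total_mon a b ij.1 ij.2).symm
  pow := e.Lm_pow_eq_zero h.pow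
  top := by
    rw [← e.total_mon]
    exact fun h0 ↦ h.top (e.total.map_eq_zero_iff.1 h0)
  pow' := e.Lm_pow_eq_zero h.pow'
  rel := by
    have h1 := congrArg e.total h.rel
    rw [map_sum, map_zero] at h1
    simpa only [e.total_mon] using h1

end SSetMod2

/-! ## The cohomology of real Milnor manifolds -/

section milnor

/-- Euclidean space of dimension `n + 1`. -/
abbrev Euc (n : ℕ) : Type := EuclideanSpace ℝ (Fin (n + 1))

variable {r s : ℕ}

/-- The projection to the first coordinates. -/
def restr (h : s ≤ r) : Euc r →ₗ[ℝ] Euc s where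
  toFun x := WithLp.toLp 2 fun i ↦ x (Fin.castLE (Nat.succ_le_succ h) i)
  map_add' _ _ := rfl
  map_smul' _ _ := rfl

/-- The extension by zero. -/
def extend : Euc s →ₗ[ℝ] Euc r where
  toFun y := WithLp.toLp 2 fun i ↦ if hi : (i : ℕ) < s + 1 then y ⟨i, hi⟩ else 0
  map_add' x y := by
    ext i
    change (if hi : (i : ℕ) < s + 1 then x ⟨i, hi⟩ + y ⟨i, hi⟩ else 0) =
      (if hi : (i : ℕ) < s + 1 then x ⟨i, hi⟩ else 0) + if hi : (i : ℕ) < s + 1 then y ⟨i, hi⟩ else 0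
    split_ifs
    · rfl
    · exact (add_zero 0).symm
  map_smul' c x := by
    ext i
    change (if hi : (i : ℕ) < s + 1 then c * x ⟨i, hi⟩ else 0) =
      c * if hi : (i : ℕ) < s + 1 then x ⟨i, hi⟩ else 0
    split_ifs
    · rfl
    · exact (mul_zero c).symm

theorem restr_extend (h : s ≤ r) (y : Euc s) : restr h (extend y) = y := by
  ext i
  exact dif_pos i.2

theorem inner_eq_sum {n : ℕ} (x y : Euc n) : inner ℝ x y = ∑ i, x i * y i := by
  rw [PiLp.inner_apply]
  exact Finset.sum_congr rfl fun i _ ↦ mul_comm _ _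

theorem inner_extend (h : s ≤ r) (x : Euc r) (y : Euc s) : inner ℝ x (extend y) = inner ℝ (restr h x) y := by
  rw [inner_eq_sum, inner_eq_sum]
  symm
  refine Fintype.sum_of_injective (Fin.castLE (Nat.succ_le_succ h))
    (Fin.castLE_injective _) _ _ (fun i hi ↦ ?_) fun i ↦ ?_
  · have : ¬ (i : ℕ) < s + 1 := fun hlt ↦ hi ⟨⟨i, hlt⟩, rfl⟩
    exact mul_eq_zero_of_right _ (dif_neg this)
  · exact congrArg (restr h x i * ·) (congrFun (congrArg WithLp.ofLp (restr_extend h y)) i).symm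

/-- The image of the smaller space. -/
def firstCoords (r s : ℕ) : Submodule ℝ (Euc r) := LinearMap.range (extend (r := r) (s := s))

theorem extend_restr (h : s ≤ r) {y : Euc r} (hy : y ∈ firstCoords r s) : extend (restr h y) = y := by
  obtain ⟨z, rfl⟩ := hy
  rw [restr_extend]

theorem finrank_firstCoords (h : s ≤ r) : Module.finrank ℝ (firstCoords r s) = s + 1 := by
  rw [firstCoords, LinearMap.finrank_range_of_inj
    (Function.LeftInverse.injective (restr_extend h)), finrank_euclideanSpace_fin]

/-- Pairs of orthogonal unit vectors. -/
def UnitPairs (h : s ≤ r) : Set (Euc r × Euc s) := {p | ‖p.1‖ = 1 ∧ ‖p.2‖ = 1 ∧ inner ℝ (restr h p.1) p.2 = (0 : ℝ)}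

theorem restr_smul (h : s ≤ r) (g : ℤˣ) (x : Euc r) : restr h (g • x) = g • restr h x := by
  rcases Int.units_eq_one_or g with rfl | rfl
  · rfl
  · rcases units_smul_eq_or (V := Euc r) (-1) with h1 | h1
    · exact absurd h1.1 (by decide)
    · rcases units_smul_eq_or (V := Euc s) (-1) with h2 | h2
      · exact absurd h2.1 (by decide)
      · rw [h1.2, h2.2, map_neg]

instance (h : s ≤ r) : InvSet (ℤˣ × ℤˣ) (UnitPairs h) where
  smul_mem g p hp := by
    obtain ⟨h1, h2, h3⟩ := hp
    rw [prodAction_smul]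
    have hn := fun {k : ℕ} (g : ℤˣ) (v : Euc k) (hv : v ∈ USph k) ↦ InvSet.smul_mem g hv
    refine ⟨hn g.1 p.1 h1, hn g.2 p.2 h2, ?_⟩
    change inner ℝ (restr h (g.1 • p.1)) (g.2 • p.2) = (0 : ℝ)
    rw [restr_smul]
    rcases units_smul_eq_or (V := Euc s) g.1 with h | h <;>
      rcases units_smul_eq_or (V := Euc s) g.2 with h' | h' <;> rw [h.2, h'.2] <;>
      simp only [inner_neg_left, inner_neg_right, h3, neg_zero]

noncomputable instance (h : s ≤ r) : MulAction (ℤˣ × ℤˣ) (UnitPairs h) :=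
  InvSet.mulAction (UnitPairs h)

instance (h : s ≤ r) : ContinuousConstSMul (ℤˣ × ℤˣ) (UnitPairs h) :=
  InvSet.continuousConstSMul (UnitPairs h)

theorem mem_realMilnorSet_iff (h : s ≤ r) (x : USph r) (y : USph s) :
    (lineOf r x, lineOf s y) ∈ realMilnorSet r s h ↔ inner ℝ (restr h x.1) y.1 = (0 : ℝ) := by
  rw [inner_eq_sum]
  exact mk_mem_realMilnorSet r s h _ _ _ _

/-- The pair of lines of a pair of unit vectors. -/
noncomputable def pairOfLines (h : s ≤ r) : C(UnitPairs h, RealMilnorManifold r s h) where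
  toFun p := ⟨(lineOf r ⟨p.1.1, p.2.1⟩, lineOf s ⟨p.1.2, p.2.2.1⟩),
    (mem_realMilnorSet_iff h _ _).2 p.2.2.2⟩
  continuous_toFun := by
    have := continuous_lineOf r
    have := continuous_lineOf s
    fun_prop

theorem pairOfLines_smul (h : s ≤ r) (g : ℤˣ × ℤˣ) (p : UnitPairs h) :
    pairOfLines h (g • p) = pairOfLines h p :=
  Subtype.ext (Prod.ext ((lineOf_eq_iff _ _).2 ⟨g.1, rfl⟩) ((lineOf_eq_iff _ _).2 ⟨g.2, rfl⟩))

/-- Orbits of simplices of pairs of unit vectors are the simplices of the Milnor manifold. -/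
noncomputable def unitPairsToSing (h : s ≤ r) : Orb (ℤˣ × ℤˣ) (UnitPairs h) ⟶
    TopCat.toSSet.obj (TopCat.of (RealMilnorManifold r s h)) :=
  Orb.toSing (pairOfLines h) (pairOfLines_smul h)

/-- The two components lift separately to the spheres; the incidence equation does not depend on the
chosen signs, so the lifted pair automatically lies in `UnitPairs`. -/
theorem map_unitPairsToSing_bijective (h : s ≤ r) (n : ℕ) :
    Function.Bijective (SSetMod2.map (unitPairsToSing h) n) := by
  refine Orb.map_toSing_bijective _ _ (fun k τ ↦ ?_) (fun k σ σ' hσ ↦ ?_) n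
  · obtain ⟨σ₁, h₁⟩ := exists_lift_lineOf
      ((ContinuousMap.fst.comp ⟨Subtype.val, continuous_subtype_val⟩).comp τ)
    obtain ⟨σ₂, h₂⟩ := exists_lift_lineOf
      ((ContinuousMap.snd.comp ⟨Subtype.val, continuous_subtype_val⟩).comp τ)
    have hm : ∀ x, ((σ₁ x).1, (σ₂ x).1) ∈ UnitPairs h := fun x ↦
      ⟨(σ₁ x).2, (σ₂ x).2, (mem_realMilnorSet_iff h _ _).1 (by
        rw [h₁, h₂]
        exact (τ x).2)⟩
    refine ⟨⟨fun x ↦ ⟨_, hm x⟩, by fun_prop⟩, ?_⟩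
    exact ContinuousMap.ext fun x ↦ Subtype.ext (Prod.ext (h₁ x) (h₂ x))
  · have h0 : ∀ x, pairOfLines h (σ x) = pairOfLines h (σ' x) := ContinuousMap.congr_fun hσ
    obtain ⟨g₁, hg₁⟩ := lift_lineOf_unique
      (⟨fun x ↦ ⟨(σ x).1.1, (σ x).2.1⟩, by fun_prop⟩ : C(stdSimplex ℝ (Fin (k + 1)), USph r))
      (⟨fun x ↦ ⟨(σ' x).1.1, (σ' x).2.1⟩, by fun_prop⟩ : C(stdSimplex ℝ (Fin (k + 1)), USph r))
      fun x ↦ congrArg (fun p ↦ p.1.1) (h0 x)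
    obtain ⟨g₂, hg₂⟩ := lift_lineOf_unique
      (⟨fun x ↦ ⟨(σ x).1.2, (σ x).2.2.1⟩, by fun_prop⟩ : C(stdSimplex ℝ (Fin (k + 1)), USph s))
      (⟨fun x ↦ ⟨(σ' x).1.2, (σ' x).2.2.1⟩, by fun_prop⟩ : C(stdSimplex ℝ (Fin (k + 1)), USph s))
      fun x ↦ congrArg (fun p ↦ p.1.2) (h0 x)
    refine ⟨(g₁, g₂), ContinuousMap.ext fun x ↦ Subtype.ext (Prod.ext ?_ ?_)⟩
    · exact congrArg Subtype.val (ContinuousMap.congr_fun hg₁ x)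
    · exact congrArg Subtype.val (ContinuousMap.congr_fun hg₂ x)

theorem norm_extend (h : s ≤ r) (y : Euc s) : ‖extend (r := r) y‖ = ‖y‖ := by
  rw [norm_eq_sqrt_real_inner, norm_eq_sqrt_real_inner, inner_extend h, restr_extend]

theorem extend_smul (g : ℤˣ) (y : Euc s) : extend (r := r) (g • y) = g • extend y := by
  rcases units_smul_eq_or (V := Euc s) g with h1 | h1 <;>
    rcases units_smul_eq_or (V := Euc r) g with h2 | h2
  · rw [h1.2, h2.2]
  · exact absurd (h1.1.symm.trans h2.1) (by decide)
  · exact absurd (h1.1.symm.trans h2.1) (by decide)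
  · rw [h1.2, h2.2, map_neg]


theorem continuous_extend : Continuous (extend (r := r) (s := s)) :=
  LinearMap.continuous_of_finiteDimensional _

theorem continuous_restr (h : s ≤ r) : Continuous (restr h) :=
  LinearMap.continuous_of_finiteDimensional _

/-- Pairs of unit vectors as pairs of nonzero vectors. -/
def unitPairsIncl (h : s ≤ r) : C(UnitPairs h, ZSet (firstCoords r s)) where
  toFun p := ⟨(p.1.1, extend p.1.2), by
    obtain ⟨h1, h2, h3⟩ := p.2
    refine ⟨norm_ne_zero_iff.1 (h1.trans_ne one_ne_zero),
      norm_ne_zero_iff.1 (((norm_extend h _).trans h2).trans_ne one_ne_zero), ⟨_, rfl⟩,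
      (inner_extend h _ _).trans h3⟩⟩
  continuous_toFun := by
    have := continuous_extend (r := r) (s := s)
    fun_prop

theorem unitPairsIncl_smul (h : s ≤ r) (g : ℤˣ × ℤˣ) (p : UnitPairs h) :
    unitPairsIncl h (g • p) = g • unitPairsIncl h p :=
  Subtype.ext (Prod.ext rfl (extend_smul g.2 p.1.2))

/-- Scaling a pair of vectors towards unit length. -/
noncomputable def scalePair (h : s ≤ r) (p : Euc r × Euc r) (t : ℝ) : Euc r × Euc r :=
  ((1 - t + t * ‖p.1‖⁻¹) • p.1, (1 - t + t * ‖restr h p.2‖⁻¹) • p.2)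

theorem norm_restr (h : s ≤ r) {y : Euc r} (hy : y ∈ firstCoords r s) : ‖restr h y‖ = ‖y‖ := by
  rw [← norm_extend h, extend_restr h hy]

theorem restr_ne_zero (h : s ≤ r) {p : Euc r × Euc r} (hp : p ∈ ZSet (firstCoords r s)) :
    ‖restr h p.2‖ ≠ 0 := by
  rw [norm_restr h hp.2.2.1]
  exact norm_ne_zero_iff.2 hp.2.1

theorem scale_pos {a t : ℝ} (ha : 0 ≤ a) (ha' : a ≠ 0) (ht : t ∈ Set.Icc (0 : ℝ) 1) :
    1 - t + t * a⁻¹ ≠ 0 := by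
  have h1 : 0 < a⁻¹ := inv_pos.2 (lt_of_le_of_ne ha ha'.symm)
  obtain ⟨h2, h3⟩ := ht
  rcases h2.eq_or_lt with rfl | h2
  · norm_num
  · have := mul_pos h2 h1
    linarith

theorem scalePair_mem (h : s ≤ r) {p : Euc r × Euc r} (hp : p ∈ ZSet (firstCoords r s))
    (t : unitInterval) : scalePair h p t ∈ ZSet (firstCoords r s) := by
  have h1 := scale_pos (norm_nonneg p.1) (norm_ne_zero_iff.2 hp.1) t.2
  have h2 := scale_pos (norm_nonneg (restr h p.2)) (restr_ne_zero h hp) t.2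
  refine ⟨smul_ne_zero h1 hp.1, smul_ne_zero h2 hp.2.1, Submodule.smul_mem _ _ hp.2.2.1, ?_⟩
  change inner ℝ ((1 - (t : ℝ) + t * ‖p.1‖⁻¹) • p.1)
    ((1 - (t : ℝ) + t * ‖restr h p.2‖⁻¹) • p.2) = (0 : ℝ)
  rw [inner_smul_left, inner_smul_right, hp.2.2.2, mul_zero, mul_zero]

theorem norm_units_smul {k : ℕ} (g : ℤˣ) (v : Euc k) : ‖g • v‖ = ‖v‖ := by
  rcases units_smul_eq_or (V := Euc k) g with h | h <;> rw [h.2]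
  exact norm_neg v

theorem scalePair_smul (h : s ≤ r) (g : ℤˣ × ℤˣ) (p : Euc r × Euc r) (t : ℝ) :
    scalePair h (g • p) t = g • scalePair h p t := by
  rw [prodAction_smul, prodAction_smul]
  refine Prod.ext ?_ ?_
  · change (1 - t + t * ‖g.1 • p.1‖⁻¹) • (g.1 • p.1) = g.1 • ((1 - t + t * ‖p.1‖⁻¹) • p.1)
    rw [norm_units_smul]
    rcases units_smul_eq_or (V := Euc r) g.1 with h | h <;> rw [h.2, h.2]
    exact smul_neg _ _
  · change (1 - t + t * ‖restr h (g.2 • p.2)‖⁻¹) • (g.2 • p.2) =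
      g.2 • ((1 - t + t * ‖restr h p.2‖⁻¹) • p.2)
    rw [restr_smul, norm_units_smul]
    rcases units_smul_eq_or (V := Euc r) g.2 with h | h <;> rw [h.2, h.2]
    exact smul_neg _ _

theorem continuous_scalePair (h : s ≤ r) :
    Continuous fun q : ZSet (firstCoords r s) × unitInterval ↦ scalePair h q.1.1 q.2 := by
  have hr := continuous_restr h
  have h1 : Continuous fun q : ZSet (firstCoords r s) × unitInterval ↦ ‖q.1.1.1‖⁻¹ :=
    Continuous.inv₀ (by fun_prop) fun q ↦ norm_ne_zero_iff.2 q.1.2.1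
  have h2 : Continuous fun q : ZSet (firstCoords r s) × unitInterval ↦ ‖restr h q.1.1.2‖⁻¹ :=
    Continuous.inv₀ (by fun_prop) fun q ↦ restr_ne_zero h q.1.2
  unfold scalePair
  fun_prop

/-- Normalization of a pair of vectors. -/
noncomputable def normalizePair (h : s ≤ r) : C(ZSet (firstCoords r s), UnitPairs h) where
  toFun p := ⟨((scalePair h p.1 1).1, restr h (scalePair h p.1 1).2), by
    have e : ∀ a : ℝ, 1 - 1 + 1 * a = a := fun a ↦ by ring
    refine ⟨?_, ?_, ?_⟩
    · change ‖(1 - 1 + 1 * ‖p.1.1‖⁻¹) • p.1.1‖ = 1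
      rw [e, norm_smul, norm_inv, norm_norm, inv_mul_cancel₀ (norm_ne_zero_iff.2 p.2.1)]
    · change ‖restr h ((1 - 1 + 1 * ‖restr h p.1.2‖⁻¹) • p.1.2)‖ = 1
      rw [e, map_smul, norm_smul, norm_inv, norm_norm, inv_mul_cancel₀ (restr_ne_zero h p.2)]
    · have hm := scalePair_mem h p.2 1
      change inner ℝ (restr h (scalePair h p.1 (1 : unitInterval)).1)
        (restr h (scalePair h p.1 (1 : unitInterval)).2) = (0 : ℝ)
      rw [← inner_extend, extend_restr h hm.2.2.1]
      exact hm.2.2.2⟩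
  continuous_toFun := by
    have hr := continuous_restr h
    have hs : Continuous fun p : ZSet (firstCoords r s) ↦ scalePair h p.1 1 :=
      (continuous_scalePair h).comp (f := fun p ↦ (p, 1)) (by fun_prop)
    exact ((continuous_fst.comp hs).prodMk (hr.comp (continuous_snd.comp hs))).subtype_mk _

theorem normalizePair_smul (h : s ≤ r) (g : ℤˣ × ℤˣ) (p : ZSet (firstCoords r s)) :
    normalizePair h (g • p) = g • normalizePair h p := by
  have h1 := scalePair_smul h g p.1 1
  refine Subtype.ext (Prod.ext (congrArg (fun q ↦ q.1) h1) ?_)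
  exact (congrArg (fun q ↦ restr h q.2) h1).trans (restr_smul h g.2 _)

/-- Rescaling both vectors to unit length is a deformation through orthogonal pairs and commutes
with both signs. -/
theorem map_unitPairsIncl_bijective (h : s ≤ r) (n : ℕ) :
    Function.Bijective (SSetMod2.map (Orb.map (unitPairsIncl h)
      (Orb.equivar_of_smul (unitPairsIncl_smul h))) n) := by
  refine Orb.map_bijective_of_retract (unitPairsIncl h) _ (normalizePair h)
    (Orb.equivar_of_smul (normalizePair_smul h)) (fun p ↦ ?_)
    ⟨fun q ↦ ⟨scalePair h q.1.1 q.2, scalePair_mem h q.1.2 q.2⟩,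
      (continuous_scalePair h).subtype_mk _⟩
    (fun g ↦ ⟨g, fun p t ↦ Subtype.ext (scalePair_smul h g p.1 t)⟩) (fun p ↦ ?_) (fun p ↦ ?_) n
  · have h1 : ‖p.1.1‖ = 1 := p.2.1
    have h2 : ‖p.1.2‖ = 1 := p.2.2.1
    refine Subtype.ext (Prod.ext ?_ ?_)
    · change (1 - 1 + 1 * ‖p.1.1‖⁻¹) • p.1.1 = p.1.1
      rw [h1]
      norm_num
    · change restr h ((1 - 1 + 1 * ‖restr h (extend p.1.2)‖⁻¹) • extend p.1.2) = p.1.2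
      rw [map_smul, restr_extend, h2]
      norm_num
  · refine Subtype.ext (Prod.ext ?_ ?_)
    · change (1 - (0 : ℝ) + 0 * ‖p.1.1‖⁻¹) • p.1.1 = p.1.1
      norm_num
    · change (1 - (0 : ℝ) + 0 * ‖restr h p.1.2‖⁻¹) • p.1.2 = p.1.2
      norm_num
  · refine Subtype.ext (Prod.ext rfl ?_)
    exact (extend_restr h (scalePair_mem h p.2 1).2.2.1).symm

/-- The cohomology of a real Milnor manifold. -/
theorem exists_milnorAlg {m s : ℕ} (h : s ≤ m + 1) :
    ∃ a b : Mod2Cohomology (RealMilnorManifold (m + 1) s h) 1, MilnorAlg a b m s := by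
  have hV : Module.finrank ℝ (Euc (m + 1)) = m + 2 := finrank_euclideanSpace_fin
  have hW := finrank_firstCoords h
  have hM : MilnorAlg (zA (firstCoords (m + 1) s)) (zB (firstCoords (m + 1) s)) m s :=
    { milnor_Z hV _ hW with
      pow' := zB_pow hV _
      rel := sum_mon_Z hV _ hW h }
  exact ⟨_, _, (hM.transport (TotalIso.ofMap _ (map_unitPairsIncl_bijective h))).transport
    (TotalIso.ofMap _ (map_unitPairsToSing_bijective h)).symm⟩

end milnor

/-! ## Involutions of the cohomology algebra of a Milnor manifold -/

namespace SSetMod2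

variable {K : SSet.{u}}

theorem nsmul_eq_zero_iff {t : T K} (ht : t ≠ 0) (n : ℕ) : n • t = 0 ↔ Even n := by
  have h2 : (2 : ℕ) • t = 0 := (two_nsmul t).trans (T_add_self t)
  have h3 : ∀ k : ℕ, (2 * k) • t = 0 := fun k ↦ by rw [mul_comm, mul_nsmul', h2, nsmul_zero]
  rcases Nat.even_or_odd' n with ⟨k, rfl | rfl⟩
  · exact ⟨fun _ ↦ even_two_mul k, fun _ ↦ h3 k⟩
  · rw [add_nsmul, h3, zero_add, one_nsmul]
    exact ⟨fun h ↦ absurd h ht, fun h ↦ absurd h (Nat.not_even_iff_odd.2 (odd_two_mul_add_one k))⟩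

theorem Lm_pow_add_eq_sum (a b : H K 1) (p q n : ℕ) :
    (Lm K a ^ p) ((Lm K b ^ q) ((Lm K (a + b) ^ n) (T1 K))) =
      ∑ j ∈ Finset.range (n + 1), n.choose j • mon a b (p + j) (q + (n - j)) := by
  rw [(Lm K).map_add, (Lm_commute a b).add_pow, LinearMap.sum_apply, map_sum, map_sum]
  refine Finset.sum_congr rfl fun j _ ↦ ?_
  have h : (Lm K a ^ j * Lm K b ^ (n - j) * (n.choose j : T K →ₗ[ZMod 2] T K)) (T1 K) =
      n.choose j • mon a b j (n - j) := by
    rw [(Nat.cast_commute (n.choose j) _).symm.eq, ← nsmul_eq_mul]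
    rfl
  rw [h, map_nsmul, map_nsmul, Lm_pow_mon_right, Lm_pow_mon_left]

theorem Lm_pow_mon_add (a b c : H K 1) (p q i j : ℕ) :
    (Lm K a ^ p) ((Lm K b ^ q) (mon a c i j)) =
      (Lm K a ^ (p + i)) ((Lm K b ^ q) ((Lm K c ^ j) (T1 K))) := by
  rw [mon, ← Lm_pow_comm a b i q, pow_add, Module.End.mul_apply]

namespace MilnorAlg

variable {a b : H K 1} {m s : ℕ} (h : MilnorAlg a b m s)
include h

/-- After multiplication by `a ^ (s - 1)` only the first two terms of the relation survive. -/
theorem mon_pred (p : ℕ) (hp : p + 1 = s) : mon a b p (m + 1) = mon a b s m := by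
  have h1 := congrArg (Lm K a ^ p) h.rel
  rw [map_sum, map_zero, ← hp, Finset.sum_range_succ', Finset.sum_range_succ',
    Finset.sum_eq_zero, zero_add] at h1
  · rw [T_add_eq_zero_iff, Lm_pow_mon_left, Lm_pow_mon_left] at h1
    rw [← hp]
    exact h1.symm
  · intro i _
    rw [Lm_pow_mon_left, h.mon_eq_zero (by omega)]

theorem mon_eq_zero_right (i : ℕ) {j : ℕ} (hj : m + 1 < j) : mon a b i j = 0 := by
  rw [mon_swap, mon, ← Nat.sub_add_cancel (show m + 2 ≤ j from hj), pow_add, h.pow', mul_zero,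
    LinearMap.zero_apply]

theorem Lm_pow_left_eq_zero {i : ℕ} (hi : s < i) (t : T K) : (Lm K a ^ i) t = 0 := by
  rw [← Nat.sub_add_cancel (show s + 1 ≤ i from hi), pow_add, h.pow, mul_zero, LinearMap.zero_apply]

theorem Lm_pow_add_top (q n : ℕ) :
    (Lm K a ^ s) ((Lm K b ^ q) ((Lm K (a + b) ^ n) (T1 K))) = mon a b s (q + n) := by
  rw [Lm_pow_add_eq_sum, Finset.sum_range_succ', Finset.sum_eq_zero, zero_add, Nat.choose_zero_right,
    one_nsmul]
  · rfl
  · intro j _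
    rw [h.mon_eq_zero (by omega), nsmul_zero]

/-- Two binomial terms survive, with coefficients `1` and `n + 1`, and both monomials equal the top
class; mod 2 the total is `n`. -/
theorem Lm_pow_add_pred (p : ℕ) (hp : p + 1 = s) (q n : ℕ) (hn : q + n = m) :
    (Lm K a ^ p) ((Lm K b ^ q) ((Lm K (a + b) ^ (n + 1)) (T1 K))) = n • mon a b s m := by
  rw [Lm_pow_add_eq_sum, Finset.sum_range_succ', Finset.sum_range_succ', Finset.sum_eq_zero,
    zero_add, Nat.choose_zero_right, one_nsmul, zero_add, Nat.choose_one_right, add_nsmul, one_nsmul,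
    Nat.add_sub_cancel, Nat.sub_zero, add_zero, hp, hn, show q + (n + 1) = m + 1 by omega,
    h.mon_pred p hp, add_assoc, T_add_self, add_zero]
  intro j _
  rw [h.mon_eq_zero (by omega), nsmul_zero]

/-- Of the three terms not killed by `a ^ (s + 1) = 0`, the one without a further factor `a`
contains `b ^ (m + 2) = 0`. -/
theorem Lm_pow_add_pred_pred (p : ℕ) (hp : p + 2 = s) (q n : ℕ) (hn : q + n = m) :
    (Lm K a ^ p) ((Lm K b ^ q) ((Lm K (a + b) ^ (n + 2)) (T1 K))) =
      ((n + 2).choose 2 + (n + 2)) • mon a b s m := by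
  rw [Lm_pow_add_eq_sum, Finset.sum_range_succ', Finset.sum_range_succ', Finset.sum_range_succ',
    Finset.sum_eq_zero]
  · rw [zero_add, zero_add, Nat.choose_one_right, h.mon_eq_zero_right (p + 0) (by omega),
      nsmul_zero, add_zero, hp, show q + (n + 2 - (1 + 1)) = m by omega,
      show q + (n + 2 - 1) = m + 1 by omega, h.mon_pred (p + 1) hp, ← add_nsmul]
  · intro j _
    rw [h.mon_eq_zero (by omega), nsmul_zero]

theorem exists_eq_smul_add_smul (c : H K 1) : ∃ x y : ZMod 2, x • a + y • b = c := by
  obtain ⟨e, he⟩ := h.exists_coeff (Pi.single 1 c)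
  have h1 := congrFun he 1
  rw [sum_smul_apply, Pi.single_eq_same] at h1
  rw [← Submodule.mem_span_pair, ← h1]
  refine Submodule.sum_mem _ fun ij _ ↦ Submodule.smul_mem _ _ ?_
  by_cases hij : 1 = (ij.1 : ℕ) + ij.2
  · obtain ⟨h2, h3⟩ | ⟨h2, h3⟩ : ((ij.1 : ℕ) = 0 ∧ (ij.2 : ℕ) = 1) ∨
      ((ij.1 : ℕ) = 1 ∧ (ij.2 : ℕ) = 0) := by omega
    · rw [h2, h3]
      have : mon a b 0 1 1 = b := (congrFun (Lm_T1 b) 1).trans (Pi.single_eq_same _ _)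
      rw [this]
      exact Submodule.subset_span (Set.mem_insert_of_mem _ rfl)
    · rw [h2, h3]
      have : mon a b 1 0 1 = a := (congrFun (Lm_T1 a) 1).trans (Pi.single_eq_same _ _)
      rw [this]
      exact Submodule.subset_span (Set.mem_insert _ _)
  · rw [homog_mon _ _ _ _ _ hij]
    exact Submodule.zero_mem _

theorem eq_or (c : H K 1) : c = 0 ∨ c = a ∨ c = b ∨ c = a + b := by
  obtain ⟨x, y, rfl⟩ := h.exists_eq_smul_add_smul c
  have h2 : ∀ x : ZMod 2, x = 0 ∨ x = 1 := by decide
  rcases h2 x with rfl | rfl <;> rcases h2 y with rfl | rfl <;> simp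

theorem left_ne_zero (hs : 1 ≤ s) : a ≠ 0 := by
  rintro rfl
  apply h.top
  rw [mon, map_zero, zero_pow (by omega), LinearMap.zero_apply]

theorem right_ne_zero (hm : 1 ≤ m) : b ≠ 0 := by
  rintro rfl
  apply h.top
  rw [mon, map_zero, zero_pow (by omega), LinearMap.zero_apply, map_zero]

/-- The automorphisms of the cohomology algebra are trivial, under suitable assumptions on the
degrees. -/
theorem fixes_generators (hs : 2 ≤ s) (hm : s ≤ m) (hr : ¬ m + 1 ≡ 2 [MOD 4])
    (he : Even ((s + 1) * (m + 1))) (φ : K ⟶ K) (hφ : Function.Injective (SSetMod2.map φ 1)) :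
    SSetMod2.map φ 1 a = a ∧ SSetMod2.map φ 1 b = b := by
  have hpow : (Lm K (SSetMod2.map φ 1 a) ^ (s + 1)) (T1 K) = 0 := by
    rw [← Tmap_Lm_pow_T1, h.pow, LinearMap.zero_apply, map_zero]
  have hrel : ∑ i ∈ Finset.range (s + 1),
      mon (SSetMod2.map φ 1 a) (SSetMod2.map φ 1 b) i (m + 1 - i) = 0 := by
    have h1 := congrArg (Tmap φ) h.rel
    rw [map_sum, map_zero] at h1
    simpa only [Tmap_mon] using h1
  have hne : ∀ c, c ≠ 0 → SSetMod2.map φ 1 c ≠ 0 := fun c hc h0 ↦ hc (hφ (h0.trans (map_zero _).symm))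
  obtain ⟨p, rfl⟩ := Nat.exists_eq_add_of_le' hs
  have ha : SSetMod2.map φ 1 a = a := by
    rcases h.eq_or (SSetMod2.map φ 1 a) with ha | ha | ha | ha
    · exact absurd ha (hne a (h.left_ne_zero (by omega)))
    · exact ha
    · exfalso
      rw [ha] at hpow
      apply h.top
      -- If `a ↦ b`, then `b ^ (s + 1) = 0`; since `s + 1 ≤ m + 1`, this kills `a ^ (s - 1) b ^ (m +
      -- 1)`, which is the top class.
      rw [← h.mon_pred (p + 1) rfl, mon, ← Nat.sub_add_cancel (show p + 2 + 1 ≤ m + 1 by omega),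
        pow_add (Lm K b), Module.End.mul_apply, hpow, map_zero, map_zero]
    · exfalso
      rw [ha] at hpow
      rcases hm.lt_or_eq with hlt | rfl
      -- For `s < m`, multiplying `(a + b) ^ (s + 1) = 0` by `aˢ b ^ (m - s - 1)` yields the top
      -- class.
      · have h1 := h.Lm_pow_add_top (m - (p + 2 + 1)) (p + 2 + 1)
        rw [hpow, map_zero, map_zero, Nat.sub_add_cancel hlt] at h1
        exact h.top h1.symm
      -- For `s = m`, multiplying by `a ^ (s - 1)` yields `m` times the top class. So `m` is even
      -- and `(s + 1) * (m + 1)` is odd, which is where the free action gives the contradiction.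
      · have h1 := h.Lm_pow_add_pred (p + 1) rfl 0 (p + 2) (zero_add _)
        rw [hpow, map_zero, map_zero] at h1
        have h2 := (nsmul_eq_zero_iff h.top _).1 h1.symm
        have h3 : Odd (p + 2 + 1) := h2.add_one
        exact Nat.not_even_iff_odd.2 (h3.mul h3) he
  refine ⟨ha, ?_⟩
  rcases h.eq_or (SSetMod2.map φ 1 b) with hb | hb | hb | hb
  · exact absurd hb (hne b (h.right_ne_zero (by omega)))
  · exfalso
    -- With `b = a` the top class would be `a ^ (s + m)`, which is zero since `m ≥ 1`.
    have hab : b = a := hφ (hb.trans ha.symm)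
    apply h.top
    have h0 := h.pow
    rw [hab, mon, ← Module.End.mul_apply, ← pow_add,
      show p + 2 + m = m - 1 + (p + 2 + 1) by omega, pow_add, h0, mul_zero, LinearMap.zero_apply]
  · exact hb
  · exfalso
    rw [ha, hb] at hrel
    obtain ⟨k, rfl⟩ := Nat.exists_eq_add_of_le' (show 1 ≤ m by omega)
    -- The image of the sum relation times `a ^ (s - 1)` has two surviving terms, contributing `m +
    -- 1 = r` times the top class.
    have e1 : Even (k + 1 + 1) := by
      have h1 := congrArg (fun t ↦ (Lm K a ^ (p + 1)) ((Lm K b ^ 0) t)) hrel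
      simp only [map_sum, map_zero, Lm_pow_mon_add] at h1
      rw [Finset.sum_range_succ', Finset.sum_range_succ', Finset.sum_eq_zero, zero_add] at h1
      · have h2 := h.Lm_pow_add_top 0 (k + 1)
        have h3 := h.Lm_pow_add_pred (p + 1) rfl 0 (k + 1) (zero_add _)
        rw [zero_add] at h2
        rw [← nsmul_eq_zero_iff h.top, add_comm, add_nsmul, one_nsmul, ← h3]
        exact (congrArg (· + _) h2.symm).trans h1
      · intro i _
        rw [h.Lm_pow_left_eq_zero (by omega)]
    -- Times `a ^ (s - 2) b` three terms survive; with `r = k + 2` even, this says that `r.choose 2`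
    -- is odd.
    have e2 : Even ((k + 2).choose 2 + (k + 2) + k + 1) := by
      have h1 := congrArg (fun t ↦ (Lm K a ^ p) ((Lm K b ^ 1) t)) hrel
      simp only [map_sum, map_zero, Lm_pow_mon_add] at h1
      rw [Finset.sum_range_succ', Finset.sum_range_succ', Finset.sum_range_succ',
        Finset.sum_eq_zero, zero_add] at h1
      · have h2 := h.Lm_pow_add_top 1 k
        have h3 := h.Lm_pow_add_pred (p + 1) rfl 1 k (add_comm _ _)
        have h4 := h.Lm_pow_add_pred_pred p rfl 1 k (add_comm _ _)
        rw [add_comm 1 k] at h2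
        rw [← nsmul_eq_zero_iff h.top, add_comm, add_comm _ k, add_nsmul, add_nsmul, one_nsmul, ← add_assoc,
          ← h3, ← h4]
        exact (congrArg (· + _ + _) h2.symm).trans h1
      · intro i _
        rw [h.Lm_pow_left_eq_zero (by omega)]
    obtain ⟨l, hl⟩ := e1
    rw [Nat.choose_two_right] at e2
    -- For `r = 2 l` the binomial coefficient is `l * (2 l - 1)`, so `l` is odd and `r ≡ 2 [MOD 4]`.
    have h2 : k + 2 = 2 * l := by omega
    rw [h2, mul_assoc, Nat.mul_div_cancel_left _ (by norm_num)] at e2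
    apply hr
    rcases Nat.even_or_odd' l with ⟨q, rfl | rfl⟩
    · exfalso
      obtain ⟨z, hz⟩ := e2
      rw [mul_assoc] at hz
      omega
    · change (k + 1 + 1) % 4 = 2 % 4
      omega

end MilnorAlg

end SSetMod2

/-! ## Free involutions of compact Hausdorff spaces -/

section free

open Orb

variable {X : Type u} [TopologicalSpace X]

/-- The parity of an element of the group of order two. -/
def parity (g : Multiplicative (ZMod 2)) : ZMod 2 := g.toAdd

theorem eq_one_or (g : Multiplicative (ZMod 2)) : g = 1 ∨ g = Multiplicative.ofAdd 1 := by
  have : ∀ g : ZMod 2, g = 0 ∨ g = 1 := by decide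
  exact this g

theorem continuousOn_indicator {t : X → X} (ht : Continuous t) {W : Set X} (hW : IsOpen W)
    (η : X → ZMod 2) (h0 : ∀ x ∈ W, η x = 0) (h1 : ∀ x, t x ∈ W → η x = 1) :
    ContinuousOn η {x | x ∈ W ∨ t x ∈ W} := by
  rintro x (hx | hx)
  · have : η =ᶠ[nhds x] fun _ ↦ 0 := by
      filter_upwards [hW.mem_nhds hx] with y hy
      exact h0 y hy
    exact (continuousAt_const.congr this.symm).continuousWithinAt
  · have : η =ᶠ[nhds x] fun _ ↦ 1 := by
      filter_upwards [(hW.preimage ht).mem_nhds hx] with y hy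
      exact h1 y hy
    exact (continuousAt_const.congr this.symm).continuousWithinAt

theorem exists_isOpen_notMem [T2Space X] {t : X → X} (ht : Continuous t) {x : X} (hx : t x ≠ x) :
    ∃ W : Set X, IsOpen W ∧ x ∈ W ∧ ∀ y ∈ W, t y ∉ W := by
  obtain ⟨U, V, hU, hV, hxU, hxV, hUV⟩ := t2_separation hx.symm
  exact ⟨U ∩ t ⁻¹' V, hU.inter (hV.preimage ht), ⟨hxU, hxV⟩,
    fun y hy hy' ↦ Set.disjoint_left.1 hUV hy'.1 hy.2⟩

variable [CompactSpace X] [T2Space X] [MulAction (Multiplicative (ZMod 2)) X]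
  [ContinuousConstSMul (Multiplicative (ZMod 2)) X]

/-- By the Hausdorff property each point has a neighbourhood `W` disjoint from its translate, and by
compactness finitely many suffice. On `W ∪ t W` the function that is `0` on `W` and `1` elsewhere is
odd and locally constant. -/
theorem exists_charCls_pow_eq_zero [Nonempty X]
    (hfree : ∀ x : X, Multiplicative.ofAdd (1 : ZMod 2) • x ≠ x) {θ : X → ZMod 2}
    (hθ : Odd parity θ) :
    ∃ N, Lm (Orb (Multiplicative (ZMod 2)) X) (charCls hθ) ^ N = 0 := by
  classical
  let t : X → X := fun x ↦ Multiplicative.ofAdd (1 : ZMod 2) • x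
  have ht : Continuous t := continuous_const_smul _
  have htt : ∀ x, t (t x) = x := fun x ↦ by
    change Multiplicative.ofAdd (1 : ZMod 2) • Multiplicative.ofAdd (1 : ZMod 2) • x = x
    rw [smul_smul]
    exact one_smul _ x
  choose W hW hxW hd using fun x ↦ exists_isOpen_notMem ht (hfree x)
  obtain ⟨S, hS⟩ := CompactSpace.elim_nhds_subcover W fun x ↦ (hW x).mem_nhds (hxW x)
  have hcov : ∀ x, ∃ j : Fin S.card, x ∈ W (S.equivFin.symm j) := by
    intro x
    have hx : x ∈ ⋃ y ∈ S, W y := by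
      rw [hS]
      trivial
    obtain ⟨y, hy, hxy⟩ := Set.mem_iUnion₂.1 hx
    exact ⟨S.equivFin ⟨y, hy⟩, by rwa [Equiv.symm_apply_apply]⟩
  have hN : 0 < S.card := (hcov (Classical.arbitrary X)).choose.pos
  refine ⟨S.card, charCls_pow_eq_zero' hN
    (fun j ↦ {x | x ∈ W (S.equivFin.symm j) ∨ t x ∈ W (S.equivFin.symm j)})
    (fun j x ↦ if x ∈ W (S.equivFin.symm j) then 0 else 1) (fun j ↦ ?_)
    (fun x ↦ (hcov x).imp fun _ ↦ Or.inl) (fun g j x hx ↦ ?_) (fun j g x hx ↦ ?_) (fun j ↦ ?_) hθ⟩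
  · exact (hW _).union ((hW _).preimage ht)
  · rcases eq_one_or g with rfl | rfl
    · rwa [one_smul]
    · refine hx.symm.imp id fun h ↦ ?_
      change t (t x) ∈ _
      rwa [htt]
  · rcases eq_one_or g with rfl | rfl
    · rw [one_smul]
      exact (add_zero _).symm
    · change (if t x ∈ _ then (0 : ZMod 2) else 1) = _ + 1
      rcases hx with hx | hx
      · rw [if_pos hx, if_neg (hd _ _ hx)]
        rfl
      · have hx' : x ∉ W (S.equivFin.symm j) := fun h ↦ hd _ _ h hx
        rw [if_pos hx, if_neg hx']
        rfl
  · exact continuousOn_indicator ht (hW _) _ (fun x hx ↦ if_pos hx)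
      fun x hx ↦ if_neg fun h ↦ hd _ _ h hx

/-- The total Betti number of a space with a free involution is even. -/
theorem even_finrank_of_free (hfree : ∀ x : X, Multiplicative.ofAdd (1 : ZMod 2) • x ≠ x)
    [Module.Finite (ZMod 2) (T (Orb Unit X))] : Even (Module.finrank (ZMod 2) (T (Orb Unit X))) := by
  rcases isEmpty_or_nonempty X with hX | hX
  · have := subsingleton_T (G := Unit) (X := X)
    rw [Module.finrank_zero_of_subsingleton]
    exact Even.zero
  obtain ⟨θ, hθ⟩ : ∃ θ : X → ZMod 2, Odd parity θ := by
    refine exists_odd (fun _ _ ↦ rfl) fun g x hg ↦ ?_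
    rcases eq_one_or g with rfl | rfl
    · rfl
    · exact absurd hg (hfree x)
  have hq : Equivar Unit (Multiplicative (ZMod 2)) (ContinuousMap.id X) :=
    fun _ ↦ ⟨1, fun x ↦ (one_smul _ x).symm⟩
  have hθ₁ : ∀ (g : Unit) (x : X), θ (g • x) = θ x := fun _ _ ↦ rfl
  have D := doubleCover hθ hq hθ₁ (Multiplicative.ofAdd 1) rfl rfl (fun g ↦ ⟨1, by
    rcases eq_one_or g with rfl | rfl
    · exact Or.inl fun x ↦ one_smul _ x
    · exact Or.inr fun x ↦ rfl⟩) (fun _ ↦ ⟨1, fun _ ↦ rfl⟩)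
  exact D.even_finrank (w := ⟨_, charCochain_mem hθ⟩) (coboundary_pointCochain hθ hq hθ₁)
    (exists_charCls_pow_eq_zero hfree hθ)

end free

/-! ## The theorem -/

namespace Mod2CohomologyIso

variable {X : Type u} [TopologicalSpace X] {Y : Type v} [TopologicalSpace Y]

/-- An isomorphism of cohomology algebras as an isomorphism of total cohomology. -/
noncomputable def totalIso (e : Mod2CohomologyIso X Y) :
    TotalIso (TopCat.toSSet.obj (TopCat.of Y)) (TopCat.toSSet.obj (TopCat.of X)) where
  one := e.toEquiv 1
  total := LinearEquiv.piCongrRight e.toEquiv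
  total_Lm c t := by
    funext n
    cases n with
    | zero => exact _root_.map_zero (e.toEquiv 0)
    | succ n => exact e.map_cup (add_comm 1 n) c (t n)
  total_T1 := by
    funext n
    by_cases hn : n = 0
    · subst hn
      exact e.map_one
    · have h0 : T1 (TopCat.toSSet.obj (TopCat.of Y)) n = 0 := Pi.single_eq_of_ne hn _
      have h1 : T1 (TopCat.toSSet.obj (TopCat.of X)) n = 0 := Pi.single_eq_of_ne hn _
      exact (congrArg (e.toEquiv n) h0).trans ((_root_.map_zero (e.toEquiv n)).trans h1.symm)

end Mod2CohomologyIso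

theorem proposition5p1 {X : Type u} [TopologicalSpace X] [CompactSpace X] [T2Space X]
    [AddAction (ZMod 2) X] [ContinuousConstVAdd (ZMod 2) X]
    (hfree : ∀ (g : ZMod 2) (x : X), g +ᵥ x = x → g = 0)
    (r s : ℕ) (hs : 1 < s) (hsr : s < r) (hr : ¬ r ≡ 2 [MOD 4])
    (hX : Nonempty (Mod2CohomologyIso X (RealMilnorManifold r s hsr.le)))
    (g : ZMod 2) (n : ℕ) :
    Mod2Cohomology.map (⟨fun x ↦ g +ᵥ x, continuous_const_vadd g⟩ : C(X, X)) n = LinearMap.id := by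
  obtain ⟨e⟩ := hX
  obtain ⟨m, rfl⟩ := Nat.exists_eq_add_of_le' (show 1 ≤ r by omega)
  obtain ⟨a, b, hM⟩ := exists_milnorAlg hsr.le
  replace hM := hM.transport e.totalIso
  generalize e.totalIso.one a = a' at hM
  generalize e.totalIso.one b = b' at hM
  -- The only use of freeness, compactness and the Hausdorff property: the total dimension of the
  -- cohomology of `X` is even.
  have heven : Even ((s + 1) * (m + 1)) := by
    have : ContinuousConstSMul (Multiplicative (ZMod 2)) X :=
      ⟨fun g ↦ continuous_const_vadd g.toAdd⟩
    have h1 := hM.transport (TotalIso.ofMap _ (Orb.map_unitToSing_bijective (X := X)))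
    obtain ⟨h2, h3⟩ := h1.finrank_eq
    rw [← h3]
    exact even_finrank_of_free fun x hx ↦ one_ne_zero (hfree 1 x hx)
  let t : ZMod 2 → C(X, X) := fun g ↦ ⟨fun x ↦ g +ᵥ x, continuous_const_vadd g⟩
  let φ := TopCat.toSSet.map (TopCat.ofHom (t g))
  have hφ : TopCat.toSSet.map (TopCat.ofHom (t (-g))) ≫ φ = 𝟙 _ := by
    have h1 : TopCat.ofHom (t (-g)) ≫ TopCat.ofHom (t g) = 𝟙 (TopCat.of X) := by
      ext x
      exact vadd_neg_vadd g x
    rw [← Functor.map_comp, h1, CategoryTheory.Functor.map_id]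
  have hinj : Function.Injective (SSetMod2.map φ 1) := by
    refine Function.LeftInverse.injective (g := SSetMod2.map (TopCat.toSSet.map (TopCat.ofHom (t (-g)))) 1)
      fun x ↦ ?_
    rw [← SSetMod2.map_comp, hφ, SSetMod2.map_id]
  obtain ⟨ha, hb⟩ := hM.fixes_generators hs (by omega) hr heven φ hinj
  -- The induced map is multiplicative on monomials in the generators, and these span all degrees at
  -- once.
  have hid : Tmap φ = LinearMap.id := by
    refine LinearMap.ext_on_range hM.span fun ij ↦ ?_
    rw [Tmap_mon, ha, hb]
    rfl
  apply LinearMap.ext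
  intro x
  have h1 := congrFun (LinearMap.congr_fun hid (Pi.single n x)) n
  rw [Tmap_single, LinearMap.id_apply, Pi.single_eq_same, Pi.single_eq_same] at h1
  exact h1
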